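/- **Conventions.** $H$ is a complex Hilbert space. For a compact operator $T$ on $H$, $\mu_1(T)\ge\mu_2(T)\ge\dots$ are the eigenvalues of $|T|$ counted with multiplicity (continued by $0$). $T\in\mathcal L^1$ means $\sum_n\mu_n(T)<\infty$; $T\in\mathcal L^{1,\infty}$ (resp. $\mathcal L^{1,\infty}_0$) means $\sum_{k\le n}\mu_k(T)=O(\log n)$ (resp. $o(\log n)$). $S_n(T)=\sum_{k>n}\mu_k(T)$ if $T\in\mathcal L^1$ and $S_n(T)=\sum_{k\le n}\mu_k(T)$ otherwise. $\mathrm{ord}(T)=\liminf_{n}\frac{\log\mu_n(T)}{\log(1/n)}$. A singular trace is a tracial weight on the positive operators of $B(H)$, with values in $[0,\infty]$, vanishing on finite rank projections; $\alpha>0$ is an exponent of singular traceability for $T$ if some singular trace takes the value $1$ on $|T|^{\alpha}$. A generalised limit is a positive linear functional on $\ell^\infty$ extending the limit on convergent sequences; it is dilation invariant if $\mathrm{Lim}(x_{2n})=\mathrm{Lim}(x_n)$. For a dilation invariant $\mathrm{Lim}_\omega$, the logarithmic Dixmier trace is $\mathrm{Tr}_\omega(B)=\mathrm{Lim}_\omega\big(\frac1{\log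 n}\sum_{k\le n}\mu_k(B)\big)$ for positive $B\in\mathcal L^{1,\infty}$ and $+\infty$ for other positive $B$. Weights are extended linearly to operators of finite weight. Let $(\mathcal A,D,H)$ be a spectral triple: $\mathcal A$ is a complex algebra acting on $H$ by bounded operators, $D$ is self-adjoint with compact resolvent, every $a\in\mathcal A$ preserves the domain of $D$ and $[D,a]$ is bounded there; assume $0$ is not an eigenvalue of $D$. Its dimension is $d(\mathcal A,D,H)=\inf\{\alpha>0:|D|^{-\alpha}\in\mathcal L^{1,\infty}_0\}$. The $\alpha$-dimensional Hausdorff functional is $H^\omega_\alpha(a)=\mathrm{Tr}_\omega(a|D|^{-\alpha})$; it is called non-trivial if $\mathrm{Tr}_\omega(|D|^{-\alpha})<\infty$ (so that it is finite on $\mathcal A$) and it is not identically zero on $\mathcal A$. For a positive compact $T$, a strictly increasing sequence $\nu=(n_k)$ and a generalised limit $\mathrm{Lim}_\eta$, let $\tau_{T,\nu,\eta}(B)=\mathrm{Lim}_\eta\big(S_{n_k}(B)/S_{n_k}(T)\big)$ for positive $B$ in the two-sided ideal generated by $T$, and $+\infty$ for other positive $B$. **Theorem.** Assume $d:=d(\mathcal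 A,D,H)\in(0,\infty)$. Then: (i) for every dilation invariant generalised limit $\omega$ and every $\alpha>0$, if $H^\omega_\alpha$ is non-trivial then $\alpha=d$; (ii) $d=\mathrm{ord}(D^{-1})^{-1}=\sup\{\gamma>0:|D|^{-\gamma}\notin\mathcal L^1\}$, and $d$ is an exponent of singular traceability for $D^{-1}$; (iii) let $\zeta(s)=\mathrm{Tr}(|D|^{-s})$, $s>d$, and suppose $(s-d)\zeta(s)\to L\in\mathbb R$ as $s\to d^+$. Put $T=|D|^{-d}$. Then (a) for every dilation invariant $\omega$, $\mathrm{Tr}_\omega(|D|^{-d})=L/d$ and $H^\omega_d(a)=\frac Ld\,\tau_{T,\mathrm{id},\omega}(a|D|^{-d})$ for all $a\in\mathcal A$; (b) for every generalised limit $\eta$ and every strictly increasing $\nu$ there is a dilation invariant $\omega$ such that $H^\omega_d(a)=\frac Ld\,\tau_{T,\nu,\eta}(a|D|^{-d})$ for all $a\in\mathcal A$; (c) if $L\neq0$, then for all such $\nu,\eta$ the functional $\tau_{T,\nu,\eta}$ is a singular trace with $\tau_{T,\nu,\eta}(|D|^{-d})=1$, so that $a\mapsto\tau_{T,\nu,\eta}(a|D|^{-d})$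 is a Hausdorff–Besicovitch functional. -/

import Mathlib

open Filter Topology Asymptotics
open scoped ENNReal NNReal ComplexStarModule

noncomputable section

namespace DixmierGeometry

variable {H : Type*} [NormedAddCommGroup H] [InnerProductSpace ℂ H] [CompleteSpace H]

/-! ### Eigenvalue sequences and ideals of compact operators -/

/-- The span of the eigenspaces of `|T| = (T* T)^{1/2}` for eigenvalues `≥ t`. Its dimension is the
number of eigenvalues of `|T|` that are `≥ t`, counted with multiplicity. -/
def spectralSubspace (T : H →L[ℂ] H) (t : ℝ) : Submodule ℂ H :=
  ⨆ κ ∈ Set.Ici t, Module.End.eigenspace ((CFC.abs T : H →L[ℂ] H) : H →ₗ[ℂ] H) (κ : ℂ)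

/-- For compact `T`: `mu T n` is the `(n+1)`-st term of the sequence of the eigenvalues of `|T|`,
arranged in non-increasing order and counted with multiplicity (so `mu T 0` is the largest one),
continued by zeros if there are only finitely many non-zero ones. It is the largest `t` such that at
least `n + 1` eigenvalues (with multiplicity) are `≥ t`. -/
def mu (T : H →L[ℂ] H) (n : ℕ) : ℝ :=
  sSup {t : ℝ | 0 ≤ t ∧ ((n + 1 : ℕ) : Cardinal) ≤ Module.rank ℂ (spectralSubspace T t)}

/-- The sum of the first `n` eigenvalues of `|T|`. -/
def partialSum (T : H →L[ℂ] H) (n : ℕ) : ℝ := ∑ k ∈ Finset.range n, mu T k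

/-- `T` belongs to the ideal `L^1` of trace class operators. -/
def IsTraceClass (T : H →L[ℂ] H) : Prop := IsCompactOperator T ∧ Summable (mu T)

/-- The trace of a positive trace class operator: the sum of its eigenvalues, with multiplicity. -/
def posTrace (T : H →L[ℂ] H) : ℝ := ∑' n, mu T n

/-- `T` belongs to the ideal `L^{1,∞}`: the sum of the first `n` eigenvalues is `O(log n)`. -/
def MemL1Inf (T : H →L[ℂ] H) : Prop :=
  IsCompactOperator T ∧ partialSum T =O[atTop] fun n : ℕ => Real.log n

/-- `T` belongs to the ideal `L_0^{1,∞}`: the sum of the first `n` eigenvalues is `o(log n)`. -/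
def MemL1InfZero (T : H →L[ℂ] H) : Prop :=
  IsCompactOperator T ∧ partialSum T =o[atTop] fun n : ℕ => Real.log n

open Classical in
/-- The integral sequence `S_n(T)`: partial sums of the eigenvalues of `|T|` if `T` is not trace
class, and tails of their sum if `T` is trace class. -/
def integralSeq (T : H →L[ℂ] H) (n : ℕ) : ℝ :=
  if IsTraceClass T then ∑' k, mu T (n + k) else partialSum T n

/-- The order of infinitesimal of a compact operator, `liminf_n log μ_n / log (1/n)`
(with `μ_1` the largest eigenvalue, hence the shift), as an extended real number. -/
def ord (T : H →L[ℂ] H) : EReal :=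
  liminf (fun n : ℕ => ENNReal.log (ENNReal.ofReal (mu T n)) /
    ((Real.log (1 / ((n : ℝ) + 1)) : ℝ) : EReal)) atTop

/-! ### Singular traces -/

/-- A singular trace on `B(H)`: a weight on the positive operators (with values in `[0,∞]`) that is
tracial and vanishes on finite rank projections. Values on non-positive operators are ignored. -/
structure IsSingularTrace (τ : (H →L[ℂ] H) → ℝ≥0∞) : Prop where
  map_add : ∀ S T : H →L[ℂ] H, 0 ≤ S → 0 ≤ T → τ (S + T) = τ S + τ T
  map_smul : ∀ (c : ℝ≥0) (T : H →L[ℂ] H), 0 ≤ T → τ (((c : ℝ) : ℂ) • T) = c * τ T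
  tracial : ∀ T : H →L[ℂ] H, τ (star T * T) = τ (T * star T)
  finiteRank : ∀ P : H →L[ℂ] H, IsStarProjection P →
    FiniteDimensional ℂ (LinearMap.range (P : H →ₗ[ℂ] H)) → τ P = 0

/-- `α` is an exponent of singular traceability for the compact operator `T`: some singular trace
takes the value `1` on `|T|^α`. -/
def IsExponentOfSingularTraceability (T : H →L[ℂ] H) (α : ℝ) : Prop :=
  0 < α ∧ ∃ τ : (H →L[ℂ] H) → ℝ≥0∞, IsSingularTrace τ ∧ τ (CFC.abs T ^ α) = 1

/-- The complex-linear extension of a weight to the operators with finite weight, computed from the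
decomposition `B = (Re B)⁺ - (Re B)⁻ + i ((Im B)⁺ - (Im B)⁻)`. -/
def linExt (φ : (H →L[ℂ] H) → ℝ≥0∞) (B : H →L[ℂ] H) : ℂ :=
  (((φ ((ℜ B : H →L[ℂ] H)⁺)).toReal - (φ ((ℜ B : H →L[ℂ] H)⁻)).toReal : ℝ) : ℂ) +
    Complex.I * (((φ ((ℑ B : H →L[ℂ] H)⁺)).toReal - (φ ((ℑ B : H →L[ℂ] H)⁻)).toReal : ℝ) : ℂ)

/-! ### Generalised limits and the traces built from them -/

/-- A generalised limit: a positive linear functional on `ℓ^∞` which agrees with the limit on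
convergent sequences. -/
structure GeneralizedLimit where
  toFun : lp (fun _ : ℕ => ℝ) ∞ →ₗ[ℝ] ℝ
  nonneg : ∀ x : lp (fun _ : ℕ => ℝ) ∞, (∀ n, 0 ≤ x n) → 0 ≤ toFun x
  limit : ∀ (x : lp (fun _ : ℕ => ℝ) ∞) (c : ℝ), Tendsto (fun n => x n) atTop (𝓝 c) → toFun x = c

open Classical in
/-- The value of a generalised limit on a bounded sequence (and `0` on unbounded ones). -/
def GeneralizedLimit.lim (ω : GeneralizedLimit) (x : ℕ → ℝ) : ℝ :=
  if h : Memℓp x ∞ then ω.toFun ⟨x, h⟩ else 0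

/-- Invariance under dilation, `Lim x_{2n} = Lim x_n`: the condition under which the logarithmic
Dixmier trace is additive. -/
def GeneralizedLimit.IsDilationInvariant (ω : GeneralizedLimit) : Prop :=
  ∀ x y : lp (fun _ : ℕ => ℝ) ∞, (∀ n, y n = x (2 * n)) → ω.toFun y = ω.toFun x

open Classical in
/-- The logarithmic Dixmier trace on positive operators:
`Tr_ω(B) = Lim_ω (∑_{k ≤ n} μ_k(B)) / log n` on `L^{1,∞}`, and `+∞` elsewhere. -/
def dixmierTrace (ω : GeneralizedLimit) (B : H →L[ℂ] H) : ℝ≥0∞ :=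
  if MemL1Inf B then ENNReal.ofReal (ω.lim fun n => partialSum B n / Real.log n) else ∞

open Classical in
/-- The functional `τ_ω` associated with a positive compact operator `T`, a sequence `n_k` and a
generalised limit: `τ_ω(B) = Lim_ω S_{n_k}(B) / S_{n_k}(T)` for positive `B` in the two-sided ideal
of `B(H)` generated by `T`, and `+∞` elsewhere. -/
def associatedTrace (T : H →L[ℂ] H) (ν : ℕ → ℕ) (ω : GeneralizedLimit) (B : H →L[ℂ] H) : ℝ≥0∞ :=
  if B ∈ TwoSidedIdeal.span ({T} : Set (H →L[ℂ] H)) then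
    ENNReal.ofReal (ω.lim fun k => integralSeq B (ν k) / integralSeq T (ν k)) else ∞

/-! ### Spectral triples -/

/-- `R` is the resolvent `(D - z)⁻¹` of the unbounded operator `D` at `z`. -/
def IsResolventAt (D : H →ₗ.[ℂ] H) (z : ℂ) (R : H →L[ℂ] H) : Prop :=
  (∀ x : H, ∃ h : R x ∈ D.domain, D ⟨R x, h⟩ - z • R x = x) ∧
    ∀ y : D.domain, R (D y - z • (y : H)) = y

/-- A spectral triple `(A, D, H)`, with `0` not an eigenvalue of `D`: an algebra acting on `H` and a
self-adjoint (in particular densely defined) operator `D` on `H` with compact resolvent, such that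
the commutators `[D, a]` are bounded. -/
structure SpectralTriple (A : Type*) [NonUnitalRing A] [Module ℂ A] [IsScalarTower ℂ A A]
    [SMulCommClass ℂ A A] (H : Type*) [NormedAddCommGroup H] [InnerProductSpace ℂ H]
    [CompleteSpace H] where
  π : A →ₙₐ[ℂ] (H →L[ℂ] H)
  D : H →ₗ.[ℂ] H
  selfAdjoint : IsSelfAdjoint D
  commutator_bounded : ∀ a : A, ∃ C : ℝ, ∀ x : D.domain,
    ∃ h : π a x ∈ D.domain, ‖D ⟨π a x, h⟩ - π a (D x)‖ ≤ C * ‖(x : H)‖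
  compact_resolvent : ∃ (z : ℂ) (R : H →L[ℂ] H), IsResolventAt D z R ∧ IsCompactOperator R
  zero_not_eigenvalue : ∀ x : D.domain, D x = 0 → (x : H) = 0

namespace SpectralTriple

variable {A : Type*} [NonUnitalRing A] [Module ℂ A] [IsScalarTower ℂ A A] [SMulCommClass ℂ A A]

/-- Since `0` is not an eigenvalue and the resolvent is compact, `D` has a bounded everywhere defined
inverse. -/
theorem exists_inverse (S : SpectralTriple A H) : ∃ T : H →L[ℂ] H, IsResolventAt S.D 0 T := by
  obtain ⟨z, R, ⟨h1, h2⟩, hR⟩ := S.compact_resolvent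
  rcases eq_or_ne z 0 with rfl | hz
  · exact ⟨R, h1, h2⟩
  have hz' : -z⁻¹ ≠ 0 := neg_ne_zero.mpr (inv_ne_zero hz)
  have hnot : ¬ Module.End.HasEigenvalue (R : Module.End ℂ H) (-z⁻¹) := by
    intro he
    obtain ⟨v, hv⟩ := he.exists_hasEigenvector
    have hRv : R v = -z⁻¹ • v := hv.apply_eq_smul
    obtain ⟨h, hx⟩ := h1 (-z • v)
    have hRw : R (-z • v) = v := by
      rw [map_smul, hRv, smul_smul]
      simp [hz]
    have hD : S.D ⟨R (-z • v), h⟩ = 0 := by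
      have h3 : S.D ⟨R (-z • v), h⟩ = -z • v + z • R (-z • v) := sub_eq_iff_eq_add.mp hx
      rw [h3, hRw]
      simp
    have h0 := S.zero_not_eigenvalue _ hD
    exact hv.2 (hRw.symm.trans h0)
  have hunit := (hR.hasEigenvalue_or_mem_resolventSet hz').resolve_left hnot
  rw [spectrum.mem_resolventSet_iff] at hunit
  have hU : IsUnit (1 + z • R) := by
    have h3 : (1 + z • R : H →L[ℂ] H) =
        (Units.mk0 (-z) (neg_ne_zero.mpr hz)) • (algebraMap ℂ (H →L[ℂ] H) (-z⁻¹) - R) := by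
      rw [Units.smul_def, Units.val_mk0, smul_sub, Algebra.algebraMap_eq_smul_one, smul_smul]
      simp [hz]
    rw [h3]
    exact hunit.smul _
  obtain ⟨U, hU⟩ := hU
  have hU1 : ∀ x, (U⁻¹ : (H →L[ℂ] H)ˣ).val (x + z • R x) = x := by
    intro x
    have h3 := congrArg (fun f : H →L[ℂ] H => f x) U.inv_mul
    simpa [hU] using h3
  have hU2 : ∀ x, (U⁻¹ : (H →L[ℂ] H)ˣ).val x + z • R ((U⁻¹ : (H →L[ℂ] H)ˣ).val x) = x := by
    intro x
    have h3 := congrArg (fun f : H →L[ℂ] H => f x) U.mul_inv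
    simpa [hU] using h3
  refine ⟨(U⁻¹ : (H →L[ℂ] H)ˣ).val * R, fun x => ?_, fun y => ?_⟩
  · obtain ⟨y, hy⟩ : ∃ y, (U⁻¹ : (H →L[ℂ] H)ˣ).val (R x) = y := ⟨_, rfl⟩
    have hy2 : y + z • R y = R x := hy ▸ hU2 (R x)
    have hy3 : R (x - z • y) = y := by
      rw [map_sub, map_smul, ← hy2]
      abel
    have hmul : ((U⁻¹ : (H →L[ℂ] H)ˣ).val * R) x = R (x - z • y) := by
      rw [hy3]
      exact hy
    rw [hmul]
    obtain ⟨h, hx⟩ := h1 (x - z • y)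
    refine ⟨h, ?_⟩
    have h3 := sub_eq_iff_eq_add.mp hx
    rw [h3, hy3]
    simp
  · have h3 := h2 y
    rw [map_sub, map_smul] at h3
    have h4 : R (S.D y) = (y : H) + z • R y := sub_eq_iff_eq_add.mp h3
    rw [zero_smul, sub_zero]
    change (U⁻¹ : (H →L[ℂ] H)ˣ).val (R (S.D y)) = y
    rw [h4]
    exact hU1 y

/-- The bounded operator `D⁻¹`. -/
def invD (S : SpectralTriple A H) : H →L[ℂ] H := S.exists_inverse.choose

theorem invD_spec (S : SpectralTriple A H) : IsResolventAt S.D 0 S.invD :=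
  S.exists_inverse.choose_spec

/-- The operator `|D|^{-s} = |D⁻¹|^s`, for `s > 0`. -/
def absPow (S : SpectralTriple A H) (s : ℝ) : H →L[ℂ] H := CFC.abs S.invD ^ s

/-- The (Hausdorff) dimension `inf {α > 0 : |D|^{-α} ∈ L_0^{1,∞}}`, in `[0,∞]`. -/
def dimension (S : SpectralTriple A H) : ℝ≥0∞ :=
  ⨅ (α : ℝ) (_ : 0 < α ∧ MemL1InfZero (S.absPow α)), ENNReal.ofReal α

/-- The zeta function `s ↦ Tr(|D|^{-s})`. -/
def zeta (S : SpectralTriple A H) (s : ℝ) : ℝ := posTrace (S.absPow s)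

/-- The `α`-dimensional Hausdorff functional `a ↦ Tr_ω(a |D|^{-α})`. -/
def hausdorffFunctional (S : SpectralTriple A H) (ω : GeneralizedLimit) (α : ℝ) (a : A) : ℂ :=
  linExt (dixmierTrace ω) (S.π a * S.absPow α)

/-- The `α`-dimensional Hausdorff functional is non-trivial: it is a finite functional, i.e.
`Tr_ω(|D|^{-α}) < ∞` (so that `a |D|^{-α}` is in the domain of `Tr_ω` for every `a`), and it is not
identically zero on the algebra. -/
def HausdorffNontrivial (S : SpectralTriple A H) (ω : GeneralizedLimit) (α : ℝ) : Prop :=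
  dixmierTrace ω (S.absPow α) < ∞ ∧ ∃ a : A, S.hausdorffFunctional ω α a ≠ 0

/-- The Hausdorff–Besicovitch functional `a ↦ τ(a |D|^{-α})` defined by a trace `τ`. -/
def besicovitchFunctional (S : SpectralTriple A H) (τ : (H →L[ℂ] H) → ℝ≥0∞) (α : ℝ) (a : A) : ℂ :=
  linExt τ (S.π a * S.absPow α)

end SpectralTriple

end DixmierGeometry

end

set_option linter.unusedSectionVars false

noncomputable section

namespace DixmierGeometry

variable {H : Type*} [NormedAddCommGroup H] [InnerProductSpace ℂ H] [CompleteSpace H]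

/-! ### Factorisation of operators -/

/-! Everything is read off the eigenvalue sequence. On an infinite-dimensional space, `mu T n` is
the least bound for a compact `T` on the orthogonal complement of a subspace of dimension at most
`n` (`exists_forall_orthogonal_norm_le`, `mu_le_of_forall_orthogonal`). This controls `mu` under
sums and products, and for injective `T` the eigenvalues of `|T|^s` are the powers `mu T n ^ s`
(`mu_abs_rpow`).

Critical exponent. If the partial sums of `μ_n^α` are `O(log n)`, then `μ_n^γ` is summable for every
`γ > α`, while a summable sequence has partial sums `o(log n)`. Hence `|D|^{-γ}` is trace class for
`γ > d` and is not for `γ < d`. The formulas for `d` follow, and so does (i): above `d` Dixmier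
traces vanish on the ideal of `|D|^{-α}`, below `d` they are infinite on `|D|^{-α}`.

Singular traces. Ky Fan's principle gives `S_n(A+B) ≤ S_n(A) + S_n(B) ≤ S_{2n}(A+B)` for partial
sums of positive operators, so additivity of `S_n` fails by at most the eigenvalues with index
between `n` and `2n`. If such blocks are negligible against `S_n(T)` along a sequence
(`IsEccentricAlong`), the generalised limit of `S_n(B)/S_n(T)` is a singular trace. For `T =
|D|^{-d}` a sequence of this kind always exists: otherwise the partial sums would grow, or the tails
decay, like a power, against criticality of `d` (`exists_isEccentricAlong`).

Residue. A Tauberian argument of Karamata turns `(s-d) ζ(s) → L` into `S_n(T) ~ (L/d) log n` for the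
partial sums (`tendsto_sum_div_log`). For `L ≠ 0`, dividing by `log n` or by `S_n(T)` then differs
by the factor `L/d`, which compares the Dixmier trace of `ω` with the trace associated with the
identity sequence and `ω`. Given `ν` and `η`, a dilation invariant `ω` is made by averaging over `n,
2n, 4n, …` before restricting to `ν` and applying `η`: the number of dilates tends to infinity,
which forces invariance, but is `o(log n)`, so the logarithmic means of operators in the ideal do
not change (`tendsto_dilationMean_sub`). For `L = 0` both sides vanish. -/

open scoped InnerProductSpace in
/-- Douglas' lemma: an operator dominated in norm by `c * ‖B ·‖` factors through `B`. -/
theorem exists_factor_of_norm_le {A B : H →L[ℂ] H} {c : ℝ} (hc : 0 ≤ c)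
    (h : ∀ x, ‖A x‖ ≤ c * ‖B x‖) : ∃ C : H →L[ℂ] H, ‖C‖ ≤ c ∧ A = C * B := by
  let K : Submodule ℂ H := (LinearMap.range (B : H →ₗ[ℂ] H)).topologicalClosure
  have : CompleteSpace K := (Submodule.isClosed_topologicalClosure _).completeSpace_coe
  have hBK : ∀ x, B x ∈ K := fun x => Submodule.le_topologicalClosure _ ⟨x, rfl⟩
  let e : H →ₗ[ℂ] K := (B : H →ₗ[ℂ] H).codRestrict K hBK
  have hdense : DenseRange e := by
    intro y
    rw [closure_subtype]
    have hy : (y : H) ∈ closure (Set.range B) := by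
      have := y.2
      rwa [← SetLike.mem_coe, Submodule.topologicalClosure_coe] at this
    convert hy using 2
    ext z
    constructor
    · rintro ⟨w, ⟨x, rfl⟩, rfl⟩
      exact ⟨x, rfl⟩
    · rintro ⟨x, rfl⟩
      exact ⟨e x, ⟨x, rfl⟩, rfl⟩
  have hn : ∀ x, ‖(A : H →ₗ[ℂ] H) x‖ ≤ c * ‖e x‖ := h
  let G : K →L[ℂ] H := (A : H →ₗ[ℂ] H).extendOfNorm e
  refine ⟨G ∘L K.orthogonalProjectionOnto, ?_, ?_⟩
  · refine ContinuousLinearMap.opNorm_le_bound _ hc fun x => ?_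
    calc ‖G (K.orthogonalProjectionOnto x)‖ ≤ c * ‖K.orthogonalProjectionOnto x‖ :=
          LinearMap.norm_extendOfNorm_apply_le hdense c hn _
      _ ≤ c * ‖x‖ := by
          gcongr
          exact Submodule.norm_orthogonalProjectionOnto_apply_le K x
  · ext x
    have h1 : K.orthogonalProjectionOnto (B x) = e x :=
      Submodule.orthogonalProjectionOnto_mem_subspace_eq_self (e x)
    change A x = G (K.orthogonalProjectionOnto (B x))
    rw [h1]
    exact (LinearMap.extendOfNorm_eq hdense ⟨c, hn⟩ x).symm

/-- Both squared norms equal `⟨x, T* T x⟩`. With Douglas' lemma this replaces the polar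
decomposition: contractions in both directions suffice, no partial isometry is needed. -/
theorem norm_abs_apply (T : H →L[ℂ] H) (x : H) : ‖(CFC.abs T : H →L[ℂ] H) x‖ = ‖T x‖ := by
  have hs : star (CFC.abs T : H →L[ℂ] H) = CFC.abs T := (CFC.abs_nonneg T).isSelfAdjoint
  have key : inner ℂ ((CFC.abs T : H →L[ℂ] H) x) ((CFC.abs T : H →L[ℂ] H) x)
      = inner ℂ (T x) (T x) := by
    rw [← ContinuousLinearMap.adjoint_inner_right, ← ContinuousLinearMap.adjoint_inner_right T,
      ← ContinuousLinearMap.star_eq_adjoint, ← ContinuousLinearMap.star_eq_adjoint, hs]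
    exact congrArg (fun f : H →L[ℂ] H => inner ℂ x (f x)) (CFC.abs_mul_abs T)
  rw [inner_self_eq_norm_sq_to_K, inner_self_eq_norm_sq_to_K] at key
  have k2 : ‖(CFC.abs T : H →L[ℂ] H) x‖ ^ 2 = ‖T x‖ ^ 2 := by exact_mod_cast key
  exact (sq_eq_sq₀ (norm_nonneg _) (norm_nonneg _)).mp k2

theorem exists_eq_mul_abs (T : H →L[ℂ] H) : ∃ U : H →L[ℂ] H, ‖U‖ ≤ 1 ∧ T = U * CFC.abs T :=
  exists_factor_of_norm_le zero_le_one fun x => by rw [norm_abs_apply, one_mul]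

theorem exists_abs_eq_mul (T : H →L[ℂ] H) : ∃ U : H →L[ℂ] H, ‖U‖ ≤ 1 ∧ CFC.abs T = U * T :=
  exists_factor_of_norm_le zero_le_one fun x => by rw [norm_abs_apply, one_mul]

/-- From `T = U |T|` and `|T| = V T` one gets `T* = |T| U* = V T U*`. Hence two-sided ideals are
self-adjoint. -/
theorem exists_star_eq_mul_mul (T : H →L[ℂ] H) :
    ∃ U V : H →L[ℂ] H, ‖U‖ ≤ 1 ∧ ‖V‖ ≤ 1 ∧ star T = U * T * V := by
  obtain ⟨U, hU, h1⟩ := exists_eq_mul_abs T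
  obtain ⟨V, hV, h2⟩ := exists_abs_eq_mul T
  refine ⟨V, star U, hV, by rwa [norm_star], ?_⟩
  have hs : star (CFC.abs T : H →L[ℂ] H) = CFC.abs T := (CFC.abs_nonneg T).isSelfAdjoint
  calc star T = star (U * CFC.abs T) := by rw [← h1]
    _ = V * T * star U := by rw [star_mul, hs, ← h2]

/-- This is the source of traciality: whatever decreases under compression by contractions agrees on
`T* T` and `T T*`. -/
theorem exists_mul_star_eq (T : H →L[ℂ] H) :
    ∃ U : H →L[ℂ] H, ‖U‖ ≤ 1 ∧ T * star T = U * (star T * T) * star U := by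
  obtain ⟨U, hU, h1⟩ := exists_eq_mul_abs T
  refine ⟨U, hU, ?_⟩
  have hs : star (CFC.abs T : H →L[ℂ] H) = CFC.abs T := (CFC.abs_nonneg T).isSelfAdjoint
  calc T * star T = (U * CFC.abs T) * star (U * CFC.abs T) := by rw [← h1]
    _ = U * (CFC.abs T * CFC.abs T) * star U := by rw [star_mul, hs]; simp only [mul_assoc]
    _ = _ := by rw [CFC.abs_mul_abs]

theorem norm_sqrt_apply_sq {S : H →L[ℂ] H} (hS : 0 ≤ S) (x : H) :
    ‖(CFC.sqrt S : H →L[ℂ] H) x‖ ^ 2 = (inner ℂ x (S x) : ℂ).re := by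
  have hs : star (CFC.sqrt S : H →L[ℂ] H) = CFC.sqrt S := (CFC.sqrt_nonneg S).isSelfAdjoint
  have key : inner ℂ ((CFC.sqrt S : H →L[ℂ] H) x) ((CFC.sqrt S : H →L[ℂ] H) x)
      = inner ℂ x (S x) := by
    rw [← ContinuousLinearMap.adjoint_inner_right, ← ContinuousLinearMap.star_eq_adjoint, hs]
    exact congrArg (fun f : H →L[ℂ] H => inner ℂ x (f x)) (CFC.sqrt_mul_sqrt_self S hS)
  rw [← key, inner_self_eq_norm_sq_to_K]
  norm_cast

/-- A positive operator below `R` is of the form `C R C*` with a contraction `C`. -/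
theorem exists_eq_conj_of_le {S R : H →L[ℂ] H} (hS : 0 ≤ S) (hSR : S ≤ R) :
    ∃ C : H →L[ℂ] H, ‖C‖ ≤ 1 ∧ S = C * R * star C := by
  have hR : 0 ≤ R := hS.trans hSR
  obtain ⟨C, hC, h⟩ := exists_factor_of_norm_le (A := CFC.sqrt S) (B := CFC.sqrt R)
    zero_le_one fun x => by
      rw [one_mul, ← sq_le_sq₀ (norm_nonneg _) (norm_nonneg _), norm_sqrt_apply_sq hS,
        norm_sqrt_apply_sq hR]
      have h1 := ((ContinuousLinearMap.nonneg_iff_isPositive _).mp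
        (sub_nonneg.mpr hSR)).re_inner_nonneg_right x
      rw [sub_apply, inner_sub_right, map_sub] at h1
      exact sub_nonneg.mp h1
  refine ⟨C, hC, ?_⟩
  have hs : star (CFC.sqrt R : H →L[ℂ] H) = CFC.sqrt R := (CFC.sqrt_nonneg R).isSelfAdjoint
  have hs' : star (CFC.sqrt S : H →L[ℂ] H) = CFC.sqrt S := (CFC.sqrt_nonneg S).isSelfAdjoint
  calc S = CFC.sqrt S * star (CFC.sqrt S) := by rw [hs', CFC.sqrt_mul_sqrt_self S hS]
    _ = C * (CFC.sqrt R * CFC.sqrt R) * star C := by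
      rw [h, star_mul, hs]; simp only [mul_assoc]
    _ = _ := by rw [CFC.sqrt_mul_sqrt_self R hR]

/-- The positive part of a self-adjoint operator `X` is of the form `C X`. -/
theorem exists_posPart_eq_mul {X : H →L[ℂ] H} (hX : IsSelfAdjoint X) :
    ∃ C : H →L[ℂ] H, X⁺ = C * X := by
  obtain ⟨U, -, h⟩ := exists_abs_eq_mul X
  -- Since `|X| = U X`, the identity `|X| + X = 2 X⁺` dictates the factor.
  refine ⟨(2⁻¹ : ℂ) • (U + 1), ?_⟩
  have h1 := CFC.abs_add_self X hX
  rw [h] at h1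
  rw [smul_mul_assoc, add_mul, one_mul, h1, ← Nat.cast_smul_eq_nsmul ℂ, smul_smul]
  simp

/-! ### Functional calculus on eigenvectors -/

/-- The functions for which the formula holds form a closed subalgebra containing the constants and
the identity, so Stone–Weierstrass applies. The eigenvalue `c` lies in the spectrum because `c - A`
kills `v`. -/
theorem cfc_apply_eigenvector {A : H →L[ℂ] H} (hA : IsSelfAdjoint A) {c : ℝ} {v : H} (hv : v ≠ 0)
    (h : A v = (c : ℂ) • v) {f : ℝ → ℝ} (hf : ContinuousOn f (spectrum ℝ A)) :
    cfc f A v = ((f c : ℝ) : ℂ) • v := by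
  have hc : c ∈ spectrum ℝ A := by
    rw [spectrum.mem_iff]
    rintro ⟨u, hu⟩
    apply hv
    have h1 : (algebraMap ℝ (H →L[ℂ] H) c - A) v = 0 := by
      rw [Algebra.algebraMap_eq_smul_one, sub_apply, h]
      simp
    have h2 := congrArg (fun g : H →L[ℂ] H => g v) u.inv_mul
    simpa [hu, h1] using h2.symm
  rw [cfc_apply f A hA hf]
  set F : C(spectrum ℝ A, ℝ) := ⟨_, hf.domRestrict⟩ with hF
  suffices ∀ G : C(spectrum ℝ A, ℝ), cfcHom hA G v = ((G ⟨c, hc⟩ : ℝ) : ℂ) • v from this F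
  intro G
  induction G using ContinuousMap.induction_on_of_compact with
  | const r =>
    have : ContinuousMap.const (spectrum ℝ A) r = algebraMap ℝ C(spectrum ℝ A, ℝ) r := rfl
    rw [this, AlgHomClass.commutes, Algebra.algebraMap_eq_smul_one]
    simp
  | id => rw [cfcHom_id hA]; simpa using h
  | star_id => rw [map_star, cfcHom_id hA, hA.star_eq]; simpa using h
  | add f g hf hg => rw [map_add, add_apply, hf, hg]; simp [add_smul]
  | mul f g hf hg =>
    rw [map_mul, mul_apply_eq_comp, hg, map_smul, hf, smul_smul]
    simp [mul_comm]
  | frequently f hf =>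
    have hcl : IsClosed {g : C(spectrum ℝ A, ℝ) |
        cfcHom hA g v = ((g ⟨c, hc⟩ : ℝ) : ℂ) • v} := by
      apply isClosed_eq
      · exact (ContinuousLinearMap.apply ℂ H v).continuous.comp (cfcHom_continuous hA)
      · exact (Complex.continuous_ofReal.comp (continuous_eval_const (⟨c, hc⟩ : spectrum ℝ A))).smul
          continuous_const
    exact hcl.mem_of_frequently_of_tendsto hf tendsto_id

theorem rpow_apply_eigenvector {A : H →L[ℂ] H} (hA : 0 ≤ A) {c : ℝ} {v : H}
    (hv : v ≠ 0) (h : A v = (c : ℂ) • v) {s : ℝ} (hs : 0 ≤ s) :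
    (A ^ s : H →L[ℂ] H) v = ((c ^ s : ℝ) : ℂ) • v := by
  rw [CFC.rpow_eq_cfc_real hA]
  exact cfc_apply_eigenvector hA.isSelfAdjoint hv h
    (Real.continuous_rpow_const hs).continuousOn

/-! ### The Schmidt sequence of a compact positive operator -/

theorem isCompactOperator_mul_left {T : H →L[ℂ] H} (hT : IsCompactOperator T) (A : H →L[ℂ] H) :
    IsCompactOperator (A * T) := hT.clm_comp A

theorem isCompactOperator_mul_right {T : H →L[ℂ] H} (hT : IsCompactOperator T) (A : H →L[ℂ] H) :
    IsCompactOperator (T * A) := hT.comp_clm A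

theorem isCompactOperator_abs {T : H →L[ℂ] H} (hT : IsCompactOperator T) :
    IsCompactOperator (CFC.abs T : H →L[ℂ] H) := by
  obtain ⟨U, -, h⟩ := exists_abs_eq_mul T
  rw [h]
  exact isCompactOperator_mul_left hT U

theorem apply_mem_orthogonal_of_invariant {A : H →L[ℂ] H} (hA : IsSelfAdjoint A)
    {V : Submodule ℂ H} (hV : ∀ x ∈ V, A x ∈ V) {x : H} (hx : x ∈ Vᗮ) : A x ∈ Vᗮ := by
  rw [Submodule.mem_orthogonal] at hx ⊢
  intro u hu
  rw [← ContinuousLinearMap.adjoint_inner_left, ← ContinuousLinearMap.star_eq_adjoint, hA.star_eq]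
  exact hx _ (hV u hu)

/-- A compact positive operator attains its norm on the orthogonal complement of a finite
dimensional invariant subspace at an eigenvector. -/
theorem exists_eigenvector_orthogonal (hH : ¬ FiniteDimensional ℂ H) {A : H →L[ℂ] H} (hA : 0 ≤ A)
    (hAc : IsCompactOperator A) (V : Submodule ℂ H) (hVf : FiniteDimensional ℂ V)
    (hV : ∀ x ∈ V, A x ∈ V) :
    ∃ v : H, ‖v‖ = 1 ∧ v ∈ Vᗮ ∧ ∃ c : ℝ, 0 ≤ c ∧ A v = (c : ℂ) • v ∧
      ∀ x ∈ Vᗮ, ‖A x‖ ≤ c * ‖x‖ := by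
  have hsa : IsSelfAdjoint A := hA.isSelfAdjoint
  have hH' : Nontrivial H := by
    by_contra hn
    rw [not_nontrivial_iff_subsingleton] at hn
    exact hH inferInstance
  set Q : H →L[ℂ] H := 1 - V.starProjection with hQ
  have hQs : IsSelfAdjoint Q := (IsSelfAdjoint.one _).sub (isSelfAdjoint_starProjection V)
  have hQmem : ∀ x, Q x ∈ Vᗮ := fun x => by
    simp [hQ]
  have hQfix : ∀ x ∈ Vᗮ, Q x = x := fun x hx => by
    have := V.starProjection_apply_eq_zero_iff.mpr hx
    simp [hQ, this]
  -- The compression of `A` to `Vᗮ` is positive and compact, so `‖B‖` is a spectral value and, if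
  -- nonzero, an eigenvalue.
  set B : H →L[ℂ] H := Q * A * Q with hB
  have hBfix : ∀ x ∈ Vᗮ, B x = A x := fun x hx => by
    change Q (A (Q x)) = A x
    rw [hQfix x hx, hQfix _ (apply_mem_orthogonal_of_invariant hsa hV hx)]
  have hBpos : 0 ≤ B := by
    have h1 := star_left_conjugate_nonneg hA Q
    rwa [hQs.star_eq] at h1
  have hBc : IsCompactOperator B :=
    isCompactOperator_mul_right (isCompactOperator_mul_left hAc Q) Q
  have hbound : ∀ x ∈ Vᗮ, ‖A x‖ ≤ ‖B‖ * ‖x‖ := fun x hx => by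
    rw [← hBfix x hx]
    exact B.le_opNorm x
  obtain ⟨w, hw0, hwV, hw⟩ : ∃ w : H, w ≠ 0 ∧ w ∈ Vᗮ ∧ A w = ((‖B‖ : ℝ) : ℂ) • w := by
    -- Here `A` vanishes on `Vᗮ`, and any nonzero vector there will do; one exists because `H` is
    -- infinite-dimensional.
    by_cases hB0 : ‖B‖ = 0
    · have hne : Vᗮ ≠ ⊥ := by
        intro h
        rw [Submodule.orthogonal_eq_bot_iff] at h
        subst h
        exact hH (Module.Finite.equiv (Submodule.topEquiv : (⊤ : Submodule ℂ H) ≃ₗ[ℂ] H))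
      obtain ⟨w, hw, hw0⟩ := Submodule.exists_mem_ne_zero_of_ne_bot hne
      refine ⟨w, hw0, hw, ?_⟩
      have := hbound w hw
      rw [hB0, zero_mul, norm_le_zero_iff] at this
      rw [this, hB0]
      simp
    · have h1 : ‖B‖ ∈ spectrum ℝ B := CStarAlgebra.norm_mem_spectrum_of_nonneg hBpos
      have h2 : ((‖B‖ : ℝ) : ℂ) ∈ spectrum ℂ B := (spectrum.algebraMap_mem_iff ℂ).mpr h1
      have h3 : ((‖B‖ : ℝ) : ℂ) ≠ 0 := by exact_mod_cast hB0
      rcases hBc.hasEigenvalue_or_mem_resolventSet h3 with h4 | h4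
      · obtain ⟨w, hw⟩ := h4.exists_hasEigenvector
        have hBw : B w = ((‖B‖ : ℝ) : ℂ) • w := hw.apply_eq_smul
        have hwV : w ∈ Vᗮ := by
          have : w = ((‖B‖ : ℝ) : ℂ)⁻¹ • B w := by
            rw [hBw, smul_smul, inv_mul_cancel₀ h3, one_smul]
          rw [this]
          exact Submodule.smul_mem _ _ (hQmem _)
        exact ⟨w, hw.2, hwV, by rw [← hBfix w hwV, hBw]⟩
      · exact absurd h4 h2
  refine ⟨((‖w‖⁻¹ : ℝ) : ℂ) • w, ?_, Submodule.smul_mem _ _ hwV, ‖B‖, norm_nonneg _, ?_, hbound⟩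
  · rw [norm_smul, Complex.norm_real, norm_inv, norm_norm, inv_mul_cancel₀ (norm_ne_zero_iff.mpr hw0)]
  · rw [map_smul, hw, smul_comm]

/-- Eigenvectors `f n` of a compact positive operator, with eigenvalues `c n` in decreasing order. -/
structure IsSchmidtSystem (A : H →L[ℂ] H) (f : ℕ → H) (c : ℕ → ℝ) : Prop where
  orthonormal : Orthonormal ℂ f
  nonneg : ∀ n, 0 ≤ c n
  apply_eq : ∀ n, A (f n) = (c n : ℂ) • f n
  norm_le : ∀ n x, (∀ i < n, inner ℂ (f i) x = (0 : ℂ)) → ‖A x‖ ≤ c n * ‖x‖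

/-- Greedy choice: to the span of the vectors already chosen, adjoin an eigenvector orthogonal to it
with the largest possible eigenvalue. Eigenvalue `0` is allowed, so the process never stops. -/
theorem exists_isSchmidtSystem (hH : ¬ FiniteDimensional ℂ H) {A : H →L[ℂ] H} (hA : 0 ≤ A)
    (hAc : IsCompactOperator A) : ∃ f c, IsSchmidtSystem A f c := by
  choose! g hg1 hg2 c hc0 hc1 hc2 using exists_eigenvector_orthogonal hH hA hAc
  -- `V n` is the span of the first `n` vectors chosen.
  let V : ℕ → Submodule ℂ H := fun n =>
    Nat.rec (motive := fun _ => Submodule ℂ H) ⊥ (fun _ W => W ⊔ Submodule.span ℂ {g W}) n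
  have hVs : ∀ n, V (n + 1) = V n ⊔ Submodule.span ℂ {g (V n)} := fun n => rfl
  have hV : ∀ n, FiniteDimensional ℂ ↥(V n) ∧ ∀ x ∈ V n, A x ∈ V n := by
    intro n
    induction n with
    | zero =>
      refine ⟨inferInstanceAs (FiniteDimensional ℂ (⊥ : Submodule ℂ H)), fun x hx => ?_⟩
      have hx0 : x = 0 := hx
      rw [hx0, map_zero]
      exact Submodule.zero_mem _
    | succ n ih =>
      obtain ⟨h1, h2⟩ := ih
      rw [hVs]
      refine ⟨inferInstance, fun x hx => ?_⟩
      obtain ⟨y, hy, z, hz, rfl⟩ := Submodule.mem_sup.mp hx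
      obtain ⟨a, rfl⟩ := Submodule.mem_span_singleton.mp hz
      rw [map_add, map_smul, hc1 _ h1 h2]
      refine Submodule.add_mem_sup (h2 y hy) (Submodule.smul_mem _ _ (Submodule.smul_mem _ _ ?_))
      exact Submodule.mem_span_singleton_self _
  have hmono : Monotone V := monotone_nat_of_le_succ fun n => by rw [hVs]; exact le_sup_left
  have hmem : ∀ i n, i < n → g (V i) ∈ V n := fun i n hin => by
    refine hmono (Nat.succ_le_of_lt hin) ?_
    rw [Nat.succ_eq_add_one, hVs]
    exact Submodule.mem_sup_right (Submodule.mem_span_singleton_self _)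
  have horth : ∀ i n, i < n → inner ℂ (g (V i)) (g (V n)) = (0 : ℂ) := fun i n hin =>
    (Submodule.mem_orthogonal _ _).mp (hg2 _ (hV n).1 (hV n).2) _ (hmem i n hin)
  have hperp : ∀ n x, (∀ i < n, inner ℂ (g (V i)) x = (0 : ℂ)) → x ∈ (V n)ᗮ := by
    intro n x
    induction n with
    | zero =>
      refine fun _ => (Submodule.mem_orthogonal _ _).mpr fun u hu => ?_
      have hu0 : u = 0 := hu
      rw [hu0, inner_zero_left]
    | succ n ih =>
      intro h
      rw [hVs, ← Submodule.inf_orthogonal]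
      refine ⟨ih fun i hi => h i (hi.trans n.lt_succ_self), ?_⟩
      exact Submodule.mem_orthogonal_singleton_iff_inner_right.mpr (h n n.lt_succ_self)
  refine ⟨fun n => g (V n), fun n => c (V n), ⟨fun n => hg1 _ (hV n).1 (hV n).2, ?_⟩, 
    fun n => hc0 _ (hV n).1 (hV n).2, fun n => hc1 _ (hV n).1 (hV n).2, 
    fun n x hx => hc2 _ (hV n).1 (hV n).2 x (hperp n x hx)⟩
  intro i j hij
  rcases lt_or_gt_of_ne hij with h | h
  · exact horth i j h
  · exact inner_eq_zero_symm.mp (horth j i h)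

/-! ### The eigenvalues of a Schmidt system are the numbers `mu` -/

namespace IsSchmidtSystem

variable {A : H →L[ℂ] H} {f : ℕ → H} {c : ℕ → ℝ}

theorem antitone (h : IsSchmidtSystem A f c) : Antitone c := by
  refine antitone_nat_of_succ_le fun n => ?_
  have h1 := h.norm_le n (f (n + 1)) fun i hi =>
    h.orthonormal.2 (ne_of_lt (hi.trans n.lt_succ_self))
  rw [h.apply_eq, norm_smul, h.orthonormal.1, mul_one, mul_one, Complex.norm_real,
    Real.norm_of_nonneg (h.nonneg _)] at h1
  exact h1

/-- The counterpart of `norm_le`: a lower bound on the span of the first `n + 1` vectors, where all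
eigenvalues are at least `c n`. -/
theorem norm_sum_ge (h : IsSchmidtSystem A f c) (n : ℕ) (a : ℕ → ℂ) :
    c n * ‖∑ i ∈ Finset.range (n + 1), a i • f i‖ ≤
      ‖A (∑ i ∈ Finset.range (n + 1), a i • f i)‖ := by
  have hsq : ∀ b : ℕ → ℂ, ‖∑ i ∈ Finset.range (n + 1), b i • f i‖ ^ 2 =
      ∑ i ∈ Finset.range (n + 1), ‖b i‖ ^ 2 := by
    intro b
    have h1 := h.orthonormal.inner_sum b b (Finset.range (n + 1))
    rw [inner_self_eq_norm_sq_to_K] at h1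
    have h2 : ((‖∑ i ∈ Finset.range (n + 1), b i • f i‖ ^ 2 : ℝ) : ℂ) =
        ((∑ i ∈ Finset.range (n + 1), ‖b i‖ ^ 2 : ℝ) : ℂ) := by
      push_cast
      refine Eq.trans ?_ (h1.trans ?_)
      · rfl
      · exact Finset.sum_congr rfl fun i _ => by rw [← Complex.conj_mul']
    exact_mod_cast h2
  have hAs : A (∑ i ∈ Finset.range (n + 1), a i • f i) =
      ∑ i ∈ Finset.range (n + 1), (a i * c i) • f i := by
    rw [map_sum]
    exact Finset.sum_congr rfl fun i _ => by rw [map_smul, h.apply_eq, smul_smul]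
  rw [hAs, ← sq_le_sq₀ (mul_nonneg (h.nonneg n) (norm_nonneg _)) (norm_nonneg _), mul_pow, hsq, hsq,
    Finset.mul_sum]
  refine Finset.sum_le_sum fun i hi => ?_
  have hi' : c n ≤ c i := h.antitone (Nat.le_of_lt_succ (Finset.mem_range.mp hi))
  rw [norm_mul, Complex.norm_real, Real.norm_of_nonneg (h.nonneg i), mul_pow, mul_comm]
  exact mul_le_mul_of_nonneg_left (pow_le_pow_left₀ (h.nonneg n) hi' 2) (sq_nonneg _)

/-- An eigenvector whose eigenvalue exceeds `c n` lies in the span of the first `n` vectors. -/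
theorem mem_span_of_eigenvector (h : IsSchmidtSystem A f c) (hA : 0 ≤ A) {n : ℕ} {κ : ℝ}
    (hκ : c n < κ) {v : H} (hv : A v = (κ : ℂ) • v) :
    v ∈ Submodule.span ℂ (Set.range fun i : Fin n => f i) := by
  set V := Submodule.span ℂ (Set.range fun i : Fin n => f i) with hV
  have hVf : FiniteDimensional ℂ V := FiniteDimensional.span_of_finite ℂ (Set.finite_range _)
  have hinv : ∀ x ∈ V, A x ∈ V := by
    intro x hx
    have hle : V ≤ V.comap (A : H →ₗ[ℂ] H) := by
      rw [hV, Submodule.span_le]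
      rintro _ ⟨i, rfl⟩
      change A (f i) ∈ V
      rw [h.apply_eq]
      exact Submodule.smul_mem _ _ (Submodule.subset_span ⟨i, rfl⟩)
    exact hle hx
  -- The component of `v` orthogonal to `V` is again in the `κ`-eigenspace, but on `Vᗮ` the operator
  -- is bounded by `c n < κ`; so the component is zero.
  set w := v - V.starProjection v with hw
  have hwV : w ∈ Vᗮ := V.sub_starProjection_mem_orthogonal v
  have hAw : A w = (κ : ℂ) • w := by
    have h1 : A w ∈ Vᗮ := apply_mem_orthogonal_of_invariant hA.isSelfAdjoint hinv hwV
    have h2 : A w - (κ : ℂ) • w ∈ Vᗮ := Submodule.sub_mem _ h1 (Submodule.smul_mem _ _ hwV)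
    have h3 : A w - (κ : ℂ) • w ∈ V := by
      have : A w - (κ : ℂ) • w = (κ : ℂ) • V.starProjection v - A (V.starProjection v) := by
        rw [hw, map_sub, hv, smul_sub]; abel
      rw [this]
      have hp := V.starProjection_apply_mem v
      exact Submodule.sub_mem _ (Submodule.smul_mem _ _ hp) (hinv _ hp)
    have h4 := Submodule.disjoint_def.mp V.orthogonal_disjoint _ h3 h2
    exact sub_eq_zero.mp h4
  have hb := h.norm_le n w fun i hi =>
    (Submodule.mem_orthogonal _ _).mp hwV _ (Submodule.subset_span ⟨⟨i, hi⟩, rfl⟩)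
  rw [hAw, norm_smul, Complex.norm_real, Real.norm_of_nonneg ((h.nonneg n).trans hκ.le)] at hb
  have hw0 : w = 0 := by
    by_contra hne
    exact absurd (le_of_mul_le_mul_right hb (norm_pos_iff.mpr hne)) (not_le.mpr hκ)
  rw [sub_eq_zero.mp hw0]
  exact V.starProjection_apply_mem v

theorem le_rank_spectralSubspace (h : IsSchmidtSystem A f c) (hA : 0 ≤ A) {n : ℕ} {t : ℝ}
    (ht : t ≤ c n) : ((n + 1 : ℕ) : Cardinal) ≤ Module.rank ℂ (spectralSubspace A t) := by
  have hmem : ∀ i : Fin (n + 1), f i ∈ spectralSubspace A t := fun i => by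
    have hi : c i ∈ Set.Ici t := ht.trans (h.antitone (Nat.le_of_lt_succ i.2))
    refine Submodule.mem_iSup_of_mem (c i) (Submodule.mem_iSup_of_mem hi ?_)
    rw [Module.End.mem_eigenspace_iff, CFC.abs_of_nonneg A hA]
    exact h.apply_eq i
  have hli : LinearIndependent ℂ fun i : Fin (n + 1) => f i :=
    (h.orthonormal.comp (fun i : Fin (n + 1) => (i : ℕ)) Fin.val_injective).linearIndependent
  have h1 : Module.finrank ℂ (Submodule.span ℂ (Set.range fun i : Fin (n + 1) => f i)) = n + 1 := by
    rw [finrank_span_eq_card hli, Fintype.card_fin]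
  have hVf : FiniteDimensional ℂ (Submodule.span ℂ (Set.range fun i : Fin (n + 1) => f i)) :=
    FiniteDimensional.span_of_finite ℂ (Set.finite_range _)
  rw [← h1, Module.finrank_eq_rank]
  refine Submodule.rank_mono (Submodule.span_le.mpr ?_)
  rintro _ ⟨i, rfl⟩
  exact hmem i

theorem le_of_le_rank (h : IsSchmidtSystem A f c) (hA : 0 ≤ A) {n : ℕ} {t : ℝ}
    (ht : ((n + 1 : ℕ) : Cardinal) ≤ Module.rank ℂ (spectralSubspace A t)) : t ≤ c n := by
  by_contra! hlt
  have hVf : FiniteDimensional ℂ (Submodule.span ℂ (Set.range fun i : Fin n => f i)) :=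
    FiniteDimensional.span_of_finite ℂ (Set.finite_range _)
  have hle : spectralSubspace A t ≤ Submodule.span ℂ (Set.range fun i : Fin n => f i) := by
    refine iSup₂_le fun κ hκ v hv => ?_
    rw [Module.End.mem_eigenspace_iff, CFC.abs_of_nonneg A hA] at hv
    exact h.mem_span_of_eigenvector hA (hlt.trans_le hκ) hv
  have h1 := ht.trans (Submodule.rank_mono hle)
  rw [← Module.finrank_eq_rank] at h1
  have h2 := finrank_range_le_card (R := ℂ) fun i : Fin n => f i
  rw [Set.finrank, Fintype.card_fin] at h2
  have h3 : n + 1 ≤ Module.finrank ℂ (Submodule.span ℂ (Set.range fun i : Fin n => f i)) := by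
    exact_mod_cast h1
  omega

/-- The set whose supremum defines `mu` is exactly `[0, c n]`: for `t ≤ c n` the first `n + 1`
vectors count, and for `t > c n` all eigenvectors lie in the span of the first `n`. -/
theorem mu_eq (h : IsSchmidtSystem A f c) (hA : 0 ≤ A) (n : ℕ) : mu A n = c n := by
  have : {t : ℝ | 0 ≤ t ∧ ((n + 1 : ℕ) : Cardinal) ≤ Module.rank ℂ (spectralSubspace A t)} =
      Set.Icc 0 (c n) := by
    ext t
    exact ⟨fun ht => ⟨ht.1, h.le_of_le_rank hA ht.2⟩,
      fun ht => ⟨ht.1, h.le_rank_spectralSubspace hA ht.2⟩⟩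
  rw [mu, this, csSup_Icc (h.nonneg n)]

end IsSchmidtSystem

theorem mu_abs (T : H →L[ℂ] H) (n : ℕ) : mu (CFC.abs T : H →L[ℂ] H) n = mu T n := by
  have h : spectralSubspace (CFC.abs T : H →L[ℂ] H) = spectralSubspace T := by
    funext t
    unfold spectralSubspace
    rw [CFC.cfcAbs_cfcAbs]
  unfold mu
  rw [h]

theorem exists_isSchmidtSystem_mu (hH : ¬ FiniteDimensional ℂ H) {A : H →L[ℂ] H} (hA : 0 ≤ A)
    (hAc : IsCompactOperator A) : ∃ f, IsSchmidtSystem A f (mu A) := by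
  obtain ⟨f, c, h⟩ := exists_isSchmidtSystem hH hA hAc
  have : mu A = c := funext fun n => h.mu_eq hA n
  exact ⟨f, this ▸ h⟩

/-! ### Approximation numbers -/

/-- The orthogonal projection of `W` to `V` has a kernel, by dimension. -/
theorem exists_mem_orthogonal_ne_zero (V W : Submodule ℂ H) [FiniteDimensional ℂ V]
    [FiniteDimensional ℂ W] (h : Module.finrank ℂ V < Module.finrank ℂ W) :
    ∃ x ∈ W, x ∈ Vᗮ ∧ x ≠ 0 := by
  have h1 := LinearMap.ker_ne_bot_of_finrank_lt
    (f := (V.orthogonalProjectionOnto : H →ₗ[ℂ] V) ∘ₗ W.subtype) h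
  obtain ⟨x, hx, hx0⟩ := Submodule.exists_mem_ne_zero_of_ne_bot h1
  refine ⟨x, x.2, ?_, fun h0 => hx0 (Subtype.ext h0)⟩
  rw [← Submodule.starProjection_apply_eq_zero_iff]
  have h2 : V.orthogonalProjectionOnto (x : H) = 0 := hx
  rw [Submodule.starProjection_apply, h2]
  rfl

theorem mu_nonneg (T : H →L[ℂ] H) (n : ℕ) : 0 ≤ mu T n :=
  Real.sSup_nonneg fun _ ht => ht.1

theorem exists_isSchmidtSystem_abs (hH : ¬ FiniteDimensional ℂ H) {T : H →L[ℂ] H}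
    (hT : IsCompactOperator T) : ∃ f, IsSchmidtSystem (CFC.abs T : H →L[ℂ] H) f (mu T) := by
  obtain ⟨f, h⟩ := exists_isSchmidtSystem_mu hH (CFC.abs_nonneg T) (isCompactOperator_abs hT)
  have : mu (CFC.abs T : H →L[ℂ] H) = mu T := funext fun n => mu_abs T n
  exact ⟨f, this ▸ h⟩

theorem mu_antitone (hH : ¬ FiniteDimensional ℂ H) {T : H →L[ℂ] H} (hT : IsCompactOperator T) :
    Antitone (mu T) := by
  obtain ⟨f, h⟩ := exists_isSchmidtSystem_abs hH hT
  exact h.antitone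

/-- One half of the minimax principle, with the span of the first `n` Schmidt vectors. The two
halves together replace the definition of `mu` in the operator inequalities below. -/
theorem exists_forall_orthogonal_norm_le (hH : ¬ FiniteDimensional ℂ H) {T : H →L[ℂ] H}
    (hT : IsCompactOperator T) (n : ℕ) : ∃ V : Submodule ℂ H, FiniteDimensional ℂ V ∧
      Module.finrank ℂ V ≤ n ∧ ∀ x ∈ Vᗮ, ‖T x‖ ≤ mu T n * ‖x‖ := by
  obtain ⟨f, h⟩ := exists_isSchmidtSystem_abs hH hT
  refine ⟨Submodule.span ℂ (Set.range fun i : Fin n => f i),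
    FiniteDimensional.span_of_finite ℂ (Set.finite_range _), ?_, fun x hx => ?_⟩
  · have h2 := finrank_range_le_card (R := ℂ) fun i : Fin n => f i
    rwa [Set.finrank, Fintype.card_fin] at h2
  · rw [← norm_abs_apply]
    exact h.norm_le n x fun i hi =>
      (Submodule.mem_orthogonal _ _).mp hx _ (Submodule.subset_span ⟨⟨i, hi⟩, rfl⟩)

/-- The other half: the span of `n + 1` Schmidt vectors meets `Vᗮ`, and on that span `‖T x‖ ≥ mu T n
* ‖x‖`. -/
theorem mu_le_of_forall_orthogonal (hH : ¬ FiniteDimensional ℂ H) {T : H →L[ℂ] H}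
    (hT : IsCompactOperator T) {n : ℕ} (V : Submodule ℂ H) (hVf : FiniteDimensional ℂ V)
    (hV : Module.finrank ℂ V ≤ n) {c : ℝ} (h : ∀ x ∈ Vᗮ, ‖T x‖ ≤ c * ‖x‖) : mu T n ≤ c := by
  obtain ⟨f, hf⟩ := exists_isSchmidtSystem_abs hH hT
  have hli : LinearIndependent ℂ fun i : Fin (n + 1) => f i :=
    (hf.orthonormal.comp (fun i : Fin (n + 1) => (i : ℕ)) Fin.val_injective).linearIndependent
  have h1 : Module.finrank ℂ (Submodule.span ℂ (Set.range fun i : Fin (n + 1) => f i)) = n + 1 := by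
    rw [finrank_span_eq_card hli, Fintype.card_fin]
  have hWf : FiniteDimensional ℂ (Submodule.span ℂ (Set.range fun i : Fin (n + 1) => f i)) :=
    FiniteDimensional.span_of_finite ℂ (Set.finite_range _)
  obtain ⟨x, hxW, hxV, hx0⟩ := exists_mem_orthogonal_ne_zero V
    (Submodule.span ℂ (Set.range fun i : Fin (n + 1) => f i)) (by omega)
  obtain ⟨a, ha⟩ := (Submodule.mem_span_range_iff_exists_fun ℂ).mp hxW
  have hx : x = ∑ i ∈ Finset.range (n + 1),
      (fun i => if hi : i < n + 1 then a ⟨i, hi⟩ else 0) i • f i := by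
    rw [← ha, Finset.sum_range]
    exact Finset.sum_congr rfl fun i _ => by simp only [dif_pos i.2]
  have h2 := hf.norm_sum_ge n fun i => if hi : i < n + 1 then a ⟨i, hi⟩ else 0
  rw [← hx, norm_abs_apply] at h2
  exact le_of_mul_le_mul_right (h2.trans (h x hxV)) (norm_pos_iff.mpr hx0)

/-! ### Behaviour of `mu` under products, sums and scalars -/

theorem mu_mul_left_le (hH : ¬ FiniteDimensional ℂ H) {T : H →L[ℂ] H}
    (hT : IsCompactOperator T) (A : H →L[ℂ] H) (n : ℕ) : mu (A * T) n ≤ ‖A‖ * mu T n := by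
  obtain ⟨V, hVf, hV, h⟩ := exists_forall_orthogonal_norm_le hH hT n
  refine mu_le_of_forall_orthogonal hH (isCompactOperator_mul_left hT A) V hVf hV fun x hx => ?_
  calc ‖A (T x)‖ ≤ ‖A‖ * ‖T x‖ := A.le_opNorm _
    _ ≤ ‖A‖ * (mu T n * ‖x‖) := by gcongr; exact h x hx
    _ = _ := by ring

/-- If `V` is optimal for `T`, then `A* V` serves for `T A`, since `x ⟂ A* V` means `A x ⟂ V`. -/
theorem mu_mul_right_le (hH : ¬ FiniteDimensional ℂ H) {T : H →L[ℂ] H}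
    (hT : IsCompactOperator T) (A : H →L[ℂ] H) (n : ℕ) : mu (T * A) n ≤ ‖A‖ * mu T n := by
  obtain ⟨V, hVf, hV, h⟩ := exists_forall_orthogonal_norm_le hH hT n
  refine mu_le_of_forall_orthogonal hH (isCompactOperator_mul_right hT A)
    (V.map ((star A : H →L[ℂ] H) : H →ₗ[ℂ] H)) inferInstance
    ((Submodule.finrank_map_le _ _).trans hV) fun x hx => ?_
  have hAx : A x ∈ Vᗮ := by
    rw [Submodule.mem_orthogonal]
    intro u hu
    rw [← ContinuousLinearMap.adjoint_inner_left, ← ContinuousLinearMap.star_eq_adjoint]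
    exact (Submodule.mem_orthogonal _ _).mp hx _ ⟨u, hu, rfl⟩
  calc ‖T (A x)‖ ≤ mu T n * ‖A x‖ := h _ hAx
    _ ≤ mu T n * (‖A‖ * ‖x‖) := by
      gcongr
      · exact mu_nonneg T n
      · exact A.le_opNorm x
    _ = _ := by ring

theorem mu_add_le (hH : ¬ FiniteDimensional ℂ H) {S T : H →L[ℂ] H} (hS : IsCompactOperator S)
    (hT : IsCompactOperator T) (m n : ℕ) : mu (S + T) (m + n) ≤ mu S m + mu T n := by
  obtain ⟨V, hVf, hV, h⟩ := exists_forall_orthogonal_norm_le hH hS m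
  obtain ⟨W, hWf, hW, h'⟩ := exists_forall_orthogonal_norm_le hH hT n
  refine mu_le_of_forall_orthogonal hH (hS.add hT) (V ⊔ W) inferInstance
    ((Submodule.finrank_add_le_finrank_add_finrank V W).trans (add_le_add hV hW)) fun x hx => ?_
  rw [← Submodule.inf_orthogonal] at hx
  calc ‖S x + T x‖ ≤ ‖S x‖ + ‖T x‖ := norm_add_le _ _
    _ ≤ mu S m * ‖x‖ + mu T n * ‖x‖ := add_le_add (h x hx.1) (h' x hx.2)
    _ = _ := by ring

theorem mu_conj_le (hH : ¬ FiniteDimensional ℂ H) {T : H →L[ℂ] H}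
    (hT : IsCompactOperator T) {U V : H →L[ℂ] H} (hU : ‖U‖ ≤ 1) (hV : ‖V‖ ≤ 1) (n : ℕ) :
    mu (U * T * V) n ≤ mu T n := by
  have h1 := mu_mul_right_le hH (isCompactOperator_mul_left hT U) V n
  have h2 := mu_mul_left_le hH hT U n
  have h3 : ‖V‖ * mu (U * T) n ≤ mu (U * T) n := mul_le_of_le_one_left (mu_nonneg _ _) hV
  have h4 : ‖U‖ * mu T n ≤ mu T n := mul_le_of_le_one_left (mu_nonneg _ _) hU
  linarith

theorem mu_mul_star_le (hH : ¬ FiniteDimensional ℂ H) {T : H →L[ℂ] H}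
    (hT : IsCompactOperator (star T * T : H →L[ℂ] H)) (n : ℕ) :
    mu (T * star T) n ≤ mu (star T * T) n := by
  obtain ⟨C, hC, h⟩ := exists_mul_star_eq T
  rw [h]
  exact mu_conj_le hH hT hC (by rwa [norm_star]) n

theorem isCompactOperator_mul_star {T : H →L[ℂ] H}
    (hT : IsCompactOperator (star T * T : H →L[ℂ] H)) :
    IsCompactOperator (T * star T : H →L[ℂ] H) := by
  obtain ⟨C, hC, h⟩ := exists_mul_star_eq T
  rw [h]
  exact isCompactOperator_mul_right (isCompactOperator_mul_left hT C) _

theorem mu_mul_star (hH : ¬ FiniteDimensional ℂ H) {T : H →L[ℂ] H}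
    (hT : IsCompactOperator (star T * T : H →L[ℂ] H)) :
    mu (T * star T) = mu (star T * T) := by
  funext n
  refine le_antisymm (mu_mul_star_le hH hT n) ?_
  have h := mu_mul_star_le hH (T := star T) (by
    rw [star_star]; exact isCompactOperator_mul_star hT) n
  rwa [star_star] at h

theorem isCompactOperator_smul {T : H →L[ℂ] H} (hT : IsCompactOperator T) (c : ℂ) :
    IsCompactOperator (c • T : H →L[ℂ] H) := hT.smul c

theorem mu_smul_le (hH : ¬ FiniteDimensional ℂ H) {T : H →L[ℂ] H}
    (hT : IsCompactOperator T) (c : ℂ) (n : ℕ) : mu (c • T) n ≤ ‖c‖ * mu T n := by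
  obtain ⟨V, hVf, hV, h⟩ := exists_forall_orthogonal_norm_le hH hT n
  refine mu_le_of_forall_orthogonal hH (isCompactOperator_smul hT c) V hVf hV fun x hx => ?_
  calc ‖c • T x‖ = ‖c‖ * ‖T x‖ := norm_smul _ _
    _ ≤ ‖c‖ * (mu T n * ‖x‖) := by gcongr; exact h x hx
    _ = _ := by ring

theorem mu_smul (hH : ¬ FiniteDimensional ℂ H) {T : H →L[ℂ] H}
    (hT : IsCompactOperator T) (c : ℂ) (n : ℕ) : mu (c • T) n = ‖c‖ * mu T n := by
  refine le_antisymm (mu_smul_le hH hT c n) ?_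
  rcases eq_or_ne c 0 with rfl | hc
  · rw [norm_zero, zero_mul]
    exact mu_nonneg _ _
  · have h := mu_smul_le hH (isCompactOperator_smul hT c) c⁻¹ n
    rw [smul_smul, inv_mul_cancel₀ hc, one_smul, norm_inv] at h
    have hc' := norm_pos_iff.mpr hc
    calc ‖c‖ * mu T n ≤ ‖c‖ * (‖c‖⁻¹ * mu (c • T) n) := by gcongr
      _ = _ := by rw [← mul_assoc, mul_inv_cancel₀ hc'.ne', one_mul]

theorem mu_zero (hH : ¬ FiniteDimensional ℂ H) (n : ℕ) : mu (0 : H →L[ℂ] H) n = 0 := by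
  have h := mu_smul hH (T := 0) isCompactOperator_zero 0 n
  rwa [norm_zero, zero_mul, smul_zero] at h

/-! ### Finite rank and compactness -/

theorem isCompactOperator_projection {P : H →L[ℂ] H}
    (hf : FiniteDimensional ℂ (LinearMap.range (P : H →ₗ[ℂ] H))) : IsCompactOperator P := by
  have h1 : IsCompactOperator (P.codRestrict (LinearMap.range (P : H →ₗ[ℂ] H)) fun x => ⟨x, rfl⟩) := by
    have := FiniteDimensional.proper ℂ (LinearMap.range (P : H →ₗ[ℂ] H))
    exact isCompactOperator_of_locallyCompactSpace_dom
      (P.codRestrict (LinearMap.range (P : H →ₗ[ℂ] H)) fun x => ⟨x, rfl⟩)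
  exact h1.clm_comp (LinearMap.range (P : H →ₗ[ℂ] H)).subtypeL

theorem mu_projection_eq_zero (hH : ¬ FiniteDimensional ℂ H) {P : H →L[ℂ] H}
    (hP : IsStarProjection P) (hf : FiniteDimensional ℂ (LinearMap.range (P : H →ₗ[ℂ] H))) {n : ℕ}
    (hn : Module.finrank ℂ (LinearMap.range (P : H →ₗ[ℂ] H)) ≤ n) : mu P n = 0 := by
  refine le_antisymm (mu_le_of_forall_orthogonal hH (isCompactOperator_projection hf)
    _ hf hn fun x hx => ?_) (mu_nonneg _ _)
  have h1 := apply_mem_orthogonal_of_invariant hP.isSelfAdjoint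
    (V := LinearMap.range (P : H →ₗ[ℂ] H)) (fun y _ => ⟨y, rfl⟩) hx
  have h2 := Submodule.disjoint_def.mp
    (LinearMap.range (P : H →ₗ[ℂ] H)).orthogonal_disjoint (P x) ⟨x, rfl⟩ h1
  rw [h2, norm_zero, zero_mul]

/-- If the eigenvalues stayed above `ε`, the images of the orthonormal eigenvectors would be
pairwise at distance at least `ε` in a relatively compact set. -/
theorem tendsto_mu (hH : ¬ FiniteDimensional ℂ H) {T : H →L[ℂ] H}
    (hT : IsCompactOperator T) : Tendsto (mu T) atTop (𝓝 0) := by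
  obtain ⟨f, h⟩ := exists_isSchmidtSystem_abs hH hT
  rw [Metric.tendsto_atTop]
  intro ε hε
  by_contra! hcon
  have hall : ∀ n, ε ≤ mu T n := fun n => by
    obtain ⟨m, hm, h1⟩ := hcon n
    rw [Real.dist_eq, sub_zero, abs_of_nonneg (mu_nonneg T m)] at h1
    exact h1.trans (h.antitone hm)
  have hcl := (isCompactOperator_abs hT).isCompact_closure_image_closedBall
    (𝕜₁ := ℂ) (f := ((CFC.abs T : H →L[ℂ] H) : H →ₗ[ℂ] H)) 1
  have hmem : ∀ n, (CFC.abs T : H →L[ℂ] H) (f n) ∈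
      closure (((CFC.abs T : H →L[ℂ] H) : H →ₗ[ℂ] H) '' Metric.closedBall 0 1) := fun n =>
    subset_closure ⟨f n, by simp [h.orthonormal.1 n], rfl⟩
  obtain ⟨a, -, φ, hφ, hlim⟩ := hcl.tendsto_subseq hmem
  have hcau := hlim.cauchySeq
  rw [Metric.cauchySeq_iff'] at hcau
  obtain ⟨N, hN⟩ := hcau ε hε
  have h1 := hN (N + 1) N.le_succ
  have hne : φ (N + 1) ≠ φ N := (hφ N.lt_succ_self).ne'
  simp only [Function.comp, h.apply_eq, dist_eq_norm] at h1
  have h2 : ε ^ 2 ≤ ‖(mu T (φ (N + 1)) : ℂ) • f (φ (N + 1)) - (mu T (φ N) : ℂ) • f (φ N)‖ ^ 2 := by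
    rw [@norm_sub_sq ℂ, inner_smul_left, inner_smul_right, h.orthonormal.2 hne, norm_smul,
      norm_smul, h.orthonormal.1, h.orthonormal.1, Complex.norm_real, Complex.norm_real,
      Real.norm_of_nonneg (mu_nonneg _ _), Real.norm_of_nonneg (mu_nonneg _ _)]
    have h3 := pow_le_pow_left₀ hε.le (hall (φ (N + 1))) 2
    simp only [mul_one, mul_zero, map_zero, sub_zero]
    nlinarith [sq_nonneg (mu T (φ N))]
  exact absurd (lt_of_le_of_lt h2 (pow_lt_pow_left₀ h1 (norm_nonneg _) two_ne_zero)) (lt_irrefl _)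

/-- `A` is a norm limit of the finite rank operators `A P_V`. This provides compactness of `|T|^s`
straight from its Schmidt system. -/
theorem isCompactOperator_of_forall_orthogonal {A : H →L[ℂ] H}
    (h : ∀ ε > 0, ∃ V : Submodule ℂ H, FiniteDimensional ℂ V ∧ ∀ x ∈ Vᗮ, ‖A x‖ ≤ ε * ‖x‖) :
    IsCompactOperator A := by
  have hcl : IsClosed {B : H →L[ℂ] H | IsCompactOperator B} :=
    isClosed_setOfPred_isCompactOperator
  refine hcl.closure_subset (Metric.mem_closure_iff.mpr fun ε hε => ?_)
  obtain ⟨V, hV, hA⟩ := h (ε / 2) (half_pos hε)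
  refine ⟨A * V.starProjection, ?_, ?_⟩
  · refine isCompactOperator_mul_left (isCompactOperator_projection ?_) A
    rw [show LinearMap.range (V.starProjection : H →ₗ[ℂ] H) = V from V.range_starProjection]
    exact hV
  · rw [dist_eq_norm]
    refine lt_of_le_of_lt (ContinuousLinearMap.opNorm_le_bound _ (half_pos hε).le fun x => ?_)
      (half_lt_self hε)
    have h1 := V.sub_starProjection_mem_orthogonal x
    have h2 : (A - A * V.starProjection) x = A (x - V.starProjection x) := by
      rw [map_sub]; rfl
    rw [h2]
    refine (hA _ h1).trans (mul_le_mul_of_nonneg_left ?_ (half_pos hε).le)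
    have h3 := Vᗮ.starProjection_norm_le
    have h4 : Vᗮ.starProjection x = x - V.starProjection x := by
      rw [Submodule.starProjection_orthogonal]; rfl
    rw [← h4]
    exact (Vᗮ.starProjection.le_opNorm x).trans (mul_le_of_le_one_left (norm_nonneg _) h3)

/-! ### Powers of compact operators -/

/-- Injectivity makes `f` a Hilbert basis: on a vector orthogonal to all `f n`, `A` is bounded by
every `c n`, hence vanishes. Then `A ^ s` is diagonal and the norm bound is a termwise comparison in
Parseval's identity. -/
theorem isSchmidtSystem_rpow {A : H →L[ℂ] H} (hA : 0 ≤ A) (hinj : ∀ x, A x = 0 → x = 0)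
    {f : ℕ → H} {c : ℕ → ℝ} (h : IsSchmidtSystem A f c) (hc : Tendsto c atTop (𝓝 0))
    {s : ℝ} (hs : 0 ≤ s) : IsSchmidtSystem (A ^ s : H →L[ℂ] H) f (fun n => c n ^ s) := by
  have hap : ∀ n, (A ^ s : H →L[ℂ] H) (f n) = ((c n ^ s : ℝ) : ℂ) • f n := fun n =>
    rpow_apply_eigenvector hA (h.orthonormal.ne_zero n) (h.apply_eq n) hs
  have hsa : star (A ^ s : H →L[ℂ] H) = A ^ s := (CFC.rpow_nonneg : 0 ≤ A ^ s).isSelfAdjoint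
  have hbot : (Submodule.span ℂ (Set.range f))ᗮ = ⊥ := by
    rw [Submodule.eq_bot_iff]
    intro x hx
    have hx' : ∀ i, inner ℂ (f i) x = (0 : ℂ) := fun i =>
      (Submodule.mem_orthogonal _ _).mp hx _ (Submodule.subset_span ⟨i, rfl⟩)
    apply hinj
    have h1 : ∀ n, ‖A x‖ ≤ c n * ‖x‖ := fun n => h.norm_le n x fun i _ => hx' i
    have h2 : Tendsto (fun n => c n * ‖x‖) atTop (𝓝 0) := by simpa using hc.mul_const ‖x‖
    exact norm_le_zero_iff.mp (ge_of_tendsto' h2 h1)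
  let b := HilbertBasis.mkOfOrthogonalEqBot h.orthonormal hbot
  have hb : ∀ i, b i = f i := fun i =>
    congrFun (HilbertBasis.coe_mkOfOrthogonalEqBot h.orthonormal hbot) i
  have hpars : ∀ y : H, HasSum (fun i => ‖inner ℂ (f i) y‖ ^ 2) (‖y‖ ^ 2) := by
    intro y
    have h1 := b.hasSum_inner_mul_inner y y
    have h2 := Complex.hasSum_re h1
    have h3 : (inner ℂ y y : ℂ).re = ‖y‖ ^ 2 := by
      rw [inner_self_eq_norm_sq_to_K]; norm_cast
    rw [h3] at h2
    convert h2 using 2 with i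
    rw [hb, ← inner_conj_symm y, Complex.conj_mul']
    norm_cast
  have hcoef : ∀ y i, inner ℂ (f i) ((A ^ s : H →L[ℂ] H) y) =
      ((c i ^ s : ℝ) : ℂ) * inner ℂ (f i) y := by
    intro y i
    rw [← ContinuousLinearMap.adjoint_inner_left, ← ContinuousLinearMap.star_eq_adjoint, hsa, hap,
      inner_smul_left, Complex.conj_ofReal]
  refine ⟨h.orthonormal, fun n => Real.rpow_nonneg (h.nonneg n) _, hap, fun n x hx => ?_⟩
  have hcn := Real.rpow_nonneg (h.nonneg n) s
  rw [← sq_le_sq₀ (norm_nonneg _) (mul_nonneg hcn (norm_nonneg _)), mul_pow]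
  refine hasSum_le (fun i => ?_) (hpars _) ((hpars x).mul_left ((c n ^ s) ^ 2))
  rw [hcoef, norm_mul, mul_pow, Complex.norm_real,
    Real.norm_of_nonneg (Real.rpow_nonneg (h.nonneg i) _)]
  rcases lt_or_ge i n with hi | hi
  · rw [hx i hi]
    simp
  · have h1 : c i ^ s ≤ c n ^ s := Real.rpow_le_rpow (h.nonneg i) (h.antitone hi) hs
    have h2 := pow_le_pow_left₀ (Real.rpow_nonneg (h.nonneg i) s) h1 2
    exact mul_le_mul_of_nonneg_right h2 (sq_nonneg _)

theorem IsSchmidtSystem.isCompactOperator {A : H →L[ℂ] H} {f : ℕ → H} {c : ℕ → ℝ}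
    (h : IsSchmidtSystem A f c) (hc : Tendsto c atTop (𝓝 0)) : IsCompactOperator A := by
  refine isCompactOperator_of_forall_orthogonal fun ε hε => ?_
  obtain ⟨n, hn⟩ := (hc.eventually_lt_const hε).exists
  refine ⟨Submodule.span ℂ (Set.range fun i : Fin n => f i),
    FiniteDimensional.span_of_finite ℂ (Set.finite_range _), fun x hx => ?_⟩
  refine (h.norm_le n x fun i hi =>
    (Submodule.mem_orthogonal _ _).mp hx _ (Submodule.subset_span ⟨⟨i, hi⟩, rfl⟩)).trans ?_
  exact mul_le_mul_of_nonneg_right hn.le (norm_nonneg _)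

theorem exists_isSchmidtSystem_abs_rpow (hH : ¬ FiniteDimensional ℂ H) {T : H →L[ℂ] H}
    (hT : IsCompactOperator T) (hinj : ∀ x, T x = 0 → x = 0) {s : ℝ} (hs : 0 ≤ s) :
    ∃ f, IsSchmidtSystem (CFC.abs T ^ s : H →L[ℂ] H) f (fun n => mu T n ^ s) := by
  obtain ⟨f, h⟩ := exists_isSchmidtSystem_abs hH hT
  refine ⟨f, isSchmidtSystem_rpow (CFC.abs_nonneg T) (fun x hx => hinj x ?_) h (tendsto_mu hH hT) hs⟩
  rw [← norm_eq_zero, ← norm_abs_apply, hx, norm_zero]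

theorem isCompactOperator_abs_rpow (hH : ¬ FiniteDimensional ℂ H) {T : H →L[ℂ] H}
    (hT : IsCompactOperator T) (hinj : ∀ x, T x = 0 → x = 0) {s : ℝ} (hs : 0 < s) :
    IsCompactOperator (CFC.abs T ^ s : H →L[ℂ] H) := by
  obtain ⟨f, h⟩ := exists_isSchmidtSystem_abs_rpow hH hT hinj hs.le
  refine h.isCompactOperator ?_
  have := (tendsto_mu hH hT).rpow_const (p := s) (Or.inr hs.le)
  rwa [Real.zero_rpow hs.ne'] at this

theorem mu_abs_rpow (hH : ¬ FiniteDimensional ℂ H) {T : H →L[ℂ] H}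
    (hT : IsCompactOperator T) (hinj : ∀ x, T x = 0 → x = 0) {s : ℝ} (hs : 0 ≤ s) (n : ℕ) :
    mu (CFC.abs T ^ s : H →L[ℂ] H) n = mu T n ^ s := by
  obtain ⟨f, h⟩ := exists_isSchmidtSystem_abs_rpow hH hT hinj hs
  exact h.mu_eq CFC.rpow_nonneg n

theorem mu_pos (hH : ¬ FiniteDimensional ℂ H) {T : H →L[ℂ] H} (hT : IsCompactOperator T)
    (hinj : ∀ x, T x = 0 → x = 0) (n : ℕ) : 0 < mu T n := by
  obtain ⟨f, h⟩ := exists_isSchmidtSystem_abs hH hT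
  refine lt_of_le_of_ne (mu_nonneg T n) fun h0 => h.orthonormal.ne_zero n (hinj _ ?_)
  rw [← norm_eq_zero, ← norm_abs_apply, h.apply_eq, ← h0]
  simp

/-! ### Inequalities for sums of eigenvalues -/

/-- The decomposition of a quadratic form along the first `n` vectors of a Schmidt system. -/
theorem IsSchmidtSystem.re_inner_eq {A : H →L[ℂ] H} (hA : 0 ≤ A) {f : ℕ → H} {c : ℕ → ℝ}
    (h : IsSchmidtSystem A f c) (n : ℕ) (x : H) : ∃ q : H,
      (∀ i < n, inner ℂ (f i) q = (0 : ℂ)) ∧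
      ‖x‖ ^ 2 = ∑ i ∈ Finset.range n, ‖inner ℂ (f i) x‖ ^ 2 + ‖q‖ ^ 2 ∧
      (inner ℂ x (A x) : ℂ).re =
        ∑ i ∈ Finset.range n, c i * ‖inner ℂ (f i) x‖ ^ 2 + (inner ℂ q (A q) : ℂ).re := by
  set a : ℕ → ℂ := fun i => inner ℂ (f i) x with ha
  set p : H := ∑ i ∈ Finset.range n, a i • f i with hp
  set q : H := x - p with hq
  have hx : x = p + q := by rw [hq]; abel
  have hfq : ∀ i < n, inner ℂ (f i) q = (0 : ℂ) := fun i hi => by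
    rw [hq, inner_sub_right, hp, h.orthonormal.inner_right_sum a (Finset.mem_range.mpr hi), ha,
      sub_self]
  have hAp : A p = ∑ i ∈ Finset.range n, (a i * c i) • f i := by
    rw [hp, map_sum]
    exact Finset.sum_congr rfl fun i _ => by rw [map_smul, h.apply_eq, smul_smul]
  have horth : ∀ b : ℕ → ℂ, inner ℂ (∑ i ∈ Finset.range n, b i • f i) q = (0 : ℂ) := fun b => by
    rw [sum_inner]
    exact Finset.sum_eq_zero fun i hi => by
      rw [inner_smul_left, hfq i (Finset.mem_range.mp hi), mul_zero]
  have hpp : (inner ℂ p p : ℂ).re = ∑ i ∈ Finset.range n, ‖a i‖ ^ 2 := by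
    rw [hp, h.orthonormal.inner_sum, Complex.re_sum]
    exact Finset.sum_congr rfl fun i _ => by
      rw [Complex.conj_mul']; norm_cast
  have hpA : (inner ℂ p (A p) : ℂ).re = ∑ i ∈ Finset.range n, c i * ‖a i‖ ^ 2 := by
    rw [hAp, hp, h.orthonormal.inner_sum, Complex.re_sum]
    refine Finset.sum_congr rfl fun i _ => ?_
    rw [← mul_assoc, Complex.conj_mul', mul_comm]
    norm_cast
  have hpq : inner ℂ p q = (0 : ℂ) := horth a
  have hqp : inner ℂ q p = (0 : ℂ) := inner_eq_zero_symm.mp hpq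
  have hApq : inner ℂ (A p) q = (0 : ℂ) := by rw [hAp]; exact horth _
  have hpAq : inner ℂ p (A q) = (0 : ℂ) := by
    rw [← ContinuousLinearMap.adjoint_inner_left, ← ContinuousLinearMap.star_eq_adjoint,
      hA.isSelfAdjoint.star_eq, hApq]
  have hqAp : inner ℂ q (A p) = (0 : ℂ) := inner_eq_zero_symm.mp hApq
  have hnorm : ∀ y : H, ‖y‖ ^ 2 = (inner ℂ y y : ℂ).re := fun y => by
    rw [inner_self_eq_norm_sq_to_K]; norm_cast
  refine ⟨q, hfq, ?_, ?_⟩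
  · rw [hnorm x, hnorm q, ← hpp]
    conv_lhs => rw [hx]
    rw [inner_add_left, inner_add_right, inner_add_right, hpq, hqp]
    simp
  · rw [← hpA]
    conv_lhs => rw [hx]
    rw [map_add, inner_add_left, inner_add_right, inner_add_right, hpAq, hqAp]
    simp

theorem IsSchmidtSystem.sum_le_re_inner {A : H →L[ℂ] H} (hA : 0 ≤ A) {f : ℕ → H} {c : ℕ → ℝ}
    (h : IsSchmidtSystem A f c) (n : ℕ) (x : H) :
    ∑ i ∈ Finset.range n, c i * ‖inner ℂ (f i) x‖ ^ 2 ≤ (inner ℂ x (A x) : ℂ).re := by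
  obtain ⟨q, -, -, h2⟩ := h.re_inner_eq hA n x
  have h3 : 0 ≤ (inner ℂ q (A q) : ℂ).re :=
    ((ContinuousLinearMap.nonneg_iff_isPositive _).mp hA).re_inner_nonneg_right q
  linarith

/-- The remainder `q` contributes at most `c n * ‖q‖²`; expressing `‖q‖²` through `‖x‖²` leaves the
weights `c i - c n ≥ 0`, to which Bessel's inequality can be applied. -/
theorem IsSchmidtSystem.re_inner_le {A : H →L[ℂ] H} (hA : 0 ≤ A) {f : ℕ → H} {c : ℕ → ℝ}
    (h : IsSchmidtSystem A f c) (n : ℕ) (x : H) : (inner ℂ x (A x) : ℂ).re ≤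
      ∑ i ∈ Finset.range n, (c i - c n) * ‖inner ℂ (f i) x‖ ^ 2 + c n * ‖x‖ ^ 2 := by
  obtain ⟨q, hq, h1, h2⟩ := h.re_inner_eq hA n x
  have h3 : (inner ℂ q (A q) : ℂ).re ≤ c n * ‖q‖ ^ 2 := by
    calc (inner ℂ q (A q) : ℂ).re ≤ ‖q‖ * ‖A q‖ := re_inner_le_norm (𝕜 := ℂ) _ _
      _ ≤ ‖q‖ * (c n * ‖q‖) := by gcongr; exact h.norm_le n q hq
      _ = _ := by ring
  simp only [sub_mul, Finset.sum_sub_distrib, ← Finset.mul_sum]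
  rw [h2, h1]
  linarith

/-- Ky Fan's maximum principle. -/
theorem sum_re_inner_le_partialSum (hH : ¬ FiniteDimensional ℂ H) {A : H →L[ℂ] H} (hA : 0 ≤ A)
    (hAc : IsCompactOperator A) {ι : Type*} [Fintype ι] {e : ι → H} (he : Orthonormal ℂ e) {n : ℕ}
    (hn : Fintype.card ι ≤ n) : ∑ k, (inner ℂ (e k) (A (e k)) : ℂ).re ≤ partialSum A n := by
  obtain ⟨f, h⟩ := exists_isSchmidtSystem_mu hH hA hAc
  calc ∑ k, (inner ℂ (e k) (A (e k)) : ℂ).re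
      ≤ ∑ k, (∑ i ∈ Finset.range n, (mu A i - mu A n) * ‖inner ℂ (f i) (e k)‖ ^ 2
          + mu A n * ‖e k‖ ^ 2) := Finset.sum_le_sum fun k _ => h.re_inner_le hA n (e k)
    _ = ∑ i ∈ Finset.range n, (mu A i - mu A n) * ∑ k, ‖inner ℂ (e k) (f i)‖ ^ 2
          + Fintype.card ι * mu A n := by
        rw [Finset.sum_add_distrib, Finset.sum_comm]
        congr 1
        · refine Finset.sum_congr rfl fun i _ => ?_
          rw [Finset.mul_sum]
          exact Finset.sum_congr rfl fun k _ => by rw [← inner_conj_symm, RCLike.norm_conj]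
        · simp [he.1]
    -- Bessel's inequality for the system `e` and the unit vector `f i`.
    _ ≤ ∑ i ∈ Finset.range n, (mu A i - mu A n) * 1 + n * mu A n := by
        gcongr with i hi
        · exact sub_nonneg.mpr (h.antitone (Finset.mem_range.mp hi).le)
        · have := he.sum_inner_products_le (s := Finset.univ) (f i)
          rwa [h.orthonormal.1, one_pow] at this
        · exact mu_nonneg _ _
    _ = partialSum A n := by
        simp [partialSum]

theorem sum_re_inner_eq_partialSum {A : H →L[ℂ] H} {f : ℕ → H}
    (h : IsSchmidtSystem A f (mu A)) (n : ℕ) :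
    ∑ k : Fin n, (inner ℂ (f k) (A (f k)) : ℂ).re = partialSum A n := by
  rw [partialSum, Finset.sum_range]
  refine Finset.sum_congr rfl fun k _ => ?_
  rw [h.apply_eq, inner_smul_right, inner_self_eq_norm_sq_to_K, h.orthonormal.1]
  simp

/-- Evaluate the sum on its own leading eigenvectors and bound each summand by Ky Fan's principle.
-/
theorem partialSum_add_le (hH : ¬ FiniteDimensional ℂ H) {A B : H →L[ℂ] H} (hA : 0 ≤ A)
    (hB : 0 ≤ B) (hAc : IsCompactOperator A) (hBc : IsCompactOperator B) (n : ℕ) :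
    partialSum (A + B) n ≤ partialSum A n + partialSum B n := by
  obtain ⟨f, h⟩ := exists_isSchmidtSystem_mu hH (add_nonneg hA hB) (hAc.add hBc)
  have ho := h.orthonormal.comp (fun i : Fin n => (i : ℕ)) Fin.val_injective
  rw [← sum_re_inner_eq_partialSum h]
  have h1 := sum_re_inner_le_partialSum hH hA hAc ho (Fintype.card_fin n).le
  have h2 := sum_re_inner_le_partialSum hH hB hBc ho (Fintype.card_fin n).le
  refine le_trans (le_of_eq ?_) (add_le_add h1 h2)
  rw [← Finset.sum_add_distrib]
  refine Finset.sum_congr rfl fun k _ => ?_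
  rw [add_apply, inner_add_right, Complex.add_re]
  rfl

theorem IsSchmidtSystem.partialSum_le_sum_re_inner {A : H →L[ℂ] H} (hA : 0 ≤ A) {f : ℕ → H}
    (h : IsSchmidtSystem A f (mu A)) {V : Submodule ℂ H} {ι : Type*} [Fintype ι]
    (b : OrthonormalBasis ι ℂ V) {n : ℕ} (hV : ∀ i < n, f i ∈ V) :
    partialSum A n ≤ ∑ k, (inner ℂ (b k : H) (A (b k)) : ℂ).re := by
  calc partialSum A n
      = ∑ i ∈ Finset.range n, mu A i * ∑ k, ‖inner ℂ (f i) (b k : H)‖ ^ 2 := by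
        refine Finset.sum_congr rfl fun i hi => ?_
        have h1 := b.sum_sq_norm_inner_left ⟨f i, hV i (Finset.mem_range.mp hi)⟩
        have h2 : ∑ k, ‖inner ℂ (f i) (b k : H)‖ ^ 2 = 1 := by
          refine Eq.trans h1 ?_
          rw [Submodule.coe_norm, h.orthonormal.1, one_pow]
        rw [h2, mul_one]
    _ = ∑ k, ∑ i ∈ Finset.range n, mu A i * ‖inner ℂ (f i) (b k : H)‖ ^ 2 := by
        rw [Finset.sum_comm]
        exact Finset.sum_congr rfl fun i _ => Finset.mul_sum _ _ _
    _ ≤ _ := Finset.sum_le_sum fun k _ => h.sum_le_re_inner hA n (b k)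

/-- The leading `n` eigenvectors of `A` and of `B` span a space of dimension at most `2 n`; on an
orthonormal basis of it, the form of `A + B` dominates both partial sums. The doubled index is the
only obstruction to additivity. -/
theorem partialSum_add_partialSum_le (hH : ¬ FiniteDimensional ℂ H) {A B : H →L[ℂ] H} (hA : 0 ≤ A)
    (hB : 0 ≤ B) (hAc : IsCompactOperator A) (hBc : IsCompactOperator B) (n : ℕ) :
    partialSum A n + partialSum B n ≤ partialSum (A + B) (2 * n) := by
  obtain ⟨f, hf⟩ := exists_isSchmidtSystem_mu hH hA hAc
  obtain ⟨g, hg⟩ := exists_isSchmidtSystem_mu hH hB hBc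
  set V : Submodule ℂ H := Submodule.span ℂ (Set.range fun i : Fin n => f i) ⊔
    Submodule.span ℂ (Set.range fun i : Fin n => g i) with hV
  have hf1 : FiniteDimensional ℂ (Submodule.span ℂ (Set.range fun i : Fin n => f i)) :=
    FiniteDimensional.span_of_finite ℂ (Set.finite_range _)
  have hg1 : FiniteDimensional ℂ (Submodule.span ℂ (Set.range fun i : Fin n => g i)) :=
    FiniteDimensional.span_of_finite ℂ (Set.finite_range _)
  have hcard : Module.finrank ℂ V ≤ 2 * n := by
    have h1 := finrank_range_le_card (R := ℂ) fun i : Fin n => f i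
    have h2 := finrank_range_le_card (R := ℂ) fun i : Fin n => g i
    rw [Set.finrank, Fintype.card_fin] at h1 h2
    have h3 := Submodule.finrank_add_le_finrank_add_finrank
      (Submodule.span ℂ (Set.range fun i : Fin n => f i))
      (Submodule.span ℂ (Set.range fun i : Fin n => g i))
    rw [← hV] at h3
    omega
  let b := stdOrthonormalBasis ℂ V
  have h1 := hf.partialSum_le_sum_re_inner hA b (n := n) fun i hi =>
    Submodule.mem_sup_left (Submodule.subset_span ⟨⟨i, hi⟩, rfl⟩)
  have h2 := hg.partialSum_le_sum_re_inner hB b (n := n) fun i hi =>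
    Submodule.mem_sup_right (Submodule.subset_span ⟨⟨i, hi⟩, rfl⟩)
  have h3 := sum_re_inner_le_partialSum hH (add_nonneg hA hB) (hAc.add hBc)
    (b.orthonormal.comp_linearIsometry V.subtypeₗᵢ) (n := 2 * n)
    ((Fintype.card_fin _).trans_le hcard)
  refine (add_le_add h1 h2).trans (le_trans (le_of_eq ?_) h3)
  rw [← Finset.sum_add_distrib]
  refine Finset.sum_congr rfl fun k _ => ?_
  rw [add_apply, inner_add_right, Complex.add_re]
  rfl

/-! ### Generalised limits -/

theorem memℓp_infty_of_eventually_le {x : ℕ → ℝ} {C : ℝ} (h : ∀ᶠ n in atTop, |x n| ≤ C) :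
    Memℓp x ∞ := by
  rw [memℓp_infty_iff]
  have h1 : IsBoundedUnder (· ≤ ·) atTop fun n => ‖x n‖ := ⟨C, by simpa using h⟩
  exact h1.bddAbove_range

theorem memℓp_infty_of_tendsto {x : ℕ → ℝ} {c : ℝ} (h : Tendsto x atTop (𝓝 c)) : Memℓp x ∞ :=
  memℓp_infty_of_eventually_le (C := |c| + 1) <|
    (h.abs.eventually_lt_const (lt_add_one _)).mono fun _ hn => hn.le

theorem exists_abs_le_of_memℓp {x : ℕ → ℝ} (h : Memℓp x ∞) : ∃ C, 0 ≤ C ∧ ∀ n, |x n| ≤ C := by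
  obtain ⟨C, hC⟩ := memℓp_infty_iff.mp h
  exact ⟨C, (norm_nonneg _).trans (hC ⟨0, rfl⟩), fun n => hC ⟨n, rfl⟩⟩

namespace GeneralizedLimit

variable (ω : GeneralizedLimit)

theorem lim_add {x y : ℕ → ℝ} (hx : Memℓp x ∞) (hy : Memℓp y ∞) :
    ω.lim (fun n => x n + y n) = ω.lim x + ω.lim y := by
  have hxy : Memℓp (fun n => x n + y n) ∞ := hx.add hy
  rw [lim, lim, lim, dif_pos hx, dif_pos hy, dif_pos hxy, ← map_add]
  rfl

theorem lim_const_mul {x : ℕ → ℝ} (hx : Memℓp x ∞) (c : ℝ) :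
    ω.lim (fun n => c * x n) = c * ω.lim x := by
  have hcx : Memℓp (fun n => c * x n) ∞ := hx.const_smul c
  rw [lim, lim, dif_pos hx, dif_pos hcx, ← smul_eq_mul, ← map_smul]
  rfl

theorem lim_of_tendsto {x : ℕ → ℝ} {c : ℝ} (h : Tendsto x atTop (𝓝 c)) : ω.lim x = c := by
  rw [lim, dif_pos (memℓp_infty_of_tendsto h)]
  exact ω.limit _ c h

theorem lim_nonneg {x : ℕ → ℝ} (h : ∀ n, 0 ≤ x n) : 0 ≤ ω.lim x := by
  rw [lim]
  split_ifs
  · exact ω.nonneg _ h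
  · exact le_rfl

/-- Boundedness of `x` passes to `y`, so neither side is the default value `0` of an unbounded
sequence. -/
theorem lim_eq_of_tendsto_sub {x y : ℕ → ℝ} (hx : Memℓp x ∞)
    (h : Tendsto (fun n => y n - x n) atTop (𝓝 0)) : ω.lim y = ω.lim x := by
  have h1 := ω.lim_add hx (memℓp_infty_of_tendsto h)
  rw [ω.lim_of_tendsto h, add_zero] at h1
  rw [← h1]
  congr 1
  funext n
  ring

theorem tendsto_mul_sub {x y : ℕ → ℝ} (hx : Memℓp x ∞) {c : ℝ} (hy : Tendsto y atTop (𝓝 c)) :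
    Tendsto (fun n => x n * y n - c * x n) atTop (𝓝 0) := by
  obtain ⟨C, hC0, hC⟩ := exists_abs_le_of_memℓp hx
  have h1 : Tendsto (fun n => C * |y n - c|) atTop (𝓝 0) := by
    have := (hy.sub_const c).abs.const_mul C
    simpa using this
  refine squeeze_zero_norm (fun n => ?_) h1
  rw [Real.norm_eq_abs, show x n * y n - c * x n = x n * (y n - c) by ring, abs_mul]
  exact mul_le_mul_of_nonneg_right (hC n) (abs_nonneg _)

theorem lim_mul_of_tendsto {x y : ℕ → ℝ} (hx : Memℓp x ∞) {c : ℝ} (hy : Tendsto y atTop (𝓝 c)) :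
    ω.lim (fun n => x n * y n) = c * ω.lim x := by
  rw [← ω.lim_const_mul hx]
  exact ω.lim_eq_of_tendsto_sub (hx.const_smul c) (tendsto_mul_sub hx hy)

end GeneralizedLimit

/-! ### Eigenvalue estimates in principal ideals -/

/-- The map `k ↦ k / m` has fibres of at most `m` elements. The upper end is left at `b`, since only
the lower one matters for tails. -/
theorem sum_Ico_div_le {t : ℕ → ℝ} (ht : ∀ n, 0 ≤ t n) {m : ℕ} (hm : 1 ≤ m) (a b : ℕ) :
    ∑ k ∈ Finset.Ico a b, t (k / m) ≤ m * ∑ j ∈ Finset.Ico (a / m) b, t j := by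
  have hmap : ∀ k ∈ Finset.Ico a b, k / m ∈ Finset.Ico (a / m) b := fun k hk => by
    rw [Finset.mem_Ico] at hk ⊢
    exact ⟨Nat.div_le_div_right hk.1, (Nat.div_le_self k m).trans_lt hk.2⟩
  rw [← Finset.sum_fiberwise_of_maps_to hmap, Finset.mul_sum]
  refine Finset.sum_le_sum fun j _ => ?_
  have h1 : ∑ k ∈ (Finset.Ico a b).filter (fun k => k / m = j), t (k / m) =
      ((Finset.Ico a b).filter fun k => k / m = j).card * t j := by
    rw [Finset.sum_congr rfl fun k hk => by rw [(Finset.mem_filter.mp hk).2], Finset.sum_const,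
      nsmul_eq_mul]
  rw [h1]
  refine mul_le_mul_of_nonneg_right ?_ (ht j)
  have h2 : (Finset.Ico a b).filter (fun k => k / m = j) ⊆ Finset.Ico (m * j) (m * j + m) := by
    intro k hk
    have h3 := (Finset.mem_filter.mp hk).2
    rw [Finset.mem_Ico, ← h3]
    exact ⟨Nat.mul_div_le k m, by have := Nat.lt_mul_div_succ k hm; rwa [mul_add, mul_one] at this⟩
  have h4 := Finset.card_le_card h2
  rw [Nat.card_Ico] at h4
  exact_mod_cast h4.trans (by omega)

/-- Induction on the generation of the ideal. Multiplication changes only the constant; a sum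
dilates the index, because `μ_{i+j}(x+y) ≤ μ_i(x) + μ_j(y)`. -/
theorem exists_mu_le_of_mem_span (hH : ¬ FiniteDimensional ℂ H) {T : H →L[ℂ] H}
    (hT : IsCompactOperator T) {B : H →L[ℂ] H}
    (hB : B ∈ TwoSidedIdeal.span ({T} : Set (H →L[ℂ] H))) :
    IsCompactOperator B ∧ ∃ C : ℝ, 0 ≤ C ∧ ∃ m : ℕ, 1 ≤ m ∧ ∀ k, mu B k ≤ C * mu T (k / m) := by
  have hanti := mu_antitone hH hT
  induction hB using TwoSidedIdeal.span_induction with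
  | mem x hx =>
    rw [Set.mem_singleton_iff.mp hx]
    exact ⟨hT, 1, zero_le_one, 1, le_rfl, fun k => by rw [Nat.div_one, one_mul]⟩
  | zero =>
    refine ⟨isCompactOperator_zero, 0, le_rfl, 1, le_rfl, fun k => ?_⟩
    rw [mu_zero hH, zero_mul]
  | add x y _ _ hx hy =>
    obtain ⟨hxc, C, hC, m, hm, h⟩ := hx
    obtain ⟨hyc, C', hC', m', hm', h'⟩ := hy
    -- The factor `2` comes from splitting `k` in halves, and `m * m'` dominates both dilations.
    refine ⟨hxc.add hyc, C + C', add_nonneg hC hC', 2 * (m * m'), by nlinarith, fun k => ?_⟩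
    have h1 : mu (x + y) k ≤ mu x (k / 2) + mu y (k / 2) :=
      (mu_antitone hH (hxc.add hyc) (by omega)).trans (mu_add_le hH hxc hyc (k / 2) (k / 2))
    have h2 : mu T (k / 2 / m) ≤ mu T (k / (2 * (m * m'))) := hanti <| by
      rw [← Nat.div_div_eq_div_mul, ← Nat.div_div_eq_div_mul]
      exact Nat.div_le_self _ _
    have h3 : mu T (k / 2 / m') ≤ mu T (k / (2 * (m * m'))) := hanti <| by
      rw [← Nat.div_div_eq_div_mul, mul_comm m m', ← Nat.div_div_eq_div_mul]
      exact Nat.div_le_self _ _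
    calc mu (x + y) k ≤ C * mu T (k / 2 / m) + C' * mu T (k / 2 / m') :=
          h1.trans (add_le_add (h _) (h' _))
      _ ≤ C * mu T (k / (2 * (m * m'))) + C' * mu T (k / (2 * (m * m'))) := by gcongr
      _ = _ := by ring
  | neg x _ hx =>
    obtain ⟨hxc, C, hC, m, hm, h⟩ := hx
    refine ⟨hxc.neg, C, hC, m, hm, fun k => ?_⟩
    have h1 := mu_smul hH hxc (-1) k
    rw [neg_one_smul, norm_neg, norm_one, one_mul] at h1
    rw [h1]
    exact h k
  | left_absorb a x _ hx =>
    obtain ⟨hxc, C, hC, m, hm, h⟩ := hx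
    refine ⟨isCompactOperator_mul_left hxc a, ‖a‖ * C, by positivity, m, hm, fun k => ?_⟩
    rw [mul_assoc]
    exact (mu_mul_left_le hH hxc a k).trans (mul_le_mul_of_nonneg_left (h k) (norm_nonneg _))
  | right_absorb a x _ hx =>
    obtain ⟨hxc, C, hC, m, hm, h⟩ := hx
    refine ⟨isCompactOperator_mul_right hxc a, ‖a‖ * C, by positivity, m, hm, fun k => ?_⟩
    rw [mul_assoc]
    exact (mu_mul_right_le hH hxc a k).trans (mul_le_mul_of_nonneg_left (h k) (norm_nonneg _))

theorem exists_sum_Ico_mu_le_of_mem_span (hH : ¬ FiniteDimensional ℂ H) {T : H →L[ℂ] H}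
    (hT : IsCompactOperator T) {B : H →L[ℂ] H}
    (hB : B ∈ TwoSidedIdeal.span ({T} : Set (H →L[ℂ] H))) :
    ∃ C : ℝ, 0 ≤ C ∧ ∃ m : ℕ, 1 ≤ m ∧ ∀ a b, ∑ k ∈ Finset.Ico a b, mu B k ≤
      C * ∑ j ∈ Finset.Ico (a / m) b, mu T j := by
  obtain ⟨-, C, hC, m, hm, h⟩ := exists_mu_le_of_mem_span hH hT hB
  refine ⟨C * m, by positivity, m, hm, fun a b => ?_⟩
  calc ∑ k ∈ Finset.Ico a b, mu B k ≤ ∑ k ∈ Finset.Ico a b, C * mu T (k / m) :=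
        Finset.sum_le_sum fun k _ => h k
    _ = C * ∑ k ∈ Finset.Ico a b, mu T (k / m) := (Finset.mul_sum _ _ _).symm
    _ ≤ C * (m * ∑ j ∈ Finset.Ico (a / m) b, mu T j) := by
        gcongr
        exact sum_Ico_div_le (mu_nonneg T) hm a b
    _ = _ := by ring

theorem exists_partialSum_le_of_mem_span (hH : ¬ FiniteDimensional ℂ H) {T : H →L[ℂ] H}
    (hT : IsCompactOperator T) {B : H →L[ℂ] H}
    (hB : B ∈ TwoSidedIdeal.span ({T} : Set (H →L[ℂ] H))) :
    ∃ C : ℝ, 0 ≤ C ∧ ∀ n, partialSum B n ≤ C * partialSum T n := by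
  obtain ⟨C, hC, m, -, h⟩ := exists_sum_Ico_mu_le_of_mem_span hH hT hB
  refine ⟨C, hC, fun n => ?_⟩
  have := h 0 n
  rwa [Nat.zero_div, ← Finset.range_eq_Ico] at this

theorem partialSum_nonneg (T : H →L[ℂ] H) (n : ℕ) : 0 ≤ partialSum T n :=
  Finset.sum_nonneg fun k _ => mu_nonneg T k

theorem isTraceClass_of_mem_span (hH : ¬ FiniteDimensional ℂ H) {T : H →L[ℂ] H}
    (hT : IsTraceClass T) {B : H →L[ℂ] H}
    (hB : B ∈ TwoSidedIdeal.span ({T} : Set (H →L[ℂ] H))) : IsTraceClass B := by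
  refine ⟨(exists_mu_le_of_mem_span hH hT.1 hB).1, ?_⟩
  obtain ⟨C, hC, h⟩ := exists_partialSum_le_of_mem_span hH hT.1 hB
  refine summable_of_sum_range_le (c := C * ∑' k, mu T k) (mu_nonneg B) fun n => (h n).trans ?_
  gcongr
  exact hT.2.sum_le_tsum _ fun k _ => mu_nonneg T k

theorem memL1Inf_of_mem_span (hH : ¬ FiniteDimensional ℂ H) {T : H →L[ℂ] H}
    (hT : MemL1Inf T) {B : H →L[ℂ] H}
    (hB : B ∈ TwoSidedIdeal.span ({T} : Set (H →L[ℂ] H))) : MemL1Inf B := by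
  refine ⟨(exists_mu_le_of_mem_span hH hT.1 hB).1, ?_⟩
  obtain ⟨C, hC, h⟩ := exists_partialSum_le_of_mem_span hH hT.1 hB
  refine IsBigO.trans (IsBigO.of_bound C (Eventually.of_forall fun n => ?_)) hT.2
  rw [Real.norm_of_nonneg (partialSum_nonneg _ _), Real.norm_of_nonneg (partialSum_nonneg _ _)]
  exact h n

/-! ### A principal ideal contains adjoints, smaller positive operators and Jordan parts -/

theorem smul_mem_span {T B : H →L[ℂ] H}
    (hB : B ∈ TwoSidedIdeal.span ({T} : Set (H →L[ℂ] H))) (c : ℂ) :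
    c • B ∈ TwoSidedIdeal.span ({T} : Set (H →L[ℂ] H)) := by
  have := TwoSidedIdeal.mul_mem_left _ (c • (1 : H →L[ℂ] H)) B hB
  rwa [smul_mul_assoc, one_mul] at this

theorem conj_mem_span {T B : H →L[ℂ] H}
    (hB : B ∈ TwoSidedIdeal.span ({T} : Set (H →L[ℂ] H))) (U V : H →L[ℂ] H) :
    U * B * V ∈ TwoSidedIdeal.span ({T} : Set (H →L[ℂ] H)) :=
  TwoSidedIdeal.mul_mem_right _ _ _ (TwoSidedIdeal.mul_mem_left _ _ _ hB)

theorem star_mem_span {T B : H →L[ℂ] H}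
    (hB : B ∈ TwoSidedIdeal.span ({T} : Set (H →L[ℂ] H))) :
    star B ∈ TwoSidedIdeal.span ({T} : Set (H →L[ℂ] H)) := by
  obtain ⟨U, V, -, -, h⟩ := exists_star_eq_mul_mul B
  rw [h]
  exact conj_mem_span hB U V

theorem mem_span_of_le {T S R : H →L[ℂ] H} (hS : 0 ≤ S) (hSR : S ≤ R)
    (hR : R ∈ TwoSidedIdeal.span ({T} : Set (H →L[ℂ] H))) :
    S ∈ TwoSidedIdeal.span ({T} : Set (H →L[ℂ] H)) := by
  obtain ⟨C, -, h⟩ := exists_eq_conj_of_le hS hSR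
  rw [h]
  exact conj_mem_span hR C _

theorem posPart_mem_span {T B : H →L[ℂ] H} (hB : IsSelfAdjoint B)
    (hBT : B ∈ TwoSidedIdeal.span ({T} : Set (H →L[ℂ] H))) :
    B⁺ ∈ TwoSidedIdeal.span ({T} : Set (H →L[ℂ] H)) := by
  obtain ⟨C, h⟩ := exists_posPart_eq_mul hB
  rw [h]
  exact TwoSidedIdeal.mul_mem_left _ _ _ hBT

theorem negPart_mem_span {T B : H →L[ℂ] H} (hB : IsSelfAdjoint B)
    (hBT : B ∈ TwoSidedIdeal.span ({T} : Set (H →L[ℂ] H))) :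
    B⁻ ∈ TwoSidedIdeal.span ({T} : Set (H →L[ℂ] H)) := by
  rw [← CFC.posPart_neg]
  exact posPart_mem_span hB.neg (TwoSidedIdeal.neg_mem _ hBT)

theorem realPart_mem_span {T B : H →L[ℂ] H}
    (hB : B ∈ TwoSidedIdeal.span ({T} : Set (H →L[ℂ] H))) :
    (ℜ B : H →L[ℂ] H) ∈ TwoSidedIdeal.span ({T} : Set (H →L[ℂ] H)) := by
  have h := smul_mem_span (TwoSidedIdeal.add_mem _ hB (star_mem_span hB)) (2⁻¹ : ℂ)
  convert h using 1
  rw [realPart_apply_coe, ← Complex.coe_smul]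
  norm_num

theorem imaginaryPart_mem_span {T B : H →L[ℂ] H}
    (hB : B ∈ TwoSidedIdeal.span ({T} : Set (H →L[ℂ] H))) :
    (ℑ B : H →L[ℂ] H) ∈ TwoSidedIdeal.span ({T} : Set (H →L[ℂ] H)) := by
  have h := smul_mem_span (TwoSidedIdeal.sub_mem _ hB (star_mem_span hB)) (-Complex.I * 2⁻¹ : ℂ)
  convert h using 1
  rw [imaginaryPart_apply_coe, ← Complex.coe_smul, smul_smul]
  norm_num

/-- If two weights are proportional on the positive part of an ideal, so are their linear
extensions on the ideal. -/
theorem linExt_eq_mul_of_forall_mem_span {T : H →L[ℂ] H} {φ ψ : (H →L[ℂ] H) → ℝ≥0∞} {c : ℝ}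
    (h : ∀ P, 0 ≤ P → P ∈ TwoSidedIdeal.span ({T} : Set (H →L[ℂ] H)) →
      (φ P).toReal = c * (ψ P).toReal) {B : H →L[ℂ] H}
    (hB : B ∈ TwoSidedIdeal.span ({T} : Set (H →L[ℂ] H))) :
    linExt φ B = (c : ℂ) * linExt ψ B := by
  have hr := realPart_mem_span hB
  have hi := imaginaryPart_mem_span hB
  have h1 := h _ (CFC.posPart_nonneg (ℜ B : H →L[ℂ] H)) (posPart_mem_span (ℜ B).2 hr)
  have h2 := h _ (CFC.negPart_nonneg (ℜ B : H →L[ℂ] H)) (negPart_mem_span (ℜ B).2 hr)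
  have h3 := h _ (CFC.posPart_nonneg (ℑ B : H →L[ℂ] H)) (posPart_mem_span (ℑ B).2 hi)
  have h4 := h _ (CFC.negPart_nonneg (ℑ B : H →L[ℂ] H)) (negPart_mem_span (ℑ B).2 hi)
  rw [linExt, linExt, h1, h2, h3, h4]
  push_cast
  ring

/-! ### Singular traces from eccentric operators -/

open Classical in
/-- The sequence `S_n(B)` formed with the convention (partial sums or tails) that suits `T`. -/
def relativeSeq (T B : H →L[ℂ] H) (n : ℕ) : ℝ :=
  if IsTraceClass T then ∑' k, mu B (n + k) else partialSum B n

theorem relativeSeq_nonneg (T B : H →L[ℂ] H) (n : ℕ) : 0 ≤ relativeSeq T B n := by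
  unfold relativeSeq
  split_ifs
  · exact tsum_nonneg fun k => mu_nonneg B _
  · exact partialSum_nonneg B n

theorem partialSum_add_tail {B : H →L[ℂ] H} (hB : Summable (mu B)) (n : ℕ) :
    partialSum B n + ∑' k, mu B (n + k) = ∑' k, mu B k := by
  have h := hB.sum_add_tsum_nat_add n
  simp only [add_comm _ n] at h
  exact h

theorem partialSum_sub {B : H →L[ℂ] H} {a b : ℕ} (hab : a ≤ b) :
    partialSum B b - partialSum B a = ∑ k ∈ Finset.Ico a b, mu B k :=
  (Finset.sum_Ico_eq_sub _ hab).symm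

/-- The operator `T` is eccentric along `ν`: its sequence `S_n` is slowly varying along `ν`. -/
structure IsEccentricAlong (T : H →L[ℂ] H) (ν : ℕ → ℕ) : Prop where
  tendsto_atTop : Tendsto ν atTop atTop
  tendsto_zero : ∀ m : ℕ, 1 ≤ m → Tendsto (fun k =>
    (∑ j ∈ Finset.Ico (ν k / m) (m * ν k), mu T j) / integralSeq T (ν k)) atTop (𝓝 0)

section

variable {T : H →L[ℂ] H} {ν : ℕ → ℕ}

theorem integralSeq_pos (hpos : ∀ n, 0 < mu T n) {n : ℕ} (hn : 1 ≤ n) : 0 < integralSeq T n := by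
  unfold integralSeq
  split_ifs with h
  · have hs : Summable fun k => mu T (n + k) := by
      simpa only [add_comm _ n] using (summable_nat_add_iff n).mpr h.2
    exact hs.tsum_pos (fun k => (hpos _).le) 0 (hpos _)
  · exact Finset.sum_pos (fun k _ => hpos k) ⟨0, Finset.mem_range.mpr hn⟩

/-- For tails, the dilated index `n / m` costs the extra block from `n / m` to `n`, which
eccentricity makes negligible. For partial sums no block is needed. The block is extended to `m * n`
to match `IsEccentricAlong`. -/
theorem exists_relativeSeq_le (hH : ¬ FiniteDimensional ℂ H) (hT : IsCompactOperator T)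
    {B : H →L[ℂ] H} (hB : B ∈ TwoSidedIdeal.span ({T} : Set (H →L[ℂ] H))) :
    ∃ C : ℝ, 0 ≤ C ∧ ∃ m : ℕ, 1 ≤ m ∧ ∀ n, relativeSeq T B n ≤
      C * (integralSeq T n + ∑ j ∈ Finset.Ico (n / m) (m * n), mu T j) := by
  obtain ⟨C, hC, m, hm, h⟩ := exists_sum_Ico_mu_le_of_mem_span hH hT hB
  refine ⟨C, hC, m, hm, fun n => ?_⟩
  have h0 : 0 ≤ ∑ j ∈ Finset.Ico (n / m) (m * n), mu T j :=
    Finset.sum_nonneg fun k _ => mu_nonneg T k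
  unfold relativeSeq integralSeq
  split_ifs with hTc
  · have hs := (isTraceClass_of_mem_span hH hTc hB).2
    -- The tail is handled through its finite truncations, to which the block estimate applies.
    have h1 : ∀ N, n ≤ N → ∑ k ∈ Finset.Ico n N, mu B k ≤
        C * (∑' k, mu T (n + k) + ∑ j ∈ Finset.Ico (n / m) (m * n), mu T j) := fun N hN => by
      refine (h n N).trans (mul_le_mul_of_nonneg_left ?_ hC)
      have h2 : partialSum T (n / m) + ∑ j ∈ Finset.Ico (n / m) N, mu T j ≤ ∑' k, mu T k := by
        rw [← partialSum_sub ((Nat.div_le_self n m).trans hN), add_sub_cancel]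
        exact hTc.2.sum_le_tsum _ fun k _ => mu_nonneg T k
      have h3 := partialSum_add_tail hTc.2 n
      have h4 : partialSum T n - partialSum T (n / m) ≤
          ∑ j ∈ Finset.Ico (n / m) (m * n), mu T j := by
        rw [partialSum_sub (Nat.div_le_self n m)]
        exact Finset.sum_le_sum_of_subset_of_nonneg
          (Finset.Ico_subset_Ico_right (Nat.le_mul_of_pos_left n hm)) fun k _ _ => mu_nonneg T k
      linarith
    have h5 : Tendsto (fun N => partialSum B N - partialSum B n) atTop
        (𝓝 (∑' k, mu B (n + k))) := by
      have h6 := hs.hasSum.tendsto_sum_nat.sub_const (partialSum B n)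
      rwa [← partialSum_add_tail hs n, add_sub_cancel_left] at h6
    refine le_of_tendsto h5 ((eventually_ge_atTop n).mono fun N hN => ?_)
    rw [partialSum_sub hN]
    exact h1 N hN
  · have h1 := h 0 n
    rw [Nat.zero_div, ← Finset.range_eq_Ico] at h1
    refine h1.trans (mul_le_mul_of_nonneg_left ?_ hC)
    exact le_add_of_nonneg_right h0

theorem IsEccentricAlong.memℓp (hH : ¬ FiniteDimensional ℂ H) (hT : IsCompactOperator T)
    (hpos : ∀ n, 0 < mu T n) (he : IsEccentricAlong T ν) {B : H →L[ℂ] H}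
    (hB : B ∈ TwoSidedIdeal.span ({T} : Set (H →L[ℂ] H))) :
    Memℓp (fun k => relativeSeq T B (ν k) / integralSeq T (ν k)) ∞ := by
  obtain ⟨C, hC, m, hm, h⟩ := exists_relativeSeq_le hH hT hB
  refine memℓp_infty_of_eventually_le (C := C * (1 + 1)) ?_
  filter_upwards [he.tendsto_atTop.eventually_ge_atTop 1,
    (he.tendsto_zero m hm).eventually_lt_const one_pos] with k hk1 hk2
  have hp := integralSeq_pos hpos hk1
  rw [abs_of_nonneg (div_nonneg (relativeSeq_nonneg _ _ _) hp.le), div_le_iff₀ hp]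
  rw [div_lt_one hp] at hk2
  calc relativeSeq T B (ν k) ≤ _ := h _
    _ ≤ C * (integralSeq T (ν k) + integralSeq T (ν k)) := by gcongr
    _ = _ := by ring

theorem IsEccentricAlong.tendsto_sum_Ico (hH : ¬ FiniteDimensional ℂ H) (hT : IsCompactOperator T)
    (he : IsEccentricAlong T ν) {B : H →L[ℂ] H}
    (hB : B ∈ TwoSidedIdeal.span ({T} : Set (H →L[ℂ] H))) :
    Tendsto (fun k => (∑ j ∈ Finset.Ico (ν k) (2 * ν k), mu B j) / integralSeq T (ν k)) atTop
      (𝓝 0) := by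
  obtain ⟨C, hC, m, hm, h⟩ := exists_sum_Ico_mu_le_of_mem_span hH hT hB
  -- The block of `B` from `n` to `2 n` is controlled by that of `T` from `n / m` to `2 n`, which
  -- lies within the one for the dilation `2 * m`.
  have h1 := (he.tendsto_zero (2 * m) (by omega)).const_mul C
  rw [mul_zero] at h1
  refine squeeze_zero (fun k => div_nonneg (Finset.sum_nonneg fun j _ => mu_nonneg B j)
    (relativeSeq_nonneg T T _)) (fun k => ?_) h1
  rw [← mul_div_assoc]
  refine div_le_div_of_nonneg_right ((h _ _).trans (mul_le_mul_of_nonneg_left ?_ hC))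
    (relativeSeq_nonneg T T _)
  refine Finset.sum_le_sum_of_subset_of_nonneg (Finset.Ico_subset_Ico ?_ ?_)
    fun j _ _ => mu_nonneg T j
  · exact Nat.div_le_div_left (by omega) hm
  · exact Nat.mul_le_mul_right _ (by omega)

theorem tendsto_partialSum_of_not_isTraceClass (hT : IsCompactOperator T)
    (h : ¬ IsTraceClass T) : Tendsto (partialSum T) atTop atTop :=
  (not_summable_iff_tendsto_nat_atTop_of_nonneg (mu_nonneg T)).mp fun hs => h ⟨hT, hs⟩

theorem tendsto_tail (B : H →L[ℂ] H) :
    Tendsto (fun n => ∑' k, mu B (n + k)) atTop (𝓝 0) := by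
  simpa only [add_comm] using tendsto_sum_nat_add (mu B)

/-- The two conventions differ only when `B` is trace class and `T` is not. Then the numerators
differ by a bounded amount while the denominator tends to infinity. -/
theorem associatedTrace_eq (hT : IsCompactOperator T)
    (hH : ¬ FiniteDimensional ℂ H) (hpos : ∀ n, 0 < mu T n) (he : IsEccentricAlong T ν)
    (η : GeneralizedLimit) {B : H →L[ℂ] H}
    (hB : B ∈ TwoSidedIdeal.span ({T} : Set (H →L[ℂ] H))) :
    associatedTrace T ν η B =
      ENNReal.ofReal (η.lim fun k => relativeSeq T B (ν k) / integralSeq T (ν k)) := by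
  rw [associatedTrace, if_pos hB]
  congr 1
  refine η.lim_eq_of_tendsto_sub (he.memℓp hH hT hpos hB) ?_
  by_cases hTc : IsTraceClass T
  · have h1 : ∀ n, integralSeq B n = relativeSeq T B n := fun n => by
      rw [integralSeq, relativeSeq, if_pos hTc, if_pos (isTraceClass_of_mem_span hH hTc hB)]
    simp [h1]
  by_cases hBc : IsTraceClass B
  · have h1 : ∀ n, integralSeq B n - relativeSeq T B n =
        ∑' k, mu B (n + k) - partialSum B n := fun n => by
      rw [integralSeq, relativeSeq, if_neg hTc, if_pos hBc]
    have h2 : ∀ n, integralSeq T n = partialSum T n := fun n => by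
      rw [integralSeq, if_neg hTc]
    simp only [← sub_div, h1, h2]
    refine Tendsto.div_atTop (a := 0 - ∑' k, mu B k) ?_
      ((tendsto_partialSum_of_not_isTraceClass hT hTc).comp he.tendsto_atTop)
    exact ((tendsto_tail B).sub hBc.2.hasSum.tendsto_sum_nat).comp he.tendsto_atTop
  · have h1 : ∀ n, integralSeq B n = relativeSeq T B n := fun n => by
      rw [integralSeq, relativeSeq, if_neg hTc, if_neg hBc]
    simp [h1]

/-- For partial sums these are the two Ky Fan inequalities. In the trace class case their limits
give additivity of the trace, so the defect of the tails is minus that of the partial sums. -/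
theorem abs_relativeSeq_add_sub_le (hH : ¬ FiniteDimensional ℂ H) (hT : IsCompactOperator T)
    {A B : H →L[ℂ] H} (hA : 0 ≤ A) (hB : 0 ≤ B)
    (hAB : A + B ∈ TwoSidedIdeal.span ({T} : Set (H →L[ℂ] H))) (n : ℕ) :
    |relativeSeq T A n + relativeSeq T B n - relativeSeq T (A + B) n| ≤
      ∑ k ∈ Finset.Ico n (2 * n), mu (A + B) k := by
  have hAm := mem_span_of_le hA (le_add_of_nonneg_right hB) hAB
  have hBm := mem_span_of_le hB (le_add_of_nonneg_left hA) hAB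
  have hAc := (exists_mu_le_of_mem_span hH hT hAm).1
  have hBc := (exists_mu_le_of_mem_span hH hT hBm).1
  have h1 := partialSum_add_le hH hA hB hAc hBc
  have h2 := partialSum_add_partialSum_le hH hA hB hAc hBc
  have h3 := partialSum_sub (B := A + B) (show n ≤ 2 * n by omega)
  rw [abs_le, ← h3]
  unfold relativeSeq
  split_ifs with hTc
  · have hAs := (isTraceClass_of_mem_span hH hTc hAm).2
    have hBs := (isTraceClass_of_mem_span hH hTc hBm).2
    have hABs := (isTraceClass_of_mem_span hH hTc hAB).2
    have htr : ∑' k, mu (A + B) k = ∑' k, mu A k + ∑' k, mu B k := by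
      refine le_antisymm ?_ ?_
      · exact le_of_tendsto_of_tendsto' hABs.hasSum.tendsto_sum_nat
          (hAs.hasSum.tendsto_sum_nat.add hBs.hasSum.tendsto_sum_nat) h1
      · refine le_of_tendsto_of_tendsto' (hAs.hasSum.tendsto_sum_nat.add
          hBs.hasSum.tendsto_sum_nat) (hABs.hasSum.tendsto_sum_nat.comp ?_) h2
        exact tendsto_id.const_mul_atTop' two_pos
    have ha := partialSum_add_tail hAs n
    have hb := partialSum_add_tail hBs n
    have hab := partialSum_add_tail hABs n
    constructor <;> linarith [h1 n, h2 n]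
  · constructor <;> linarith [h1 n, h2 n]

theorem relativeSeq_smul (hH : ¬ FiniteDimensional ℂ H) {B : H →L[ℂ] H}
    (hB : IsCompactOperator B) (c : ℝ≥0) (n : ℕ) :
    relativeSeq T (((c : ℝ) : ℂ) • B) n = c * relativeSeq T B n := by
  have h : mu (((c : ℝ) : ℂ) • B) = fun k => (c : ℝ) * mu B k := funext fun k => by
    rw [mu_smul hH hB, Complex.norm_real, Real.norm_of_nonneg c.coe_nonneg]
  unfold relativeSeq partialSum
  rw [h]
  split_ifs
  · exact tsum_mul_left
  · exact (Finset.mul_sum _ _ _).symm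

theorem self_mem_span (T : H →L[ℂ] H) : T ∈ TwoSidedIdeal.span ({T} : Set (H →L[ℂ] H)) :=
  TwoSidedIdeal.subset_span (Set.mem_singleton T)

/-- An injective `T` is bounded below on the finite-dimensional range of `P`, so `P = C T P` by
Douglas' lemma. -/
theorem mem_span_of_finiteDimensional_range (hinj : ∀ x, T x = 0 → x = 0) {P : H →L[ℂ] H}
    (hf : FiniteDimensional ℂ (LinearMap.range (P : H →ₗ[ℂ] H))) :
    P ∈ TwoSidedIdeal.span ({T} : Set (H →L[ℂ] H)) := by
  let g : LinearMap.range (P : H →ₗ[ℂ] H) →ₗ[ℂ] H := (T : H →ₗ[ℂ] H) ∘ₗ Submodule.subtype _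
  have hg : LinearMap.ker g = ⊥ :=
    LinearMap.ker_eq_bot'.mpr fun x hx => Subtype.ext (hinj x hx)
  obtain ⟨K, -, hK⟩ := g.exists_antilipschitzWith hg
  obtain ⟨C, -, hC⟩ := exists_factor_of_norm_le (A := P) (B := T * P) K.2 fun x => by
    have h1 := hK.le_mul_dist ⟨P x, x, rfl⟩ 0
    rwa [dist_zero_right, map_zero, dist_zero_right] at h1
  rw [hC, ← mul_assoc]
  exact conj_mem_span (self_mem_span T) C P

/-- On the ideal, the additivity defect is a block sum that eccentricity kills after division by
`S_n(T)`. Off the ideal, both sides are `∞`: the ideal is closed under passing to smaller positive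
operators, and it contains `A* A` exactly when it contains `A A*`. -/
theorem isSingularTrace_associatedTrace (hH : ¬ FiniteDimensional ℂ H) (hT : IsCompactOperator T)
    (hinj : ∀ x, T x = 0 → x = 0) (he : IsEccentricAlong T ν) (η : GeneralizedLimit) :
    IsSingularTrace (associatedTrace T ν η) := by
  have hpos := mu_pos hH hT hinj
  have heq := fun {B : H →L[ℂ] H} => associatedTrace_eq (B := B) hT hH hpos he η
  have hnn : ∀ B : H →L[ℂ] H,
      0 ≤ η.lim fun k => relativeSeq T B (ν k) / integralSeq T (ν k) := fun B =>
    η.lim_nonneg fun k => div_nonneg (relativeSeq_nonneg _ _ _) (relativeSeq_nonneg T T _)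
  refine ⟨fun A B hA hB => ?_, fun c B _ => ?_, fun A => ?_, fun P hP hf => ?_⟩
  · by_cases hAB : A + B ∈ TwoSidedIdeal.span ({T} : Set (H →L[ℂ] H))
    · have hAm := mem_span_of_le hA (le_add_of_nonneg_right hB) hAB
      have hBm := mem_span_of_le hB (le_add_of_nonneg_left hA) hAB
      rw [heq hAB, heq hAm, heq hBm, ← ENNReal.ofReal_add (hnn A) (hnn B),
        ← η.lim_add (he.memℓp hH hT hpos hAm) (he.memℓp hH hT hpos hBm)]
      congr 1
      symm
      refine η.lim_eq_of_tendsto_sub (he.memℓp hH hT hpos hAB) ?_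
      refine squeeze_zero_norm (fun k => ?_) (he.tendsto_sum_Ico hH hT hAB)
      rw [← add_div, ← sub_div, norm_div, Real.norm_eq_abs,
        Real.norm_of_nonneg (show 0 ≤ integralSeq T (ν k) from relativeSeq_nonneg T T _)]
      exact div_le_div_of_nonneg_right (abs_relativeSeq_add_sub_le hH hT hA hB hAB _)
        (relativeSeq_nonneg T T _)
    · rw [associatedTrace, if_neg hAB]
      by_cases hAm : A ∈ TwoSidedIdeal.span ({T} : Set (H →L[ℂ] H))
      · have hBm : B ∉ TwoSidedIdeal.span ({T} : Set (H →L[ℂ] H)) := fun hBm =>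
          hAB (TwoSidedIdeal.add_mem _ hAm hBm)
        rw [show associatedTrace T ν η B = ∞ from if_neg hBm, add_top]
      · rw [show associatedTrace T ν η A = ∞ from if_neg hAm, top_add]
  -- The value `c = 0` is separate because `B` may lie outside the ideal, where the right side is `0
  -- * ∞ = 0`.
  · rcases eq_or_ne c 0 with rfl | hc
    · have h0 : (0 : H →L[ℂ] H) ∈ TwoSidedIdeal.span ({T} : Set (H →L[ℂ] H)) :=
        TwoSidedIdeal.zero_mem _
      rw [NNReal.coe_zero, Complex.ofReal_zero, zero_smul, heq h0, ENNReal.coe_zero, zero_mul]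
      have h1 := fun n => relativeSeq_smul (T := T) hH (B := 0) isCompactOperator_zero 0 n
      simp only [NNReal.coe_zero, Complex.ofReal_zero, smul_zero, zero_mul] at h1
      simp only [h1, zero_div]
      rw [η.lim_of_tendsto tendsto_const_nhds, ENNReal.ofReal_zero]
    · have hc' : ((c : ℝ) : ℂ) ≠ 0 := by exact_mod_cast hc
      by_cases hB : B ∈ TwoSidedIdeal.span ({T} : Set (H →L[ℂ] H))
      · rw [heq hB, heq (smul_mem_span hB _), ← ENNReal.ofReal_coe_nnreal (p := c),
          ← ENNReal.ofReal_mul c.coe_nonneg, ← η.lim_const_mul (he.memℓp hH hT hpos hB)]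
        simp only [relativeSeq_smul hH (exists_mu_le_of_mem_span hH hT hB).1, mul_div_assoc]
      · have hcB : ((c : ℝ) : ℂ) • B ∉ TwoSidedIdeal.span ({T} : Set (H →L[ℂ] H)) := fun h => hB <| by
          have h1 := smul_mem_span h ((c : ℝ) : ℂ)⁻¹
          rwa [smul_smul, inv_mul_cancel₀ hc', one_smul] at h1
        rw [associatedTrace, associatedTrace, if_neg hB, if_neg hcB,
          ENNReal.mul_top (by exact_mod_cast hc)]
  · have hiff : ∀ A : H →L[ℂ] H, star A * A ∈ TwoSidedIdeal.span ({T} : Set (H →L[ℂ] H)) →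
        A * star A ∈ TwoSidedIdeal.span ({T} : Set (H →L[ℂ] H)) := fun A hA => by
      obtain ⟨C, -, h⟩ := exists_mul_star_eq A
      rw [h]
      exact conj_mem_span hA C _
    by_cases hA : star A * A ∈ TwoSidedIdeal.span ({T} : Set (H →L[ℂ] H))
    · rw [heq hA, heq (hiff A hA)]
      unfold relativeSeq partialSum
      rw [mu_mul_star hH (exists_mu_le_of_mem_span hH hT hA).1]
    · have hA' : A * star A ∉ TwoSidedIdeal.span ({T} : Set (H →L[ℂ] H)) := fun h => hA <| by
        have := hiff (star A)
        rw [star_star] at this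
        exact this h
      rw [associatedTrace, associatedTrace, if_neg hA, if_neg hA']
  · rw [associatedTrace, if_pos (mem_span_of_finiteDimensional_range hinj hf)]
    have h0 : ∀ n, Module.finrank ℂ (LinearMap.range (P : H →ₗ[ℂ] H)) ≤ n → mu P n = 0 :=
      fun n hn => mu_projection_eq_zero hH hP hf hn
    -- `P` is itself trace class, so its integral sequence is a tail, which is zero beyond the rank.
    have hPc : IsTraceClass P := ⟨isCompactOperator_projection hf,
      summable_of_ne_finset_zero (s := Finset.range (Module.finrank ℂ
        (LinearMap.range (P : H →ₗ[ℂ] H)))) fun n hn => h0 n (by simpa using hn)⟩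
    rw [η.lim_of_tendsto (c := 0), ENNReal.ofReal_zero]
    refine tendsto_const_nhds.congr' ?_
    filter_upwards [he.tendsto_atTop.eventually_ge_atTop
      (Module.finrank ℂ (LinearMap.range (P : H →ₗ[ℂ] H)))] with k hk
    rw [integralSeq, if_pos hPc]
    have : ∀ j, mu P (ν k + j) = 0 := fun j => h0 _ (hk.trans (Nat.le_add_right _ _))
    simp [this]

theorem associatedTrace_self (hH : ¬ FiniteDimensional ℂ H) (hT : IsCompactOperator T)
    (hinj : ∀ x, T x = 0 → x = 0) (hν : Tendsto ν atTop atTop) (η : GeneralizedLimit) :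
    associatedTrace T ν η T = 1 := by
  rw [associatedTrace, if_pos (self_mem_span T), η.lim_of_tendsto (c := 1),
    ENNReal.ofReal_one]
  refine tendsto_const_nhds.congr' ?_
  filter_upwards [hν.eventually_ge_atTop 1] with k hk
  exact (div_self (integralSeq_pos (mu_pos hH hT hinj) hk).ne').symm

end

/-! ### A Tauberian theorem -/

/-- The sums `σ ∑ t_n^{1+σ} g(t_n^σ)` from the proof of Karamata's Tauberian theorem. -/
def karamataSum (t : ℕ → ℝ) (g : ℝ → ℝ) (σ : ℝ) : ℝ := ∑' n, σ * t n ^ (1 + σ) * g (t n ^ σ)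

section Karamata

variable {t : ℕ → ℝ} {ℓ : ℝ}

/-- For `y ^ k` the sum has exponent `1 + (k + 1) σ`; the hypothesis at `(k + 1) σ` gives the limit
`ℓ / (k + 1)`, which is `ℓ` times the integral of `y ^ k`. -/
theorem karamataSum_polynomial (ht : ∀ n, 0 < t n)
    (hsum : ∀ σ > (0 : ℝ), Summable fun n => t n ^ (1 + σ))
    (h : Tendsto (fun σ : ℝ => σ * ∑' n, t n ^ (1 + σ)) (𝓝[>] 0) (𝓝 ℓ)) (p : Polynomial ℝ) :
    (∀ σ > (0 : ℝ), Summable fun n => σ * t n ^ (1 + σ) * p.eval (t n ^ σ)) ∧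
    Tendsto (karamataSum t fun y => p.eval y) (𝓝[>] 0) (𝓝 (ℓ * ∫ y in (0 : ℝ)..1, p.eval y)) := by
  induction p using Polynomial.induction_on' with
  | add p q hp hq =>
    simp only [Polynomial.eval_add, mul_add]
    refine ⟨fun σ hσ => (hp.1 σ hσ).add (hq.1 σ hσ), ?_⟩
    rw [intervalIntegral.integral_add (p.continuous.intervalIntegrable _ _)
      (q.continuous.intervalIntegrable _ _), mul_add]
    refine (hp.2.add hq.2).congr' ?_
    filter_upwards [self_mem_nhdsWithin] with σ hσ
    simp only [karamataSum, mul_add]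
    exact ((hp.1 σ hσ).tsum_add (hq.1 σ hσ)).symm
  | monomial k a =>
    have hterm : ∀ (σ : ℝ) n, σ * t n ^ (1 + σ) * (Polynomial.monomial k a).eval (t n ^ σ) =
        σ * a * t n ^ (1 + ((k : ℝ) + 1) * σ) := fun σ n => by
      rw [Polynomial.eval_monomial, ← Real.rpow_mul_natCast (ht n).le,
        show 1 + ((k : ℝ) + 1) * σ = (1 + σ) + σ * k by ring, Real.rpow_add (ht n) (1 + σ)]
      ring
    have hk : (0 : ℝ) < (k : ℝ) + 1 := by positivity
    refine ⟨fun σ hσ => ?_, ?_⟩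
    · simp only [hterm]
      exact (hsum _ (mul_pos hk hσ)).mul_left _
    · have hlim : Tendsto (fun σ : ℝ => ((k : ℝ) + 1) * σ) (𝓝[>] 0) (𝓝[>] 0) := by
        refine tendsto_nhdsWithin_of_tendsto_nhds_of_eventually_within _ ?_ ?_
        · have : Tendsto (fun σ : ℝ => ((k : ℝ) + 1) * σ) (𝓝 0) (𝓝 (((k : ℝ) + 1) * 0)) :=
            tendsto_id.const_mul _
          rw [mul_zero] at this
          exact this.mono_left nhdsWithin_le_nhds
        · filter_upwards [self_mem_nhdsWithin] with σ hσ
          exact mul_pos hk hσ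
      have h1 := (h.comp hlim).const_mul (a / ((k : ℝ) + 1))
      have h2 : ∫ y in (0 : ℝ)..1, (Polynomial.monomial k a).eval y = a / ((k : ℝ) + 1) := by
        simp only [Polynomial.eval_monomial]
        rw [intervalIntegral.integral_const_mul, integral_pow]
        simp [div_eq_mul_inv]
      rw [h2, mul_comm ℓ]
      refine h1.congr fun σ => ?_
      simp only [karamataSum, hterm, Function.comp, tsum_mul_left]
      field_simp

/-- `t 0` may exceed `1`, but `t 0 ^ σ → 1`. A fixed compact interval is needed for Weierstrass
approximation. -/
theorem eventually_rpow_mem_Icc (ht : ∀ n, 0 < t n) (hanti : Antitone t) :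
    ∀ᶠ σ in 𝓝[>] (0 : ℝ), ∀ n, t n ^ σ ∈ Set.Icc (0 : ℝ) 2 := by
  have h1 : Tendsto (fun σ : ℝ => t 0 ^ σ) (𝓝[>] 0) (𝓝 1) := by
    have := (Real.continuousAt_const_rpow (a := t 0) (b := 0) (ht 0).ne').tendsto
    rw [Real.rpow_zero] at this
    exact this.mono_left nhdsWithin_le_nhds
  filter_upwards [h1.eventually_lt_const one_lt_two, self_mem_nhdsWithin] with σ hσ hσ0 n
  exact ⟨Real.rpow_nonneg (ht n).le _,
    (Real.rpow_le_rpow (ht n).le (hanti n.zero_le) (le_of_lt hσ0)).trans hσ.le⟩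

theorem karamata_limit_nonneg (ht : ∀ n, 0 < t n)
    (h : Tendsto (fun σ : ℝ => σ * ∑' n, t n ^ (1 + σ)) (𝓝[>] 0) (𝓝 ℓ)) : 0 ≤ ℓ := by
  refine ge_of_tendsto h ?_
  filter_upwards [self_mem_nhdsWithin] with σ hσ
  exact mul_nonneg (le_of_lt hσ) (tsum_nonneg fun n => Real.rpow_nonneg (ht n).le _)

theorem karamataSum_continuous (ht : ∀ n, 0 < t n) (hanti : Antitone t)
    (hsum : ∀ σ > (0 : ℝ), Summable fun n => t n ^ (1 + σ))
    (h : Tendsto (fun σ : ℝ => σ * ∑' n, t n ^ (1 + σ)) (𝓝[>] 0) (𝓝 ℓ)) {g : ℝ → ℝ}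
    (hg : Continuous g) :
    (∀ᶠ σ in 𝓝[>] 0, Summable fun n => σ * t n ^ (1 + σ) * g (t n ^ σ)) ∧
    Tendsto (karamataSum t g) (𝓝[>] 0) (𝓝 (ℓ * ∫ y in (0 : ℝ)..1, g y)) := by
  have hℓ := karamata_limit_nonneg ht h
  have key : ∀ δ > 0, ∃ p : Polynomial ℝ, (∀ y ∈ Set.Icc (0 : ℝ) 2, |p.eval y - g y| < δ) ∧
      ∀ᶠ σ in 𝓝[>] 0, Summable (fun n => σ * t n ^ (1 + σ) * g (t n ^ σ)) ∧
        |karamataSum t g σ - karamataSum t (fun y => p.eval y) σ| ≤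
          δ * (σ * ∑' n, t n ^ (1 + σ)) := by
    intro δ hδ
    obtain ⟨p, hp⟩ := exists_polynomial_near_of_continuousOn 0 2 g hg.continuousOn δ hδ
    refine ⟨p, hp, ?_⟩
    filter_upwards [eventually_rpow_mem_Icc ht hanti, self_mem_nhdsWithin] with σ hσ hσ0
    have hσ0' : 0 < σ := hσ0
    have hps := (karamataSum_polynomial ht hsum h p).1 σ hσ0'
    have hb : ∀ n, ‖σ * t n ^ (1 + σ) * g (t n ^ σ) - σ * t n ^ (1 + σ) * p.eval (t n ^ σ)‖ ≤
        δ * (σ * t n ^ (1 + σ)) := fun n => by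
      have h1 : 0 ≤ σ * t n ^ (1 + σ) := mul_nonneg hσ0'.le (Real.rpow_nonneg (ht n).le _)
      rw [← mul_sub, norm_mul, Real.norm_of_nonneg h1, mul_comm δ, Real.norm_eq_abs, abs_sub_comm]
      exact mul_le_mul_of_nonneg_left (hp _ (hσ n)).le h1
    have hds : Summable fun n => δ * (σ * t n ^ (1 + σ)) := ((hsum σ hσ0').mul_left σ).mul_left δ
    have hsub := Summable.of_norm_bounded hds hb
    have hgs : Summable fun n => σ * t n ^ (1 + σ) * g (t n ^ σ) := by
      have := hsub.add hps
      simpa only [sub_add_cancel] using this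
    refine ⟨hgs, ?_⟩
    rw [karamataSum, karamataSum, ← hgs.tsum_sub hps]
    have := tsum_of_norm_bounded hds.hasSum hb
    rw [tsum_mul_left, tsum_mul_left] at this
    exact this
  refine ⟨?_, ?_⟩
  · obtain ⟨p, -, hp⟩ := key 1 one_pos
    exact hp.mono fun _ hσ => hσ.1
  rw [Metric.tendsto_nhds]
  intro ε hε
  -- The total weight `σ ∑ t_n^{1+σ}` is eventually below `ℓ + 1`, so replacing `g` by `p` costs at
  -- most `ε / 3`; the same holds for the integrals.
  have hδ : 0 < ε / (3 * (ℓ + 1)) := by positivity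
  obtain ⟨p, hp, hev⟩ := key _ hδ
  have hpl := (Metric.tendsto_nhds.mp (karamataSum_polynomial ht hsum h p).2) (ε / 3) (by positivity)
  have hint : |(∫ y in (0 : ℝ)..1, p.eval y) - ∫ y in (0 : ℝ)..1, g y| ≤ ε / (3 * (ℓ + 1)) := by
    rw [← intervalIntegral.integral_sub (p.continuous.intervalIntegrable _ _)
      (hg.intervalIntegrable _ _)]
    have := intervalIntegral.norm_integral_le_of_norm_le_const (a := (0 : ℝ)) (b := 1)
      (f := fun y => p.eval y - g y) (C := ε / (3 * (ℓ + 1))) fun y hy => by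
        rw [Set.uIoc_of_le zero_le_one] at hy
        exact (hp y ⟨hy.1.le, hy.2.trans one_le_two⟩).le
    simpa using this
  filter_upwards [hev, hpl, h.eventually_lt_const (lt_add_one ℓ)] with σ h1 h2 h3
  rw [Real.dist_eq] at h2 ⊢
  have h4 : ε / (3 * (ℓ + 1)) * (σ * ∑' n, t n ^ (1 + σ)) ≤ ε / (3 * (ℓ + 1)) * (ℓ + 1) := by
    gcongr
  have h5 : ε / (3 * (ℓ + 1)) * (ℓ + 1) = ε / 3 := by field_simp
  have h6 : |ℓ * (∫ y in (0 : ℝ)..1, p.eval y) - ℓ * ∫ y in (0 : ℝ)..1, g y| ≤ ε / 3 := by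
    rw [← mul_sub, abs_mul, abs_of_nonneg hℓ, ← h5, mul_comm]
    exact mul_le_mul hint (by linarith) hℓ hδ.le
  have h7 := abs_sub_le (karamataSum t g σ) (karamataSum t (fun y => p.eval y) σ)
    (ℓ * ∫ y in (0 : ℝ)..1, g y)
  have h8 := abs_sub_le (karamataSum t (fun y => p.eval y) σ) (ℓ * ∫ y in (0 : ℝ)..1, p.eval y)
    (ℓ * ∫ y in (0 : ℝ)..1, g y)
  linarith [h1.2]

/-- A continuous function interpolating between `0` before `a` and `1 / y` after `b`. -/
def ramp (a b y : ℝ) : ℝ := max 0 (min 1 ((y - a) / (b - a))) / max y (Real.exp (-1))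

theorem continuous_ramp (a b : ℝ) : Continuous (ramp a b) := by
  refine Continuous.div (by fun_prop) (by fun_prop) fun y => ?_
  exact (lt_max_of_lt_right (Real.exp_pos _)).ne'

theorem ramp_nonneg (a b y : ℝ) : 0 ≤ ramp a b y :=
  div_nonneg (le_max_left _ _) (le_max_of_le_right (Real.exp_pos _).le)

theorem ramp_eq_zero {a b y : ℝ} (hab : a < b) (hy : y ≤ a) : ramp a b y = 0 := by
  rw [ramp, max_eq_left, zero_div]
  exact (min_le_right _ _).trans (div_nonpos_of_nonpos_of_nonneg (by linarith) (by linarith))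

theorem ramp_eq_inv {a b y : ℝ} (hab : a < b) (hb : Real.exp (-1) ≤ b) (hy : b ≤ y) :
    ramp a b y = y⁻¹ := by
  have h1 : 1 ≤ (y - a) / (b - a) := by rw [le_div_iff₀ (by linarith)]; linarith
  rw [ramp, min_eq_left h1, max_eq_right zero_le_one, max_eq_left (hb.trans hy), one_div]

theorem ramp_le {a b y : ℝ} : ramp a b y ≤ (max y (Real.exp (-1)))⁻¹ := by
  rw [ramp, div_eq_mul_inv]
  refine mul_le_of_le_one_left (inv_nonneg.mpr (le_max_of_le_right (Real.exp_pos _).le)) ?_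
  exact max_le zero_le_one (min_le_left _ _)

/-- The part beyond `b` gives `-log b`, and on the sloping part the integrand is at most `e`. As `a`
and `b` approach `1 / e`, the integral tends to `1`. -/
theorem integral_ramp {a b : ℝ} (ha : 0 ≤ a) (hab : a < b) (hb : Real.exp (-1) ≤ b) (hb1 : b ≤ 1) :
    -Real.log b ≤ ∫ y in (0 : ℝ)..1, ramp a b y ∧
      ∫ y in (0 : ℝ)..1, ramp a b y ≤ -Real.log b + Real.exp 1 * (b - a) := by
  have hi : ∀ u v, IntervalIntegrable (ramp a b) MeasureTheory.volume u v := fun u v =>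
    (continuous_ramp a b).intervalIntegrable u v
  have h0 : ∫ y in (0 : ℝ)..a, ramp a b y = 0 := by
    refine intervalIntegral.integral_zero_ae (Eventually.of_forall fun y hy => ?_)
    rw [Set.uIoc_of_le ha] at hy
    exact ramp_eq_zero hab hy.2
  have hb0 : 0 < b := (Real.exp_pos _).trans_le hb
  have h1 : ∫ y in b..1, ramp a b y = -Real.log b := by
    rw [intervalIntegral.integral_congr (g := fun y => y⁻¹) fun y hy => ?_,
      integral_inv_of_pos hb0 one_pos, one_div, Real.log_inv]
    rw [Set.uIcc_of_le hb1] at hy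
    exact ramp_eq_inv hab hb hy.1
  have h2 : 0 ≤ ∫ y in a..b, ramp a b y :=
    intervalIntegral.integral_nonneg hab.le fun y _ => ramp_nonneg a b y
  have h3 : ∫ y in a..b, ramp a b y ≤ Real.exp 1 * (b - a) := by
    have := intervalIntegral.norm_integral_le_of_norm_le_const (a := a) (b := b)
      (f := ramp a b) (C := Real.exp 1) fun y _ => by
        rw [Real.norm_of_nonneg (ramp_nonneg a b y)]
        refine ramp_le.trans ?_
        rw [show Real.exp 1 = (Real.exp (-1))⁻¹ by rw [Real.exp_neg, inv_inv]]
        exact inv_anti₀ (Real.exp_pos _) (le_max_right _ _)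
    rw [abs_of_nonneg (by linarith)] at this
    exact (le_abs_self _).trans this
  rw [← intervalIntegral.integral_add_adjacent_intervals (hi 0 a) (hi a 1),
    ← intervalIntegral.integral_add_adjacent_intervals (hi a b) (hi b 1), h0, h1]
  constructor <;> linarith

/-- This is Karamata's choice of test function: `1 / y` for `y ≥ 1 / e` and `0` before. It turns the
weight `t_n^{1+σ}` into `t_n`, has integral `1` over `[0, 1]`, and is squeezed between continuous
ramps. -/
theorem tendsto_sum_large_terms (ht : ∀ n, 0 < t n) (hanti : Antitone t)
    (hsum : ∀ σ > (0 : ℝ), Summable fun n => t n ^ (1 + σ))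
    (h : Tendsto (fun σ : ℝ => σ * ∑' n, t n ^ (1 + σ)) (𝓝[>] 0) (𝓝 ℓ)) :
    Tendsto (fun σ : ℝ => σ * ∑' n, if Real.exp (-1) ≤ t n ^ σ then t n else 0) (𝓝[>] 0) (𝓝 ℓ) := by
  have hℓ := karamata_limit_nonneg ht h
  have he0 := Real.exp_pos (-1)
  have he1 : Real.exp (-1) < 1 := by rw [Real.exp_lt_one_iff]; norm_num
  have hterm : ∀ (σ : ℝ) n, σ * t n ^ (1 + σ) * (t n ^ σ)⁻¹ = σ * t n := fun σ n => by
    rw [Real.rpow_add (ht n), Real.rpow_one]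
    have := (Real.rpow_pos_of_pos (ht n) σ).ne'
    field_simp
  have hw : ∀ σ > (0 : ℝ), ∀ n, 0 ≤ σ * t n ^ (1 + σ) := fun σ hσ n =>
    mul_nonneg (le_of_lt hσ) (Real.rpow_nonneg (ht n).le _)
  have hup : ∀ a, 0 ≤ a → a < Real.exp (-1) → ∀ᶠ σ in 𝓝[>] (0 : ℝ),
      Summable (fun n => σ * if Real.exp (-1) ≤ t n ^ σ then t n else 0) ∧
      σ * (∑' n, if Real.exp (-1) ≤ t n ^ σ then t n else 0) ≤
        karamataSum t (ramp a (Real.exp (-1))) σ := fun a ha hae => by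
    filter_upwards [(karamataSum_continuous ht hanti hsum h (continuous_ramp a (Real.exp (-1)))).1,
      self_mem_nhdsWithin] with σ hs hσ
    have hle : ∀ n, (σ * if Real.exp (-1) ≤ t n ^ σ then t n else 0) ≤
        σ * t n ^ (1 + σ) * ramp a (Real.exp (-1)) (t n ^ σ) := fun n => by
      split_ifs with hc
      · rw [ramp_eq_inv hae le_rfl hc, hterm]
      · rw [mul_zero]
        exact mul_nonneg (hw σ hσ n) (ramp_nonneg _ _ _)
    have hnn : ∀ n, 0 ≤ σ * if Real.exp (-1) ≤ t n ^ σ then t n else 0 := fun n => by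
      split_ifs
      · exact mul_nonneg (le_of_lt hσ) (ht n).le
      · rw [mul_zero]
    have hs' := Summable.of_nonneg_of_le hnn hle hs
    refine ⟨hs', ?_⟩
    rw [← tsum_mul_left]
    exact hs'.tsum_le_tsum hle hs
  have hlow : ∀ b, Real.exp (-1) < b → ∀ᶠ σ in 𝓝[>] (0 : ℝ),
      karamataSum t (ramp (Real.exp (-1)) b) σ ≤
        σ * (∑' n, if Real.exp (-1) ≤ t n ^ σ then t n else 0) := fun b hb => by
    filter_upwards [(karamataSum_continuous ht hanti hsum h (continuous_ramp (Real.exp (-1)) b)).1,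
      hup 0 le_rfl he0, self_mem_nhdsWithin] with σ hs hs' hσ
    rw [← tsum_mul_left]
    refine hs.tsum_le_tsum (fun n => ?_) hs'.1
    split_ifs with hc
    · rw [← hterm]
      refine mul_le_mul_of_nonneg_left (ramp_le.trans_eq ?_) (hw σ hσ n)
      rw [max_eq_left hc]
    · rw [ramp_eq_zero hb (not_le.mp hc).le, mul_zero, mul_zero]
  rw [tendsto_order]
  constructor
  · intro c hc
    have hlim : Tendsto (fun b => ℓ * -Real.log b) (𝓝[>] (Real.exp (-1))) (𝓝 ℓ) := by
      have := ((Real.continuousAt_log he0.ne').neg.const_mul ℓ).tendsto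
      rw [Pi.neg_apply, Real.log_exp, neg_neg, mul_one] at this
      exact this.mono_left nhdsWithin_le_nhds
    obtain ⟨b, hb1, hb2, hb3⟩ := ((hlim.eventually_const_lt hc).and
      ((eventually_nhdsWithin_of_eventually_nhds (eventually_le_nhds he1)).and
        self_mem_nhdsWithin)).exists
    have hb4 : Real.exp (-1) < b := hb3
    have h1 := (integral_ramp he0.le hb4 hb4.le hb2).1
    have h2 := (karamataSum_continuous ht hanti hsum h (continuous_ramp (Real.exp (-1)) b)).2
    have h3 : c < ℓ * ∫ y in (0 : ℝ)..1, ramp (Real.exp (-1)) b y :=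
      hb1.trans_le (mul_le_mul_of_nonneg_left h1 hℓ)
    filter_upwards [h2.eventually_const_lt h3, hlow b hb4] with σ h4 h5
    exact h4.trans_le h5
  · intro c hc
    have hlim : Tendsto (fun a => ℓ * (1 + Real.exp 1 * (Real.exp (-1) - a)))
        (𝓝[<] (Real.exp (-1))) (𝓝 ℓ) := by
      have : Tendsto (fun a => ℓ * (1 + Real.exp 1 * (Real.exp (-1) - a))) (𝓝 (Real.exp (-1)))
          (𝓝 (ℓ * (1 + Real.exp 1 * (Real.exp (-1) - Real.exp (-1))))) :=
        Continuous.tendsto (by fun_prop) _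
      rw [sub_self, mul_zero, add_zero, mul_one] at this
      exact this.mono_left nhdsWithin_le_nhds
    obtain ⟨a, ha1, ha2, ha3⟩ := ((hlim.eventually_lt_const hc).and
      ((eventually_nhdsWithin_of_eventually_nhds (eventually_ge_nhds he0)).and
        self_mem_nhdsWithin)).exists
    have ha4 : a < Real.exp (-1) := ha3
    have h1 := (integral_ramp ha2 ha4 le_rfl he1.le).2
    rw [Real.log_exp, neg_neg] at h1
    have h2 := (karamataSum_continuous ht hanti hsum h (continuous_ramp a (Real.exp (-1)))).2
    have h3 : ℓ * ∫ y in (0 : ℝ)..1, ramp a (Real.exp (-1)) y < c :=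
      (mul_le_mul_of_nonneg_left h1 hℓ).trans_lt ha1
    filter_upwards [h2.eventually_lt_const h3, hup a ha2 ha4] with σ h4 h5
    exact h5.2.trans_lt h4

/-- A Hardy–Littlewood type Tauberian theorem for the partial sums of a decreasing sequence. -/
theorem tendsto_sum_div_log (ht : ∀ n, 0 < t n) (hanti : Antitone t)
    (hsum : ∀ σ > (0 : ℝ), Summable fun n => t n ^ (1 + σ))
    (h : Tendsto (fun σ : ℝ => σ * ∑' n, t n ^ (1 + σ)) (𝓝[>] 0) (𝓝 ℓ)) :
    Tendsto (fun N : ℕ => (∑ n ∈ Finset.range N, t n) / Real.log N) atTop (𝓝 ℓ) := by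
  -- The sum of the terms that are at least `exp (-X)`; with `σ = 1 / X` the previous limit reads `F
  -- X / X → ℓ`.
  set F : ℝ → ℝ := fun X => ∑' n, if Real.exp (-X) ≤ t n then t n else 0 with hF
  have ht0 : Tendsto t atTop (𝓝 0) := by
    have h1 := (hsum 1 one_pos).tendsto_atTop_zero
    have h2 := h1.rpow_const (p := 1 / 2) (Or.inr (by norm_num))
    rw [Real.zero_rpow (by norm_num)] at h2
    refine h2.congr fun n => ?_
    rw [← Real.rpow_mul (ht n).le]
    norm_num
  have hFs : ∀ X, Summable fun n => if Real.exp (-X) ≤ t n then t n else 0 := fun X => by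
    obtain ⟨N, hN⟩ := (ht0.eventually_lt_const (Real.exp_pos (-X))).exists_forall_of_atTop
    refine summable_of_ne_finset_zero (s := Finset.range N) fun n hn => if_neg ?_
    exact not_le.mpr (hN n (by simpa using hn))
  have hFnn : ∀ X n, 0 ≤ if Real.exp (-X) ≤ t n then t n else 0 := fun X n => by
    split_ifs
    · exact (ht n).le
    · exact le_rfl
  have hFX : Tendsto (fun X => F X / X) atTop (𝓝 ℓ) := by
    have h1 := (tendsto_sum_large_terms ht hanti hsum h).comp tendsto_inv_atTop_nhdsGT_zero
    refine h1.congr' ?_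
    filter_upwards [eventually_gt_atTop 0] with X hX
    have hiff : ∀ n, Real.exp (-1) ≤ t n ^ X⁻¹ ↔ Real.exp (-X) ≤ t n := fun n => by
      rw [Real.le_rpow_inv_iff_of_pos (Real.exp_pos _).le (ht n).le hX, ← Real.exp_mul]
      simp
    simp only [Function.comp, hiff, hF]
    rw [div_eq_inv_mul]
  have hlog : Tendsto (fun N : ℕ => Real.log N) atTop atTop :=
    Real.tendsto_log_atTop.comp tendsto_natCast_atTop_atTop
  -- Among the first `N` terms, those below `1 / N` add up to at most `1`.
  have hupper : Tendsto (fun N : ℕ => F (Real.log N) / Real.log N + 1 / Real.log N) atTop (𝓝 ℓ) := by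
    have := (hFX.comp hlog).add (hlog.const_div_atTop 1)
    rwa [add_zero] at this
  -- For the lower bound the threshold is raised to `exp (-(L - √L))` with `L = log N`, which does
  -- not affect the asymptotics.
  have hsqrt : Tendsto (fun L : ℝ => L - √L) atTop atTop := by
    have h1 : Tendsto (fun L : ℝ => √L * (√L - 1)) atTop atTop :=
      Real.tendsto_sqrt_atTop.atTop_mul_atTop₀
        (tendsto_atTop_add_const_right _ _ Real.tendsto_sqrt_atTop)
    refine h1.congr' ?_
    filter_upwards [eventually_ge_atTop 0] with L hL
    rw [mul_sub, Real.mul_self_sqrt hL, mul_one]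
  have hratio : Tendsto (fun L : ℝ => (L - √L) / L) atTop (𝓝 1) := by
    have h1 : Tendsto (fun L : ℝ => 1 - (√L)⁻¹) atTop (𝓝 (1 - 0)) :=
      (tendsto_inv_atTop_zero.comp Real.tendsto_sqrt_atTop).const_sub 1
    rw [sub_zero] at h1
    refine h1.congr' ?_
    filter_upwards [eventually_gt_atTop 0] with L hL
    rw [sub_div, div_self hL.ne', Real.sqrt_div_self]
  have hlower : Tendsto (fun L : ℝ => F (L - √L) / L) atTop (𝓝 ℓ) := by
    have h1 := (hFX.comp hsqrt).mul hratio
    rw [mul_one] at h1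
    refine h1.congr' ?_
    filter_upwards [hsqrt.eventually_gt_atTop 0] with L hL
    simp only [Function.comp]
    field_simp
  have hbig : Tendsto (fun L : ℝ => Real.exp √L / L) atTop atTop := by
    refine ((Real.tendsto_exp_div_pow_atTop 2).comp Real.tendsto_sqrt_atTop).congr' ?_
    filter_upwards [eventually_ge_atTop 0] with L hL
    simp only [Function.comp, Real.sq_sqrt hL]
  refine tendsto_of_tendsto_of_tendsto_of_le_of_le' (hlower.comp hlog) hupper ?_ ?_
  · filter_upwards [hlog.eventually (hlower.eventually_lt_const (lt_add_one ℓ)),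
      hlog.eventually (hbig.eventually_ge_atTop (ℓ + 1)), hlog.eventually_gt_atTop 0,
      eventually_ge_atTop 1] with N h1 h2 h3 h4
    have hN : (0 : ℝ) < N := by exact_mod_cast h4
    simp only [Function.comp]
    -- If `t N` reaches the threshold, the first `N` terms already sum to at least `exp √L`, far
    -- more than needed. Otherwise all terms counted by `F` are among the first `N`.
    by_cases hc : Real.exp (-(Real.log N - √(Real.log N))) ≤ t N
    · refine h1.le.trans (h2.trans (div_le_div_of_nonneg_right ?_ h3.le))
      calc Real.exp √(Real.log N) = ∑ n ∈ Finset.range N, Real.exp (-(Real.log N - √(Real.log N))) := by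
            rw [Finset.sum_const, Finset.card_range, nsmul_eq_mul, neg_sub, Real.exp_sub,
              Real.exp_log hN]
            field_simp
        _ ≤ _ := Finset.sum_le_sum fun n hn => hc.trans (hanti (Finset.mem_range.mp hn).le)
    · refine div_le_div_of_nonneg_right ?_ h3.le
      rw [hF]
      simp only
      rw [tsum_eq_sum (s := Finset.range N) fun n hn => if_neg fun hn' =>
        hc (hn'.trans (hanti (by simpa using hn)))]
      refine Finset.sum_le_sum fun n _ => ?_
      split_ifs
      · exact le_rfl
      · exact (ht n).le
  · filter_upwards [hlog.eventually_gt_atTop 0, eventually_ge_atTop 1] with N h3 h4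
    have hN : (0 : ℝ) < N := by exact_mod_cast h4
    rw [← add_div]
    refine div_le_div_of_nonneg_right ?_ h3.le
    have h5 := (hFs (Real.log N)).sum_le_tsum (Finset.range N) fun n _ => hFnn _ n
    have h6 : ∑ n ∈ Finset.range N, t n ≤ ∑ n ∈ Finset.range N,
        ((if Real.exp (-Real.log N) ≤ t n then t n else 0) + (N : ℝ)⁻¹) := by
      refine Finset.sum_le_sum fun n _ => ?_
      split_ifs with hc
      · exact le_add_of_nonneg_right (inv_nonneg.mpr hN.le)
      · rw [zero_add]
        rw [Real.exp_neg, Real.exp_log hN] at hc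
        exact (not_le.mp hc).le
    rw [Finset.sum_add_distrib, Finset.sum_const, Finset.card_range, nsmul_eq_mul,
      mul_inv_cancel₀ hN.ne'] at h6
    linarith

end Karamata

/-! ### Decay of decreasing sequences -/

section Decay

variable {a : ℕ → ℝ}

theorem succ_mul_le_sum_range (ha : Antitone a) (n : ℕ) :
    ((n : ℝ) + 1) * a n ≤ ∑ k ∈ Finset.range (n + 1), a k := by
  calc ((n : ℝ) + 1) * a n = ∑ k ∈ Finset.range (n + 1), a n := by simp
    _ ≤ _ := Finset.sum_le_sum fun k hk => ha (Nat.le_of_lt_succ (Finset.mem_range.mp hk))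

theorem summable_rpow_of_sum_isBigO_log (ha0 : ∀ n, 0 ≤ a n) (ha : Antitone a)
    (h : (fun n => ∑ k ∈ Finset.range n, a k) =O[atTop] fun n : ℕ => Real.log n) {r : ℝ}
    (hr : 1 < r) : Summable fun n => a n ^ r := by
  -- Monotonicity gives `a n = O(n^{δ-1})`, and this `δ` makes `r (1 - δ) = (r + 1) / 2 > 1`.
  set δ : ℝ := (1 - 1 / r) / 2 with hδ
  have hr0 : 0 < r := by linarith
  have hδ0 : 0 < δ := by
    have : 1 / r < 1 := (div_lt_one hr0).mpr hr
    linarith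
  have hlog : (fun n : ℕ => Real.log n) =O[atTop] fun n : ℕ => (n : ℝ) ^ δ :=
    (isLittleO_log_rpow_atTop hδ0).isBigO.comp_tendsto tendsto_natCast_atTop_atTop
  have h1 : (fun n : ℕ => ((n : ℝ) + 1) * a n) =O[atTop] fun n : ℕ => ((n : ℝ) + 1) ^ δ := by
    have h2 := (h.trans hlog).comp_tendsto (tendsto_add_atTop_nat 1)
    refine IsBigO.trans (IsBigO.of_bound 1 (Eventually.of_forall fun n => ?_))
      (h2.congr_right fun n => by simp)
    rw [one_mul, Function.comp_apply, Real.norm_of_nonneg (mul_nonneg (by positivity) (ha0 n)),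
      Real.norm_of_nonneg (Finset.sum_nonneg fun k _ => ha0 k)]
    exact succ_mul_le_sum_range ha n
  have h3 : a =O[atTop] fun n : ℕ => ((n : ℝ) + 1) ^ (δ - 1) := by
    have h4 := (isBigO_refl (fun n : ℕ => ((n : ℝ) + 1)⁻¹) atTop).mul h1
    refine (h4.congr_left fun n => ?_).congr_right fun n => ?_
    · rw [inv_mul_cancel_left₀ (by positivity)]
    · rw [Real.rpow_sub_one (by positivity), div_eq_inv_mul]
  have h5 : (fun n => a n ^ r) =O[atTop] fun n : ℕ => ((n : ℝ) + 1) ^ (-((r + 1) / 2)) := by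
    refine (h3.rpow hr0.le (Eventually.of_forall fun n => ?_)).congr_right fun n => ?_
    · exact Real.rpow_nonneg (by positivity) _
    · rw [← Real.rpow_mul (by positivity)]
      congr 1
      rw [hδ]
      field_simp
      ring
  refine summable_of_isBigO_nat ?_ h5
  have h6 : Summable fun n : ℕ => (n : ℝ) ^ (-((r + 1) / 2)) :=
    Real.summable_nat_rpow.mpr (by linarith)
  have h7 := (summable_nat_add_iff 1).mpr h6
  simpa using h7

theorem sum_range_isLittleO_log_of_summable (h : Summable a) :
    (fun n => ∑ k ∈ Finset.range n, a k) =o[atTop] fun n : ℕ => Real.log n := by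
  have h1 : (fun n => ∑ k ∈ Finset.range n, a k) =O[atTop] fun _ : ℕ => (1 : ℝ) :=
    h.hasSum.tendsto_sum_nat.isBigO_one ℝ
  refine h1.trans_isLittleO ((isLittleO_const_left.mpr (Or.inr ?_)))
  exact tendsto_norm_atTop_atTop.comp (Real.tendsto_log_atTop.comp tendsto_natCast_atTop_atTop)

/-- The power mean inequality with exponent `1 / γ`, applied to `f ^ γ`. -/
theorem sum_rpow_le_card_rpow_mul {f : ℕ → ℝ} (hf : ∀ n, 0 ≤ f n) (s : Finset ℕ) {γ : ℝ}
    (h0 : 0 < γ) (h1 : γ ≤ 1) :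
    ∑ k ∈ s, f k ^ γ ≤ (s.card : ℝ) ^ (1 - γ) * (∑ k ∈ s, f k) ^ γ := by
  have h := Real.rpow_sum_le_const_mul_sum_rpow s (fun k => f k ^ γ) (p := 1 / γ)
    ((one_le_div h0).mpr h1)
  have h2 : ∀ k, |f k ^ γ| = f k ^ γ := fun k => abs_of_nonneg (Real.rpow_nonneg (hf k) _)
  have h3 : ∀ k, (f k ^ γ) ^ (1 / γ) = f k := fun k => by
    rw [← Real.rpow_mul (hf k), mul_one_div_cancel h0.ne', Real.rpow_one]
  simp only [h2, h3] at h
  have hs : 0 ≤ ∑ k ∈ s, f k ^ γ := Finset.sum_nonneg fun k _ => Real.rpow_nonneg (hf k) _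
  have h4 := Real.rpow_le_rpow (Real.rpow_nonneg hs _) h h0.le
  rw [← Real.rpow_mul hs, one_div_mul_cancel h0.ne', Real.rpow_one,
    Real.mul_rpow (Real.rpow_nonneg (Nat.cast_nonneg _) _) (Finset.sum_nonneg fun k _ => hf k),
    ← Real.rpow_mul (Nat.cast_nonneg _), sub_mul, one_div_mul_cancel h0.ne', one_mul] at h4
  exact h4

end Decay

/-! ### Existence of eccentric subsequences -/

section Eccentric

variable {T : H →L[ℂ] H}

theorem integralSeq_le_of_isTraceClass (h : IsTraceClass T) {a b : ℕ} (hab : a ≤ b) :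
    integralSeq T a = integralSeq T b + ∑ k ∈ Finset.Ico a b, mu T k := by
  have h1 := partialSum_add_tail h.2 a
  have h2 := partialSum_add_tail h.2 b
  have h3 := partialSum_sub (B := T) hab
  rw [integralSeq, integralSeq, if_pos h, if_pos h]
  linarith

theorem integralSeq_le_of_not_isTraceClass (h : ¬ IsTraceClass T) {a b : ℕ} (hab : a ≤ b) :
    integralSeq T b = integralSeq T a + ∑ k ∈ Finset.Ico a b, mu T k := by
  have h3 := partialSum_sub (B := T) hab
  rw [integralSeq, integralSeq, if_neg h, if_neg h]
  linarith

theorem sum_Ico_mu_nonneg (T : H →L[ℂ] H) (a b : ℕ) : 0 ≤ ∑ k ∈ Finset.Ico a b, mu T k :=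
  Finset.sum_nonneg fun k _ => mu_nonneg T k

/-- Otherwise `S(q^j)` grows at least like `(1 + ε)^j`. But `S(q^j)^γ ≤ q^{j(γ-1)} ∑ μ_n^γ` by
Hölder, which is impossible once `q^{γ-1} < 1 + ε`, that is for `γ > 1` near `1`. -/
theorem exists_sum_Ico_le_of_not_isTraceClass (hpos : ∀ n, 0 < mu T n)
    (h1 : ∀ γ > (1 : ℝ), Summable fun n => mu T n ^ γ) (hT : ¬ IsTraceClass T) {q : ℕ}
    (hq : 2 ≤ q) {ε : ℝ} (hε : 0 < ε) :
    ∃ p, 1 ≤ p ∧ ∑ k ∈ Finset.Ico p (q * p), mu T k ≤ ε * integralSeq T p := by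
  by_contra! hcon
  have hq0 : (0 : ℝ) < q := by exact_mod_cast (by omega : 0 < q)
  have hgrow : ∀ j : ℕ, (1 + ε) ^ j * integralSeq T 1 ≤ integralSeq T (q ^ j) := by
    intro j
    induction j with
    | zero => simp
    | succ j ih =>
      have h2 := hcon (q ^ j) (Nat.one_le_pow _ _ (by omega))
      have h3 := integralSeq_le_of_not_isTraceClass hT
        (show q ^ j ≤ q * q ^ j from Nat.le_mul_of_pos_left _ (by omega))
      rw [pow_succ' q, h3, pow_succ]
      nlinarith
  have hlim : Tendsto (fun γ : ℝ => (q : ℝ) ^ (γ - 1)) (𝓝[>] 1) (𝓝 1) := by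
    have : Tendsto (fun γ : ℝ => (q : ℝ) ^ (γ - 1)) (𝓝 1) (𝓝 ((q : ℝ) ^ ((1 : ℝ) - 1))) :=
      ((Real.continuous_const_rpow hq0.ne').comp (continuous_sub_right 1)).tendsto 1
    rw [sub_self, Real.rpow_zero] at this
    exact this.mono_left nhdsWithin_le_nhds
  obtain ⟨γ, hγ, hγ1⟩ := ((hlim.eventually_lt_const (show (1 : ℝ) < 1 + ε by linarith)).and
    self_mem_nhdsWithin).exists
  have hγ1' : 1 < γ := hγ1
  have hS1 : 0 < integralSeq T 1 := integralSeq_pos hpos le_rfl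
  have hqγ : 0 < (q : ℝ) ^ (γ - 1) := Real.rpow_pos_of_pos hq0 _
  have hbound : ∀ j : ℕ, ((1 + ε) / (q : ℝ) ^ (γ - 1)) ^ j * integralSeq T 1 ^ γ ≤
      ∑' n, mu T n ^ γ := by
    intro j
    have h2 := Real.rpow_sum_le_const_mul_sum_rpow (Finset.range (q ^ j)) (mu T) hγ1'.le
    simp only [abs_of_nonneg (mu_nonneg T _), Finset.card_range] at h2
    have h3 : integralSeq T (q ^ j) = ∑ k ∈ Finset.range (q ^ j), mu T k := by
      rw [integralSeq, if_neg hT, partialSum]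
    rw [← h3] at h2
    have h4 : (1 + ε) ^ j * integralSeq T 1 ^ γ ≤ integralSeq T (q ^ j) ^ γ := by
      refine le_trans ?_ (Real.rpow_le_rpow (by positivity) (hgrow j) (by linarith))
      rw [Real.mul_rpow (by positivity) hS1.le]
      gcongr
      exact Real.self_le_rpow_of_one_le (one_le_pow₀ (by linarith)) hγ1'.le
    have h5 : ∑ k ∈ Finset.range (q ^ j), mu T k ^ γ ≤ ∑' n, mu T n ^ γ :=
      (h1 γ hγ1').sum_le_tsum _ fun k _ => Real.rpow_nonneg (mu_nonneg T k) _
    have h6 : (((q ^ j : ℕ) : ℝ)) ^ (γ - 1) = ((q : ℝ) ^ (γ - 1)) ^ j := by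
      rw [Nat.cast_pow, ← Real.rpow_natCast, ← Real.rpow_natCast, ← Real.rpow_mul hq0.le,
        ← Real.rpow_mul hq0.le, mul_comm]
    rw [h6] at h2
    rw [div_pow, div_mul_eq_mul_div, div_le_iff₀ (by positivity), mul_comm (∑' n, mu T n ^ γ)]
    exact (h4.trans h2).trans (by gcongr)
  have hinf : Tendsto (fun j : ℕ => ((1 + ε) / (q : ℝ) ^ (γ - 1)) ^ j * integralSeq T 1 ^ γ)
      atTop atTop :=
    (tendsto_pow_atTop_atTop_of_one_lt ((one_lt_div hqγ).mpr hγ)).atTop_mul_const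
      (Real.rpow_pos_of_pos hS1 _)
  obtain ⟨j, hj⟩ := (hinf.eventually_gt_atTop (∑' n, mu T n ^ γ)).exists
  exact absurd (hbound j) (not_le.mpr hj)

/-- The dual argument: otherwise the tails at `q^j` decay at least like `(1 + ε)^{-j}`. By Hölder
the block sums of `μ_n^γ` are then at most `K ρ^j`, where `ρ = q^{1-γ} (1 + ε)^{-γ}` is below `1`
for `γ < 1` near `1`, so `μ_n^γ` would be summable. -/
theorem exists_sum_Ico_le_of_isTraceClass (h1 : ∀ γ : ℝ, 0 < γ → γ < 1 →
    ¬ Summable fun n => mu T n ^ γ) (hT : IsTraceClass T) {q : ℕ}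
    (hq : 2 ≤ q) {ε : ℝ} (hε : 0 < ε) :
    ∃ p, 1 ≤ p ∧ ∑ k ∈ Finset.Ico p (q * p), mu T k ≤ ε * integralSeq T (q * p) := by
  by_contra! hcon
  have hq0 : (0 : ℝ) < q := by exact_mod_cast (by omega : 0 < q)
  have hSnn : ∀ n, 0 ≤ integralSeq T n := relativeSeq_nonneg T T
  have hdecay : ∀ j : ℕ, integralSeq T (q ^ j) ≤ ((1 + ε)⁻¹) ^ j * integralSeq T 1 := by
    intro j
    induction j with
    | zero => simp
    | succ j ih =>
      have h2 := hcon (q ^ j) (Nat.one_le_pow _ _ (by omega))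
      have h3 := integralSeq_le_of_isTraceClass hT
        (show q ^ j ≤ q * q ^ j from Nat.le_mul_of_pos_left _ (by omega))
      rw [pow_succ' q, pow_succ', mul_assoc, inv_mul_eq_div, le_div_iff₀ (by linarith)]
      linarith
  have hlim : Tendsto (fun γ : ℝ => (q : ℝ) ^ (1 - γ) * ((1 + ε)⁻¹) ^ γ) (𝓝[<] 1)
      (𝓝 (1 + ε)⁻¹) := by
    have h2 : Continuous fun γ : ℝ => (q : ℝ) ^ (1 - γ) * ((1 + ε)⁻¹) ^ γ :=
      ((Real.continuous_const_rpow hq0.ne').comp (continuous_sub_left 1)).mul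
        (Real.continuous_const_rpow (by positivity))
    have h3 := h2.tendsto 1
    rw [sub_self, Real.rpow_zero, one_mul, Real.rpow_one] at h3
    exact h3.mono_left nhdsWithin_le_nhds
  obtain ⟨γ, hγ, hγ0, hγ1⟩ := ((hlim.eventually_lt_const
    (show (1 + ε)⁻¹ < 1 from inv_lt_one_of_one_lt₀ (by linarith))).and
    ((eventually_nhdsWithin_of_eventually_nhds (eventually_gt_nhds one_pos)).and
      self_mem_nhdsWithin)).exists
  have hγ1' : γ < 1 := hγ1
  set ρ : ℝ := (q : ℝ) ^ (1 - γ) * ((1 + ε)⁻¹) ^ γ with hρ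
  have hρ0 : 0 ≤ ρ := by positivity
  set K : ℝ := (q : ℝ) ^ (1 - γ) * integralSeq T 1 ^ γ with hK
  have hK0 : 0 ≤ K := mul_nonneg (by positivity) (Real.rpow_nonneg (hSnn 1) _)
  have hblock : ∀ j : ℕ, ∑ k ∈ Finset.Ico (q ^ j) (q ^ (j + 1)), mu T k ^ γ ≤ K * ρ ^ j := by
    intro j
    refine (sum_rpow_le_card_rpow_mul (mu_nonneg T) _ hγ0 hγ1'.le).trans ?_
    have h2 : ∑ k ∈ Finset.Ico (q ^ j) (q ^ (j + 1)), mu T k ≤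
        ((1 + ε)⁻¹) ^ j * integralSeq T 1 := by
      have h3 := integralSeq_le_of_isTraceClass hT
        (Nat.pow_le_pow_right (by omega : 0 < q) (Nat.le_succ j))
      linarith [hdecay j, hSnn (q ^ (j + 1))]
    have h4 : ((Finset.Ico (q ^ j) (q ^ (j + 1))).card : ℝ) ≤ (q : ℝ) ^ (j + 1) := by
      rw [Nat.card_Ico]
      exact_mod_cast Nat.sub_le _ _
    calc _ ≤ ((q : ℝ) ^ (j + 1)) ^ (1 - γ) * (((1 + ε)⁻¹) ^ j * integralSeq T 1) ^ γ := by
          gcongr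
          · exact Real.rpow_nonneg (Finset.sum_nonneg fun k _ => mu_nonneg T k) _
          · exact Finset.sum_nonneg fun k _ => mu_nonneg T k
      _ = K * ρ ^ j := by
          rw [Real.mul_rpow (by positivity) (hSnn 1), hK, hρ, mul_pow,
            ← Real.rpow_natCast ((1 + ε)⁻¹), ← Real.rpow_natCast (((1 + ε)⁻¹) ^ γ),
            ← Real.rpow_mul (by positivity), ← Real.rpow_mul (by positivity), mul_comm γ (j : ℝ),
            pow_succ, Real.mul_rpow (by positivity) hq0.le, ← Real.rpow_natCast (q : ℝ),
            ← Real.rpow_natCast ((q : ℝ) ^ (1 - γ)), ← Real.rpow_mul hq0.le,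
            ← Real.rpow_mul hq0.le, mul_comm (1 - γ) (j : ℝ)]
          ring
  have hsum : ∀ j : ℕ, ∑ k ∈ Finset.range (q ^ j), mu T k ^ γ ≤
      mu T 0 ^ γ + ∑ i ∈ Finset.range j, K * ρ ^ i := by
    intro j
    induction j with
    | zero => simp
    | succ j ih =>
      rw [← Finset.sum_range_add_sum_Ico _ (Nat.pow_le_pow_right (by omega : 0 < q)
        (Nat.le_succ j)), Finset.sum_range_succ]
      linarith [hblock j]
  have hgeo : Summable fun i : ℕ => K * ρ ^ i :=
    (summable_geometric_of_lt_one hρ0 hγ).mul_left K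
  refine h1 γ hγ0 hγ1' (summable_of_sum_range_le
    (c := mu T 0 ^ γ + ∑' i : ℕ, K * ρ ^ i) (fun n => Real.rpow_nonneg (mu_nonneg T n) _)
    fun n => ?_)
  calc ∑ k ∈ Finset.range n, mu T k ^ γ ≤ ∑ k ∈ Finset.range (q ^ n), mu T k ^ γ :=
        Finset.sum_le_sum_of_subset_of_nonneg
          (Finset.range_mono (Nat.lt_pow_self (by omega)).le)
          fun k _ _ => Real.rpow_nonneg (mu_nonneg T k) _
    _ ≤ _ := hsum n
    _ ≤ _ := by
        gcongr
        exact hgeo.sum_le_tsum _ fun i _ => by positivity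

/-- An operator of order one is eccentric along some sequence. -/
theorem exists_isEccentricAlong (hpos : ∀ n, 0 < mu T n)
    (h1 : ∀ γ > (1 : ℝ), Summable fun n => mu T n ^ γ)
    (h2 : ∀ γ : ℝ, 0 < γ → γ < 1 → ¬ Summable fun n => mu T n ^ γ) :
    ∃ ν : ℕ → ℕ, IsEccentricAlong T ν := by
  -- In both cases `S` is evaluated at one end of the block; monotonicity moves it to the geometric
  -- centre `(k + 2) * p`.
  have key : ∀ k : ℕ, ∃ p, 1 ≤ p ∧ ∑ j ∈ Finset.Ico p ((k + 2) ^ 2 * p), mu T j ≤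
      1 / ((k : ℝ) + 1) * integralSeq T ((k + 2) * p) := by
    intro k
    have hk2 : k + 2 ≤ (k + 2) ^ 2 := Nat.le_self_pow two_ne_zero _
    have hq : 2 ≤ (k + 2) ^ 2 := by omega
    have hε : 0 < 1 / ((k : ℝ) + 1) := by positivity
    by_cases hT : IsTraceClass T
    · obtain ⟨p, hp, h⟩ := exists_sum_Ico_le_of_isTraceClass h2 hT hq hε
      refine ⟨p, hp, h.trans (mul_le_mul_of_nonneg_left ?_ hε.le)⟩
      have h3 := integralSeq_le_of_isTraceClass hT
        (show (k + 2) * p ≤ (k + 2) ^ 2 * p from Nat.mul_le_mul_right _ hk2)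
      rw [h3]
      exact le_add_of_nonneg_right (sum_Ico_mu_nonneg T _ _)
    · obtain ⟨p, hp, h⟩ := exists_sum_Ico_le_of_not_isTraceClass hpos h1 hT hq hε
      refine ⟨p, hp, h.trans (mul_le_mul_of_nonneg_left ?_ hε.le)⟩
      have h3 := integralSeq_le_of_not_isTraceClass hT
        (show p ≤ (k + 2) * p from Nat.le_mul_of_pos_left _ (by omega))
      rw [h3]
      exact le_add_of_nonneg_right (sum_Ico_mu_nonneg T _ _)
  choose p hp h using key
  -- As soon as `k ≥ m`, dividing or multiplying the centre by `m` stays within the block.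
  refine ⟨fun k => (k + 2) * p k, tendsto_atTop_mono (fun k => ?_) tendsto_id, fun m hm => ?_⟩
  · have := hp k
    have h3 : (k + 2) * 1 ≤ (k + 2) * p k := Nat.mul_le_mul_left _ this
    simp only [id]
    omega
  · refine squeeze_zero' (Eventually.of_forall fun k =>
      div_nonneg (sum_Ico_mu_nonneg T _ _) (relativeSeq_nonneg T T _)) ?_
      tendsto_one_div_add_atTop_nhds_zero_nat
    filter_upwards [eventually_ge_atTop m] with k hk
    have hS : 0 < integralSeq T ((k + 2) * p k) :=
      integralSeq_pos hpos (Nat.one_le_iff_ne_zero.mpr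
        (Nat.mul_ne_zero (by omega) (by have := hp k; omega)))
    rw [div_le_iff₀ hS]
    refine le_trans (Finset.sum_le_sum_of_subset_of_nonneg (Finset.Ico_subset_Ico ?_ ?_)
      fun j _ _ => mu_nonneg T j) (h k)
    · rw [Nat.le_div_iff_mul_le hm, mul_comm]
      exact Nat.mul_le_mul_right _ (by omega)
    · rw [← mul_assoc, pow_two]
      exact Nat.mul_le_mul_right _ (Nat.mul_le_mul_right _ (by omega))

end Eccentric

/-! ### Averages over dilations -/

/-- A number of dilations growing to infinity, but slowly in comparison with `log n`. -/
def dilationCount (n : ℕ) : ℕ := ⌊√(Real.log n)⌋₊ + 1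

theorem tendsto_log_natCast : Tendsto (fun n : ℕ => Real.log n) atTop atTop :=
  Real.tendsto_log_atTop.comp tendsto_natCast_atTop_atTop

theorem dilationCount_pos (n : ℕ) : (0 : ℝ) < dilationCount n := by
  unfold dilationCount
  positivity

theorem tendsto_dilationCount : Tendsto (fun n => (dilationCount n : ℝ)) atTop atTop := by
  have h1 : Tendsto (fun n : ℕ => √(Real.log n)) atTop atTop :=
    Real.tendsto_sqrt_atTop.comp tendsto_log_natCast
  refine tendsto_atTop_mono (fun n => ?_) h1
  simpa [dilationCount] using (Nat.lt_floor_add_one √(Real.log n)).le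

theorem tendsto_dilationCount_div_log :
    Tendsto (fun n : ℕ => (dilationCount n : ℝ) / Real.log n) atTop (𝓝 0) := by
  have h1 : Tendsto (fun n : ℕ => (√(Real.log n))⁻¹ + (Real.log n)⁻¹) atTop (𝓝 (0 + 0)) :=
    (tendsto_inv_atTop_zero.comp (Real.tendsto_sqrt_atTop.comp tendsto_log_natCast)).add
      (tendsto_inv_atTop_zero.comp tendsto_log_natCast)
  rw [add_zero] at h1
  refine squeeze_zero' ?_ ?_ h1
  · filter_upwards [tendsto_log_natCast.eventually_gt_atTop 0] with n hn
    exact div_nonneg (Nat.cast_nonneg _) hn.le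
  · filter_upwards [tendsto_log_natCast.eventually_gt_atTop 0] with n hn
    rw [← Real.sqrt_div_self, ← one_div (Real.log n), ← add_div]
    gcongr
    rw [dilationCount, Nat.cast_add, Nat.cast_one]
    gcongr
    exact Nat.floor_le (Real.sqrt_nonneg _)

/-- The mean of a sequence over the dilates `n, 2n, 4n, …`. -/
def dilationMean (x : ℕ → ℝ) (n : ℕ) : ℝ :=
  (∑ j ∈ Finset.range (dilationCount n), x (2 ^ j * n)) / dilationCount n

theorem abs_dilationMean_sub_le {x : ℕ → ℝ} {n : ℕ} {c ε : ℝ}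
    (h : ∀ j < dilationCount n, |x (2 ^ j * n) - c| ≤ ε) : |dilationMean x n - c| ≤ ε := by
  have h1 : dilationMean x n - c =
      (∑ j ∈ Finset.range (dilationCount n), (x (2 ^ j * n) - c)) / dilationCount n := by
    rw [Finset.sum_sub_distrib, Finset.sum_const, Finset.card_range, nsmul_eq_mul, sub_div,
      mul_div_cancel_left₀ _ (dilationCount_pos n).ne', dilationMean]
  rw [h1, abs_div, abs_of_pos (dilationCount_pos n), div_le_iff₀ (dilationCount_pos n)]
  refine (Finset.abs_sum_le_sum_abs _ _).trans ?_
  calc _ ≤ ∑ j ∈ Finset.range (dilationCount n), ε :=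
        Finset.sum_le_sum fun j hj => h j (Finset.mem_range.mp hj)
    _ = _ := by rw [Finset.sum_const, Finset.card_range, nsmul_eq_mul, mul_comm]

theorem dilationMean_add (x y : ℕ → ℝ) (n : ℕ) :
    dilationMean (fun k => x k + y k) n = dilationMean x n + dilationMean y n := by
  rw [dilationMean, Finset.sum_add_distrib, add_div, dilationMean, dilationMean]

theorem dilationMean_const_mul (c : ℝ) (x : ℕ → ℝ) (n : ℕ) :
    dilationMean (fun k => c * x k) n = c * dilationMean x n := by
  rw [dilationMean, ← Finset.mul_sum, mul_div_assoc, dilationMean]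

theorem dilationMean_nonneg {x : ℕ → ℝ} (h : ∀ n, 0 ≤ x n) (n : ℕ) : 0 ≤ dilationMean x n :=
  div_nonneg (Finset.sum_nonneg fun _ _ => h _) (dilationCount_pos n).le

theorem tendsto_dilationMean {x : ℕ → ℝ} {c : ℝ} (h : Tendsto x atTop (𝓝 c)) :
    Tendsto (dilationMean x) atTop (𝓝 c) := by
  rw [Metric.tendsto_atTop] at h ⊢
  intro ε hε
  obtain ⟨N, hN⟩ := h (ε / 2) (half_pos hε)
  refine ⟨N, fun n hn => ?_⟩
  rw [Real.dist_eq]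
  refine (abs_dilationMean_sub_le (ε := ε / 2) fun j _ => ?_).trans_lt (half_lt_self hε)
  exact (hN _ (hn.trans (Nat.le_mul_of_pos_left _ (by positivity)))).le

/-- The sum telescopes. For bounded `x` the right side tends to `0` since `dilationCount` tends to
infinity, whence dilation invariance. -/
theorem dilationMean_two_mul_sub (x : ℕ → ℝ) (n : ℕ) :
    dilationMean (fun k => x (2 * k)) n - dilationMean x n =
      (x (2 ^ dilationCount n * n) - x n) / dilationCount n := by
  have h := Finset.sum_range_sub (fun j => x (2 ^ j * n)) (dilationCount n)
  rw [pow_zero, one_mul] at h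
  rw [dilationMean, dilationMean, ← sub_div, ← Finset.sum_sub_distrib, ← h]
  congr 1
  refine Finset.sum_congr rfl fun j _ => ?_
  rw [pow_succ', mul_assoc]

theorem memℓp_dilationMean {x : ℕ → ℝ} (h : Memℓp x ∞) (ν : ℕ → ℕ) :
    Memℓp (fun k => dilationMean x (ν k)) ∞ := by
  obtain ⟨C, -, hC⟩ := exists_abs_le_of_memℓp h
  refine memℓp_infty_of_eventually_le (C := C) (Eventually.of_forall fun k => ?_)
  have := abs_dilationMean_sub_le (x := x) (n := ν k) (c := 0) (ε := C)
    fun j _ => by simpa using hC _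
  simpa using this

namespace GeneralizedLimit

/-- The generalised limit that averages over dilations of a given sequence of indices. -/
def dilationAverage (η : GeneralizedLimit) (ν : ℕ → ℕ) (hν : Tendsto ν atTop atTop) :
    GeneralizedLimit where
  toFun :=
    { toFun := fun x => η.lim fun k => dilationMean x (ν k)
      map_add' := fun x y => by
        rw [← η.lim_add (memℓp_dilationMean (lp.memℓp x) ν) (memℓp_dilationMean (lp.memℓp y) ν)]
        congr 1
        funext k
        exact dilationMean_add x y (ν k)
      map_smul' := fun c x => by
        rw [RingHom.id_apply, smul_eq_mul,
          ← η.lim_const_mul (memℓp_dilationMean (lp.memℓp x) ν) c]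
        congr 1
        funext k
        exact dilationMean_const_mul c x (ν k) }
  nonneg := fun x hx => η.lim_nonneg fun k => dilationMean_nonneg hx _
  limit := fun _ _ h => η.lim_of_tendsto ((tendsto_dilationMean h).comp hν)

theorem dilationAverage_lim (η : GeneralizedLimit) {ν : ℕ → ℕ} (hν : Tendsto ν atTop atTop)
    {x : ℕ → ℝ} (hx : Memℓp x ∞) :
    (η.dilationAverage ν hν).lim x = η.lim fun k => dilationMean x (ν k) := by
  rw [lim, dif_pos hx]
  rfl

theorem isDilationInvariant_dilationAverage (η : GeneralizedLimit) {ν : ℕ → ℕ}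
    (hν : Tendsto ν atTop atTop) : (η.dilationAverage ν hν).IsDilationInvariant := by
  intro x y hxy
  refine η.lim_eq_of_tendsto_sub (memℓp_dilationMean (lp.memℓp x) ν) ?_
  obtain ⟨C, -, hC⟩ := exists_abs_le_of_memℓp (lp.memℓp x)
  have h1 : Tendsto (fun k => (C + C) / dilationCount (ν k)) atTop (𝓝 0) :=
    (tendsto_dilationCount.comp hν).const_div_atTop _
  refine squeeze_zero_norm (fun k => ?_) h1
  have h2 : (fun k => x (2 * k)) = y := funext fun k => (hxy k).symm
  have h3 := dilationMean_two_mul_sub x (ν k)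
  rw [h2] at h3
  rw [h3, norm_div, Real.norm_of_nonneg (dilationCount_pos _).le]
  gcongr
  exact (abs_sub _ _).trans (add_le_add (hC _) (hC _))

end GeneralizedLimit

/-! ### Operators with logarithmically growing partial sums -/

section Logarithmic

variable {T : H →L[ℂ] H} {ℓ : ℝ}

theorem tendsto_log_mul_div_log {f : ℕ → ℕ} (hf : ∀ n, 0 < f n)
    (h : Tendsto (fun n => Real.log (f n) / Real.log n) atTop (𝓝 0)) :
    Tendsto (fun n => Real.log ((f n * n : ℕ) : ℝ) / Real.log n) atTop (𝓝 1) := by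
  have h1 := h.add_const 1
  rw [zero_add] at h1
  refine h1.congr' ?_
  filter_upwards [tendsto_log_natCast.eventually_gt_atTop 0, eventually_gt_atTop 0] with n hn hn0
  rw [Nat.cast_mul, Real.log_mul (by exact_mod_cast (hf n).ne') (by exact_mod_cast hn0.ne'),
    add_div, div_self hn.ne']

theorem tendsto_log_div_div_log {m : ℕ} (hm : 1 ≤ m) :
    Tendsto (fun n => Real.log ((n / m : ℕ) : ℝ) / Real.log n) atTop (𝓝 1) := by
  -- The constant `2 * m` comes from `n ≤ (n / m) * (2 * m)`, valid for `n ≥ m`.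
  have h1 : Tendsto (fun n : ℕ => 1 - Real.log (2 * m) / Real.log n) atTop (𝓝 (1 - 0)) :=
    (tendsto_log_natCast.const_div_atTop _).const_sub 1
  rw [sub_zero] at h1
  refine tendsto_of_tendsto_of_tendsto_of_le_of_le' h1 tendsto_const_nhds ?_ ?_
  all_goals
    filter_upwards [tendsto_log_natCast.eventually_gt_atTop 0, eventually_ge_atTop m,
      eventually_gt_atTop 0] with n hn hnm hn0
    have hq : 1 ≤ n / m := (Nat.one_le_div_iff hm).mpr hnm
    have hq0 : (0 : ℝ) < (n / m : ℕ) := by exact_mod_cast hq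
    have hm0 : (0 : ℝ) < m := by exact_mod_cast hm
  · rw [sub_le_iff_le_add, ← add_div, le_div_iff₀ hn, one_mul,
      ← Real.log_mul hq0.ne' (by positivity)]
    refine Real.log_le_log (by exact_mod_cast hn0) ?_
    have h2 : n ≤ (n / m) * (2 * m) := by
      have h3 := Nat.div_add_mod n m
      have h4 := Nat.mod_lt n hm
      have h5 : m * 1 ≤ m * (n / m) := Nat.mul_le_mul_left _ hq
      nlinarith
    exact_mod_cast h2
  · rw [div_le_one hn]
    exact Real.log_le_log hq0 (by exact_mod_cast Nat.div_le_self n m)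

theorem tendsto_partialSum_comp_div_log
    (h : Tendsto (fun n : ℕ => partialSum T n / Real.log n) atTop (𝓝 ℓ)) {u : ℕ → ℕ}
    (hu : Tendsto (fun n => Real.log (u n) / Real.log n) atTop (𝓝 1)) :
    Tendsto (fun n : ℕ => partialSum T (u n) / Real.log n) atTop (𝓝 ℓ) := by
  have hlog : Tendsto (fun n => Real.log (u n)) atTop atTop := by
    refine (hu.pos_mul_atTop one_pos tendsto_log_natCast).congr' ?_
    filter_upwards [tendsto_log_natCast.eventually_gt_atTop 0] with n hn
    exact div_mul_cancel₀ _ hn.ne'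
  have hu' : Tendsto u atTop atTop := by
    refine tendsto_atTop.mpr fun b => ?_
    filter_upwards [hlog.eventually_gt_atTop (Real.log b),
      hlog.eventually_gt_atTop 0] with n hn hn0
    have hun : (0 : ℝ) < u n := by
      rcases Nat.eq_zero_or_pos (u n) with h0 | h0
      · simp [h0] at hn0
      · exact_mod_cast h0
    by_contra! hlt
    exact absurd (Real.log_le_log hun (by exact_mod_cast hlt.le : (u n : ℝ) ≤ b)) (not_le.mpr hn)
  have h1 := (h.comp hu').mul hu
  rw [mul_one] at h1
  refine h1.congr' ?_
  filter_upwards [hlog.eventually_gt_atTop 0] with n hn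
  exact div_mul_div_cancel₀ hn.ne'

/-- Both ends of the block have logarithm asymptotic to `log n`, so the two normalised partial sums
have the same limit. The growing factor `f n` is allowed for use with `2 ^ dilationCount n`. -/
theorem tendsto_sum_Ico_div_log
    (h : Tendsto (fun n : ℕ => partialSum T n / Real.log n) atTop (𝓝 ℓ)) {f : ℕ → ℕ}
    (hf : ∀ n, 0 < f n) (hf' : Tendsto (fun n => Real.log (f n) / Real.log n) atTop (𝓝 0)) {m : ℕ}
    (hm : 1 ≤ m) :
    Tendsto (fun n => (∑ k ∈ Finset.Ico (n / m) (f n * n), mu T k) / Real.log n) atTop (𝓝 0) := by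
  have h1 := (tendsto_partialSum_comp_div_log h (tendsto_log_mul_div_log hf hf')).sub
    (tendsto_partialSum_comp_div_log h (tendsto_log_div_div_log hm))
  rw [sub_self] at h1
  refine h1.congr fun n => ?_
  rw [← sub_div, partialSum_sub ((Nat.div_le_self n m).trans (Nat.le_mul_of_pos_left _ (hf n)))]

theorem not_isTraceClass_of_tendsto_div_log (hℓ : 0 < ℓ)
    (h : Tendsto (fun n : ℕ => partialSum T n / Real.log n) atTop (𝓝 ℓ)) : ¬ IsTraceClass T := by
  intro hT
  have h1 : Tendsto (fun n : ℕ => partialSum T n / Real.log n) atTop (𝓝 0) :=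
    (sum_range_isLittleO_log_of_summable hT.2).tendsto_div_nhds_zero
  exact hℓ.ne' (tendsto_nhds_unique h h1)

theorem integralSeq_of_not_isTraceClass (h : ¬ IsTraceClass T) : integralSeq T = partialSum T := by
  funext n
  rw [integralSeq, if_neg h]

theorem relativeSeq_of_not_isTraceClass (h : ¬ IsTraceClass T) (B : H →L[ℂ] H) :
    relativeSeq T B = partialSum B := by
  funext n
  rw [relativeSeq, if_neg h]

theorem isEccentricAlong_of_tendsto_div_log (hℓ : 0 < ℓ)
    (h : Tendsto (fun n : ℕ => partialSum T n / Real.log n) atTop (𝓝 ℓ)) {ν : ℕ → ℕ}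
    (hν : Tendsto ν atTop atTop) : IsEccentricAlong T ν := by
  refine ⟨hν, fun m hm => ?_⟩
  rw [integralSeq_of_not_isTraceClass (not_isTraceClass_of_tendsto_div_log hℓ h)]
  have h1 := (tendsto_sum_Ico_div_log h (f := fun _ => m) (fun _ => hm)
    (tendsto_log_natCast.const_div_atTop _) hm).div h hℓ.ne'
  rw [zero_div] at h1
  refine (h1.comp hν).congr' ?_
  filter_upwards [(tendsto_log_natCast.comp hν).eventually_gt_atTop 0] with k hk
  exact div_div_div_cancel_right₀ hk.ne' _ _

theorem memL1Inf_of_tendsto_div_log (hT : IsCompactOperator T)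
    (h : Tendsto (fun n : ℕ => partialSum T n / Real.log n) atTop (𝓝 ℓ)) : MemL1Inf T := by
  refine ⟨hT, isBigO_of_div_tendsto_nhds ?_ ℓ h⟩
  filter_upwards [tendsto_log_natCast.eventually_gt_atTop 0] with n hn h0
  exact absurd h0 hn.ne'

theorem memℓp_partialSum_div_log {B : H →L[ℂ] H} (hB : MemL1Inf B) :
    Memℓp (fun n : ℕ => partialSum B n / Real.log n) ∞ := by
  obtain ⟨C, hC⟩ := hB.2.bound
  refine memℓp_infty_of_eventually_le (C := C) ?_
  filter_upwards [hC, tendsto_log_natCast.eventually_gt_atTop 0] with n hn hn0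
  rwa [abs_div, abs_of_pos hn0, div_le_iff₀ hn0, ← abs_of_pos hn0]

theorem toReal_dixmierTrace (ω : GeneralizedLimit) {B : H →L[ℂ] H} (hB : MemL1Inf B) :
    (dixmierTrace ω B).toReal = ω.lim fun n => partialSum B n / Real.log n := by
  rw [dixmierTrace, if_pos hB, ENNReal.toReal_ofReal]
  refine ω.lim_nonneg fun n => div_nonneg (partialSum_nonneg _ _) ?_
  exact Real.log_natCast_nonneg n

theorem toReal_dixmierTrace_eq_zero (hH : ¬ FiniteDimensional ℂ H) (ω : GeneralizedLimit)
    (hT : MemL1InfZero T) {P : H →L[ℂ] H}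
    (hP : P ∈ TwoSidedIdeal.span ({T} : Set (H →L[ℂ] H))) : (dixmierTrace ω P).toReal = 0 := by
  rw [toReal_dixmierTrace ω (memL1Inf_of_mem_span hH ⟨hT.1, hT.2.isBigO⟩ hP)]
  refine ω.lim_of_tendsto (IsLittleO.tendsto_div_nhds_zero ?_)
  obtain ⟨C, -, h⟩ := exists_partialSum_le_of_mem_span hH hT.1 hP
  refine IsBigO.trans_isLittleO (IsBigO.of_bound C (Eventually.of_forall fun n => ?_)) hT.2
  rw [Real.norm_of_nonneg (partialSum_nonneg _ _), Real.norm_of_nonneg (partialSum_nonneg _ _)]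
  exact h n

/-- The factor `ℓ` is the limit of `S_n(T) / log n`, and multiplying by this convergent sequence
changes the denominator. -/
theorem toReal_associatedTrace (hH : ¬ FiniteDimensional ℂ H) (hT : IsCompactOperator T)
    (hpos : ∀ n, 0 < mu T n) (hℓ : 0 < ℓ)
    (h : Tendsto (fun n : ℕ => partialSum T n / Real.log n) atTop (𝓝 ℓ)) {ν : ℕ → ℕ}
    (hν : Tendsto ν atTop atTop) (η : GeneralizedLimit) {P : H →L[ℂ] H}
    (hP : P ∈ TwoSidedIdeal.span ({T} : Set (H →L[ℂ] H))) :
    ℓ * (associatedTrace T ν η P).toReal =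
      η.lim fun k => partialSum P (ν k) / Real.log (ν k) := by
  have he := isEccentricAlong_of_tendsto_div_log hℓ h hν
  have hTt := not_isTraceClass_of_tendsto_div_log hℓ h
  have hmem := he.memℓp hH hT hpos hP
  have hnn : 0 ≤ η.lim fun k => relativeSeq T P (ν k) / integralSeq T (ν k) :=
    η.lim_nonneg fun k => div_nonneg (relativeSeq_nonneg _ _ _) (relativeSeq_nonneg T T _)
  rw [associatedTrace_eq hT hH hpos he η hP, ENNReal.toReal_ofReal hnn,
    ← η.lim_mul_of_tendsto hmem (h.comp hν)]
  congr 1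
  funext k
  rw [relativeSeq_of_not_isTraceClass hTt, integralSeq_of_not_isTraceClass hTt]
  rcases Nat.eq_zero_or_pos (ν k) with h0 | h0
  · simp [h0, partialSum]
  · have hS : 0 < partialSum T (ν k) :=
      Finset.sum_pos (fun k _ => hpos k) ⟨0, Finset.mem_range.mpr h0⟩
    exact div_mul_div_cancel₀ hS.ne'

theorem abs_partialSum_div_log_sub_le {B : H →L[ℂ] H} {n N p : ℕ} (hn : 0 < Real.log n)
    (hnp : n ≤ p) (hpN : p ≤ N) :
    |partialSum B p / Real.log p - partialSum B n / Real.log n| ≤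
      (∑ k ∈ Finset.Ico n N, mu B k) / Real.log n +
        partialSum B n / Real.log n * ((Real.log p - Real.log n) / Real.log n) := by
  have hn0 : (0 : ℝ) < n := by
    rcases Nat.eq_zero_or_pos n with h0 | h0
    · simp [h0] at hn
    · exact_mod_cast h0
  have hlog : Real.log n ≤ Real.log p := Real.log_le_log hn0 (by exact_mod_cast hnp)
  have hp : 0 < Real.log p := hn.trans_le hlog
  have hsub := partialSum_sub (B := B) hnp
  have h1 : partialSum B p / Real.log p - partialSum B n / Real.log n =
      (∑ k ∈ Finset.Ico n p, mu B k) / Real.log p -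
        partialSum B n / Real.log n * ((Real.log p - Real.log n) / Real.log p) := by
    rw [← hsub]
    field_simp
    ring
  have hPn : 0 ≤ partialSum B n / Real.log n := div_nonneg (partialSum_nonneg _ _) hn.le
  have hd : 0 ≤ Real.log p - Real.log n := sub_nonneg.mpr hlog
  rw [h1]
  refine (abs_sub _ _).trans (add_le_add ?_ ?_)
  · rw [abs_of_nonneg (div_nonneg (sum_Ico_mu_nonneg B _ _) hp.le)]
    refine div_le_div₀ (sum_Ico_mu_nonneg B _ _) ?_ hn hlog
    exact Finset.sum_le_sum_of_subset_of_nonneg (Finset.Ico_subset_Ico le_rfl hpN)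
      fun k _ _ => mu_nonneg B k
  · rw [abs_of_nonneg (mul_nonneg hPn (div_nonneg hd hp.le))]
    gcongr

theorem tendsto_log_two_pow_dilationCount :
    Tendsto (fun n => Real.log ((2 ^ dilationCount n : ℕ) : ℝ) / Real.log n) atTop (𝓝 0) := by
  have h := tendsto_dilationCount_div_log.mul_const (Real.log 2)
  rw [zero_mul] at h
  refine h.congr fun n => ?_
  rw [Nat.cast_pow, Real.log_pow, Nat.cast_ofNat]
  ring

/-- For operators in the ideal of `T`, averaging over few dilations does not affect the logarithmic
means. -/
theorem tendsto_dilationMean_sub (hH : ¬ FiniteDimensional ℂ H) (hT : IsCompactOperator T)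
    (h : Tendsto (fun n : ℕ => partialSum T n / Real.log n) atTop (𝓝 ℓ)) {P : H →L[ℂ] H}
    (hP : P ∈ TwoSidedIdeal.span ({T} : Set (H →L[ℂ] H))) :
    Tendsto (fun n => dilationMean (fun k => partialSum P k / Real.log k) n -
      partialSum P n / Real.log n) atTop (𝓝 0) := by
  obtain ⟨C, hC, m, hm, hle⟩ := exists_sum_Ico_mu_le_of_mem_span hH hT hP
  obtain ⟨K, hK, hKle⟩ := exists_abs_le_of_memℓp
    (memℓp_partialSum_div_log (memL1Inf_of_mem_span hH (memL1Inf_of_tendsto_div_log hT h) hP))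
  -- Two errors for each dilate: the eigenvalues between `n` and `2 ^ dilationCount n * n`, and the
  -- change of the logarithm in the denominator. Both are `o(1)` because `dilationCount n` is `o(log
  -- n)`.
  have h1 := ((tendsto_sum_Ico_div_log h (f := fun n => 2 ^ dilationCount n)
    (fun n => by positivity) tendsto_log_two_pow_dilationCount hm).const_mul C).add
    (tendsto_log_two_pow_dilationCount.const_mul K)
  rw [mul_zero, mul_zero, add_zero] at h1
  refine squeeze_zero_norm' ?_ h1
  filter_upwards [tendsto_log_natCast.eventually_gt_atTop 0, eventually_gt_atTop 0] with n hn hn0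
  refine abs_dilationMean_sub_le fun j hj => ?_
  have hj' : 2 ^ j ≤ 2 ^ dilationCount n := Nat.pow_le_pow_right two_pos hj.le
  refine (abs_partialSum_div_log_sub_le hn (Nat.le_mul_of_pos_left n (by positivity))
    (Nat.mul_le_mul_right n hj')).trans (add_le_add ?_ ?_)
  · rw [← mul_div_assoc]
    gcongr
    exact hle _ _
  · have hlog : Real.log ((2 ^ j * n : ℕ) : ℝ) - Real.log n = Real.log ((2 ^ j : ℕ) : ℝ) := by
      rw [Nat.cast_mul, Real.log_mul (by positivity) (by positivity)]
      ring
    rw [hlog]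
    refine mul_le_mul ((le_abs_self _).trans (hKle n)) ?_
      (div_nonneg (Real.log_natCast_nonneg _) hn.le) hK
    gcongr

theorem toReal_dixmierTrace_dilationAverage (hH : ¬ FiniteDimensional ℂ H)
    (hT : IsCompactOperator T)
    (h : Tendsto (fun n : ℕ => partialSum T n / Real.log n) atTop (𝓝 ℓ)) {ν : ℕ → ℕ}
    (hν : Tendsto ν atTop atTop) (η : GeneralizedLimit) {P : H →L[ℂ] H}
    (hP : P ∈ TwoSidedIdeal.span ({T} : Set (H →L[ℂ] H))) :
    (dixmierTrace (η.dilationAverage ν hν) P).toReal =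
      η.lim fun k => partialSum P (ν k) / Real.log (ν k) := by
  have hPm := memL1Inf_of_mem_span hH (memL1Inf_of_tendsto_div_log hT h) hP
  have hmem := memℓp_partialSum_div_log hPm
  rw [toReal_dixmierTrace _ hPm, η.dilationAverage_lim hν hmem]
  refine η.lim_eq_of_tendsto_sub ?_ ((tendsto_dilationMean_sub hH hT h hP).comp hν)
  obtain ⟨C, -, hC⟩ := exists_abs_le_of_memℓp hmem
  exact memℓp_infty_of_eventually_le (Eventually.of_forall fun k => hC (ν k))

end Logarithmic

/-! ### Existence of generalised limits -/

theorem exists_tendsto_hyperfilter {x : ℕ → ℝ} (h : Memℓp x ∞) :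
    ∃ c, Tendsto x (hyperfilter ℕ : Filter ℕ) (𝓝 c) := by
  obtain ⟨C, -, hC⟩ := exists_abs_le_of_memℓp h
  obtain ⟨c, -, hc⟩ := (isCompact_Icc (a := -C) (b := C)).ultrafilter_le_nhds
    ((hyperfilter ℕ).map x) (by
      rw [le_principal_iff]
      exact Filter.mem_map.mpr (univ_mem' fun n => abs_le.mp (hC n)))
  exact ⟨c, hc⟩

theorem tendsto_limUnder_hyperfilter {x : ℕ → ℝ} (h : Memℓp x ∞) :
    Tendsto x (hyperfilter ℕ : Filter ℕ) (𝓝 (limUnder (hyperfilter ℕ : Filter ℕ) x)) :=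
  tendsto_nhds_limUnder (exists_tendsto_hyperfilter h)

/-- The limit along a free ultrafilter. -/
def GeneralizedLimit.hyperfilter : GeneralizedLimit where
  toFun :=
    { toFun := fun x => limUnder (Filter.hyperfilter ℕ : Filter ℕ) x
      map_add' := fun x y => ((tendsto_limUnder_hyperfilter (lp.memℓp x)).add
        (tendsto_limUnder_hyperfilter (lp.memℓp y))).limUnder_eq
      map_smul' := fun c x =>
        ((tendsto_limUnder_hyperfilter (lp.memℓp x)).const_smul c).limUnder_eq }
  nonneg := fun x hx => ge_of_tendsto' (tendsto_limUnder_hyperfilter (lp.memℓp x)) hx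
  limit := fun _ _ h => (h.mono_left Nat.hyperfilter_le_atTop).limUnder_eq

/-! ### The order of a decreasing sequence -/

/-- If the quotient were eventually above some `x > 1 / d`, then `t n ≤ (n + 1)^{-x}` and `t n ^ γ`
would be summable for some `γ < d`. Conversely, for `0 < y < 1 / d` the sequence `t n ^ (1 / y)` is
decreasing and summable, so `(n + 1) * t n ^ (1 / y)` is bounded and the quotient is at least `y -
o(1)`. -/
theorem liminf_log_div_log {t : ℕ → ℝ} (ht : ∀ n, 0 < t n) (hanti : Antitone t) {d : ℝ}
    (hd : 0 < d) (h1 : ∀ γ, d < γ → Summable fun n => t n ^ γ)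
    (h2 : ∀ γ, 0 < γ → γ < d → ¬ Summable fun n => t n ^ γ) :
    liminf (fun n : ℕ => ((Real.log (t n) / Real.log (1 / ((n : ℝ) + 1)) : ℝ) : EReal)) atTop =
      ((d⁻¹ : ℝ) : EReal) := by
  have hlog : Tendsto (fun n : ℕ => Real.log ((n : ℝ) + 1)) atTop atTop :=
    Real.tendsto_log_atTop.comp (tendsto_atTop_add_const_right _ 1 tendsto_natCast_atTop_atTop)
  refine le_antisymm ?_ ?_
  · refine le_of_forall_gt_imp_ge_of_dense fun a ha => ?_
    obtain ⟨x, hx, hxa⟩ := EReal.lt_iff_exists_real_btwn.mp ha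
    refine le_trans (liminf_le_of_frequently_le ?_) hxa.le
    have hx : d⁻¹ < x := EReal.coe_lt_coe_iff.mp hx
    have hx0 : 0 < x := (inv_pos.mpr hd).trans hx
    obtain ⟨γ, hγ1, hγ2⟩ := exists_between ((inv_lt_comm₀ hd hx0).mp hx)
    have hγ0 : 0 < γ := (inv_pos.mpr hx0).trans hγ1
    by_contra hfreq
    refine h2 γ hγ0 hγ2 ?_
    have hxγ : 1 < x * γ := by rwa [inv_lt_iff_one_lt_mul₀' hx0] at hγ1
    have hs : Summable fun n : ℕ => ((n : ℝ) + 1) ^ (-(x * γ)) := by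
      have h6 : Summable fun n : ℕ => (n : ℝ) ^ (-(x * γ)) :=
        Real.summable_nat_rpow.mpr (by linarith)
      simpa using (summable_nat_add_iff 1).mpr h6
    refine summable_of_isBigO_nat hs (IsBigO.of_bound 1 ?_)
    filter_upwards [not_frequently.mp hfreq, hlog.eventually_gt_atTop 0] with n hn hn0
    -- The denominator `log (1 / (n + 1))` is negative, so clearing it reverses the inequality.
    rw [EReal.coe_le_coe_iff, not_le, one_div, Real.log_inv, lt_div_iff_of_neg (by linarith)] at hn
    rw [one_mul, Real.norm_of_nonneg (Real.rpow_nonneg (ht n).le _),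
      Real.norm_of_nonneg (by positivity), neg_mul_eq_neg_mul, Real.rpow_mul (by positivity)]
    refine Real.rpow_le_rpow (ht n).le ?_ hγ0.le
    rw [← Real.log_le_log_iff (ht n) (by positivity), Real.log_rpow (by positivity)]
    linarith
  · refine le_of_forall_lt_imp_le_of_dense fun a ha => ?_
    obtain ⟨x, hax, hx⟩ := EReal.lt_iff_exists_real_btwn.mp ha
    refine hax.le.trans (le_liminf_of_le (by isBoundedDefault) ?_)
    have hx : x < d⁻¹ := EReal.coe_lt_coe_iff.mp hx
    obtain ⟨y, hxy, hy⟩ := exists_between (max_lt hx (inv_pos.mpr hd))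
    have hy0 : 0 < y := (le_max_right _ _).trans_lt hxy
    have hsum := h1 y⁻¹ ((lt_inv_comm₀ hy0 hd).mp hy)
    set C := ∑' n, t n ^ y⁻¹ with hC
    have hC0 : 0 < C := hsum.tsum_pos (fun n => Real.rpow_nonneg (ht n).le _) 0
      (Real.rpow_pos_of_pos (ht 0) _)
    have hle : ∀ n : ℕ, Real.log (t n) ≤ y * (Real.log C - Real.log ((n : ℝ) + 1)) := by
      intro n
      have h3 : ((n : ℝ) + 1) * t n ^ y⁻¹ ≤ C :=
        (succ_mul_le_sum_range (fun i j hij =>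
          Real.rpow_le_rpow (ht j).le (hanti hij) (inv_nonneg.mpr hy0.le)) n).trans
          (hsum.sum_le_tsum _ fun k _ => Real.rpow_nonneg (ht k).le _)
      have hp := Real.rpow_pos_of_pos (ht n) y⁻¹
      have h4 := Real.log_le_log (by positivity) h3
      rw [Real.log_mul (by positivity) hp.ne', Real.log_rpow (ht n)] at h4
      calc Real.log (t n) = y * (y⁻¹ * Real.log (t n)) := by
            rw [mul_inv_cancel_left₀ hy0.ne']
        _ ≤ _ := mul_le_mul_of_nonneg_left (by linarith) hy0.le
    have hlim : Tendsto (fun n : ℕ => y - y * Real.log C / Real.log ((n : ℝ) + 1)) atTop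
        (𝓝 (y - 0)) := (hlog.const_div_atTop _).const_sub y
    rw [sub_zero] at hlim
    filter_upwards [hlim.eventually_const_lt ((le_max_left _ _).trans_lt hxy),
      hlog.eventually_gt_atTop 0] with n hn hn0
    rw [EReal.coe_le_coe_iff, one_div, Real.log_inv]
    refine hn.le.trans ?_
    rw [le_div_iff_of_neg (by linarith)]
    refine (hle n).trans (le_of_eq ?_)
    field_simp
    ring

/-! ### Spectral triples -/

theorem mu_eq_zero_of_finiteDimensional [FiniteDimensional ℂ H] (T : H →L[ℂ] H) {n : ℕ}
    (hn : Module.finrank ℂ H ≤ n) : mu T n = 0 := by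
  have h : {t : ℝ | 0 ≤ t ∧
      ((n + 1 : ℕ) : Cardinal) ≤ Module.rank ℂ (spectralSubspace T t)} = ∅ := by
    refine Set.eq_empty_of_forall_notMem fun t ht => ?_
    have h1 := ht.2.trans (Submodule.rank_le (spectralSubspace T t))
    rw [← Module.finrank_eq_rank, Nat.cast_le] at h1
    omega
  rw [mu, h, Real.sSup_empty]

theorem memL1InfZero_of_finiteDimensional [FiniteDimensional ℂ H] (T : H →L[ℂ] H) :
    MemL1InfZero T := by
  refine ⟨?_, sum_range_isLittleO_log_of_summable ?_⟩
  · have := FiniteDimensional.proper ℂ H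
    exact isCompactOperator_of_locallyCompactSpace_dom T
  · exact summable_of_ne_finset_zero (s := Finset.range (Module.finrank ℂ H)) fun n hn =>
      mu_eq_zero_of_finiteDimensional T (not_lt.mp fun h => hn (Finset.mem_range.mpr h))

theorem memL1InfZero_of_isTraceClass {T : H →L[ℂ] H} (h : IsTraceClass T) : MemL1InfZero T :=
  ⟨h.1, sum_range_isLittleO_log_of_summable h.2⟩

/-- For a natural number `n > s`, `|T|^n = |T|^{n-s} |T|^s`, and `|T|^n` is injective. -/
theorem abs_rpow_injective {T : H →L[ℂ] H} (hinj : ∀ x, T x = 0 → x = 0) {s : ℝ} (hs : 0 < s)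
    (x : H) (hx : (CFC.abs T ^ s : H →L[ℂ] H) x = 0) : x = 0 := by
  have hpow : ∀ n : ℕ, ∀ y, (CFC.abs T ^ n : H →L[ℂ] H) y = 0 → y = 0 := by
    intro n
    induction n with
    | zero => exact fun y hy => by simpa using hy
    | succ n ih =>
      intro y hy
      rw [pow_succ, mul_apply_eq_comp] at hy
      refine hinj y ?_
      rw [← norm_eq_zero, ← norm_abs_apply, ih _ hy, norm_zero]
  lift s to ℝ≥0 using hs.le
  obtain ⟨n, hn⟩ := exists_nat_gt s
  refine hpow n x ?_
  have h1 := CFC.nnrpow_add (a := (CFC.abs T : H →L[ℂ] H)) (tsub_pos_of_lt hn)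
    (NNReal.coe_pos.mp hs)
  rw [tsub_add_cancel_of_le hn.le, CFC.nnrpow_eq_rpow (bot_le.trans_lt hn), NNReal.coe_natCast,
    CFC.rpow_natCast _ _ (CFC.abs_nonneg T), CFC.nnrpow_eq_rpow (NNReal.coe_pos.mp hs)] at h1
  rw [h1, mul_apply_eq_comp, hx, map_zero]

namespace SpectralTriple

variable {A : Type*} [NonUnitalRing A] [Module ℂ A] [IsScalarTower ℂ A A] [SMulCommClass ℂ A A]
variable (S : SpectralTriple A H)

/-- The resolvent identity `D⁻¹ = R (1 - z D⁻¹)`, with `R` the given compact resolvent at `z`. -/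
theorem isCompactOperator_invD : IsCompactOperator S.invD := by
  obtain ⟨z, R, ⟨-, h2⟩, hR⟩ := S.compact_resolvent
  have h : S.invD = R * (1 - z • S.invD) := by
    ext x
    obtain ⟨hx, hD⟩ := S.invD_spec.1 x
    rw [zero_smul, sub_zero] at hD
    have := h2 ⟨S.invD x, hx⟩
    rw [hD] at this
    exact this.symm
  rw [h]
  exact isCompactOperator_mul_right hR _

theorem invD_injective (x : H) (hx : S.invD x = 0) : x = 0 := by
  obtain ⟨h, hD⟩ := S.invD_spec.1 x
  have h0 : (⟨S.invD x, h⟩ : S.D.domain) = 0 := Subtype.ext hx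
  rw [h0, LinearPMap.map_zero, zero_smul, sub_zero] at hD
  exact hD.symm

variable {S} {d : ℝ}

/-- On a finite-dimensional space every power is in `L_0^{1,∞}`, so the infimum could not be
positive. -/
theorem not_finiteDimensional (hd : 0 < d) (hdim : S.dimension = ENNReal.ofReal d) :
    ¬ FiniteDimensional ℂ H := by
  intro hH
  have h1 : S.dimension ≤ ENNReal.ofReal (d / 2) :=
    iInf₂_le (d / 2) ⟨by positivity, memL1InfZero_of_finiteDimensional _⟩
  rw [hdim, ENNReal.ofReal_le_ofReal_iff (by positivity)] at h1
  linarith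

theorem mu_absPow (S : SpectralTriple A H) (hH : ¬ FiniteDimensional ℂ H) {s : ℝ} (hs : 0 ≤ s) :
    mu (S.absPow s) = fun n => mu S.invD n ^ s :=
  funext fun n => mu_abs_rpow hH S.isCompactOperator_invD S.invD_injective hs n

theorem mu_invD_pos (S : SpectralTriple A H) (hH : ¬ FiniteDimensional ℂ H) (n : ℕ) :
    0 < mu S.invD n :=
  mu_pos hH S.isCompactOperator_invD S.invD_injective n

theorem isCompactOperator_absPow (S : SpectralTriple A H) (hH : ¬ FiniteDimensional ℂ H) {s : ℝ}
    (hs : 0 < s) : IsCompactOperator (S.absPow s) :=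
  isCompactOperator_abs_rpow hH S.isCompactOperator_invD S.invD_injective hs

theorem isTraceClass_absPow_iff (hH : ¬ FiniteDimensional ℂ H) {s : ℝ} (hs : 0 < s) :
    IsTraceClass (S.absPow s) ↔ Summable fun n => mu S.invD n ^ s := by
  rw [IsTraceClass, mu_absPow S hH hs.le, and_iff_right (isCompactOperator_absPow S hH hs)]

theorem isTraceClass_absPow_of_memL1Inf (hH : ¬ FiniteDimensional ℂ H) {α γ : ℝ} (hα : 0 < α)
    (h : MemL1Inf (S.absPow α)) (hγ : α < γ) : IsTraceClass (S.absPow γ) := by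
  rw [isTraceClass_absPow_iff hH (hα.trans hγ)]
  have h1 := summable_rpow_of_sum_isBigO_log (mu_nonneg (S.absPow α))
    (mu_antitone hH (isCompactOperator_absPow S hH hα)) h.2 ((one_lt_div hα).mpr hγ)
  simp only [mu_absPow S hH hα.le] at h1
  refine h1.congr fun n => ?_
  rw [← Real.rpow_mul (mu_nonneg _ n), mul_div_cancel₀ _ hα.ne']

theorem le_of_memL1InfZero (hdim : S.dimension = ENNReal.ofReal d) {α : ℝ} (hα : 0 < α)
    (h : MemL1InfZero (S.absPow α)) : d ≤ α := by
  have h1 : S.dimension ≤ ENNReal.ofReal α := iInf₂_le α ⟨hα, h⟩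
  rwa [hdim, ENNReal.ofReal_le_ofReal_iff hα.le] at h1

theorem isTraceClass_absPow_of_lt (hd : 0 < d) (hdim : S.dimension = ENNReal.ofReal d) {γ : ℝ}
    (hγ : d < γ) : IsTraceClass (S.absPow γ) := by
  have hH := not_finiteDimensional hd hdim
  have h1 : S.dimension < ENNReal.ofReal γ := by
    rw [hdim]
    exact (ENNReal.ofReal_lt_ofReal_iff (hd.trans hγ)).mpr hγ
  simp only [dimension, iInf_lt_iff] at h1
  obtain ⟨α, ⟨hα, hm⟩, hαγ⟩ := h1
  exact isTraceClass_absPow_of_memL1Inf hH hα ⟨hm.1, hm.2.isBigO⟩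
    ((ENNReal.ofReal_lt_ofReal_iff (hd.trans hγ)).mp hαγ)

theorem not_isTraceClass_absPow_of_lt (hdim : S.dimension = ENNReal.ofReal d) {γ : ℝ}
    (hγ : 0 < γ) (hγd : γ < d) : ¬ IsTraceClass (S.absPow γ) := fun h =>
  not_le.mpr hγd (le_of_memL1InfZero hdim hγ (memL1InfZero_of_isTraceClass h))

theorem mul_absPow_mem_span (S : SpectralTriple A H) (a : A) (s : ℝ) :
    S.π a * S.absPow s ∈ TwoSidedIdeal.span ({S.absPow s} : Set (H →L[ℂ] H)) :=
  TwoSidedIdeal.mul_mem_left _ _ _ (self_mem_span _)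

/-- For `α > d` the operator is trace class and the Dixmier trace vanishes on its ideal. For `α <
d`, finiteness puts `|D|^{-α}` in `L^{1,∞}`, and then `|D|^{-γ}` would be trace class for some `γ <
d`. -/
theorem eq_of_hausdorffNontrivial (hd : 0 < d) (hdim : S.dimension = ENNReal.ofReal d)
    {ω : GeneralizedLimit} {α : ℝ} (hα : 0 < α) (h : S.HausdorffNontrivial ω α) : α = d := by
  have hH := not_finiteDimensional hd hdim
  obtain ⟨hfin, a, ha⟩ := h
  have hm : MemL1Inf (S.absPow α) := by
    by_contra hcon
    rw [dixmierTrace, if_neg hcon] at hfin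
    exact hfin.ne rfl
  refine le_antisymm (not_lt.mp fun hlt => ha ?_) (not_lt.mp fun hlt => ?_)
  · have h0 := linExt_eq_mul_of_forall_mem_span (T := S.absPow α) (φ := dixmierTrace ω)
      (ψ := dixmierTrace ω) (c := 0) (fun P _ hP => by
        rw [zero_mul, toReal_dixmierTrace_eq_zero hH ω
          (memL1InfZero_of_isTraceClass (isTraceClass_absPow_of_lt hd hdim hlt)) hP])
      (mul_absPow_mem_span S a α)
    rwa [Complex.ofReal_zero, zero_mul] at h0
  · obtain ⟨γ, hγ1, hγ2⟩ := exists_between hlt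
    exact not_isTraceClass_absPow_of_lt hdim (hα.trans hγ1) hγ2
      (isTraceClass_absPow_of_memL1Inf hH hα hm hγ1)

theorem ord_invD_inv (hd : 0 < d) (hdim : S.dimension = ENNReal.ofReal d) :
    (ord S.invD)⁻¹ = (d : EReal) := by
  have hH := not_finiteDimensional hd hdim
  have h : ord S.invD = ((d⁻¹ : ℝ) : EReal) := by
    rw [← liminf_log_div_log (mu_invD_pos S hH) (mu_antitone hH S.isCompactOperator_invD) hd
      (fun γ hγ => (isTraceClass_absPow_iff hH (hd.trans hγ)).mp
        (isTraceClass_absPow_of_lt hd hdim hγ))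
      (fun γ hγ hγd hs => not_isTraceClass_absPow_of_lt hdim hγ hγd
        ((isTraceClass_absPow_iff hH hγ).mpr hs)), ord]
    congr 1
    funext n
    rw [ENNReal.log_ofReal_of_pos (mu_invD_pos S hH n), EReal.coe_div]
  rw [h, ← EReal.coe_inv, inv_inv]

theorem isLUB_not_isTraceClass (hd : 0 < d) (hdim : S.dimension = ENNReal.ofReal d) :
    IsLUB {γ : ℝ | 0 < γ ∧ ¬ IsTraceClass (S.absPow γ)} d := by
  refine ⟨fun γ hγ => not_lt.mp fun hlt => hγ.2 (isTraceClass_absPow_of_lt hd hdim hlt),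
    fun b hb => not_lt.mp fun hlt => ?_⟩
  obtain ⟨γ, hγ1, hγ2⟩ := exists_between (max_lt hlt hd)
  have hγ0 : 0 < γ := (le_max_right _ _).trans_lt hγ1
  exact not_le.mpr ((le_max_left _ _).trans_lt hγ1)
    (hb ⟨hγ0, not_isTraceClass_absPow_of_lt hdim hγ0 hγ2⟩)

theorem absPow_injective (S : SpectralTriple A H) {s : ℝ} (hs : 0 < s) (x : H)
    (hx : S.absPow s x = 0) : x = 0 :=
  abs_rpow_injective S.invD_injective hs x hx

theorem summable_mu_absPow_rpow_iff (hH : ¬ FiniteDimensional ℂ H) (hd : 0 < d) {γ : ℝ}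
    (hγ : 0 < γ) :
    (Summable fun n => mu (S.absPow d) n ^ γ) ↔ IsTraceClass (S.absPow (d * γ)) := by
  rw [isTraceClass_absPow_iff hH (mul_pos hd hγ)]
  refine summable_congr fun n => ?_
  rw [mu_absPow S hH hd.le, Real.rpow_mul (mu_nonneg _ n)]

/-- Criticality of `d` says that `|D|^{-d}` has order one, hence is eccentric along some sequence;
any generalised limit then gives a normalised singular trace. -/
theorem isExponentOfSingularTraceability_invD (hd : 0 < d)
    (hdim : S.dimension = ENNReal.ofReal d) : IsExponentOfSingularTraceability S.invD d := by
  have hH := not_finiteDimensional hd hdim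
  have hT := isCompactOperator_absPow S hH hd
  have hinj := fun x => absPow_injective S hd x
  obtain ⟨ν, hν⟩ := exists_isEccentricAlong (T := S.absPow d) (mu_pos hH hT hinj)
    (fun γ hγ => (summable_mu_absPow_rpow_iff hH hd (one_pos.trans hγ)).mpr
      (isTraceClass_absPow_of_lt hd hdim (lt_mul_of_one_lt_right hd hγ)))
    (fun γ hγ hγ1 hs => not_isTraceClass_absPow_of_lt hdim (mul_pos hd hγ)
      (mul_lt_of_lt_one_right hd hγ1) ((summable_mu_absPow_rpow_iff hH hd hγ).mp hs))
  exact ⟨hd, _, isSingularTrace_associatedTrace hH hT hinj hν GeneralizedLimit.hyperfilter,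
    associatedTrace_self hH hT hinj hν.tendsto_atTop _⟩

section Residue

variable {L : ℝ}

/-- The substitution `s = d (1 + σ)`, for which `s - d = d σ`; this is where the factor `1 / d`
arises. -/
theorem tendsto_mul_tsum_mu_absPow (hH : ¬ FiniteDimensional ℂ H) (hd : 0 < d)
    (hL : Tendsto (fun s : ℝ => (s - d) * S.zeta s) (𝓝[>] d) (𝓝 L)) :
    Tendsto (fun σ : ℝ => σ * ∑' n, mu (S.absPow d) n ^ (1 + σ)) (𝓝[>] 0) (𝓝 (L / d)) := by
  have h1 : Tendsto (fun σ : ℝ => d * (1 + σ)) (𝓝[>] 0) (𝓝[>] d) := by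
    refine tendsto_nhdsWithin_iff.mpr ⟨?_, ?_⟩
    · have h2 : Continuous fun σ : ℝ => d * (1 + σ) := by fun_prop
      have h3 := h2.tendsto 0
      rw [add_zero, mul_one] at h3
      exact h3.mono_left nhdsWithin_le_nhds
    · filter_upwards [self_mem_nhdsWithin] with σ hσ
      exact lt_mul_of_one_lt_right hd (lt_add_of_pos_right 1 hσ)
  refine ((hL.comp h1).div_const d).congr' ?_
  filter_upwards [self_mem_nhdsWithin] with σ hσ
  have hσ0 : 0 < σ := hσ
  have h4 : S.zeta (d * (1 + σ)) = ∑' n, mu (S.absPow d) n ^ (1 + σ) := by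
    rw [zeta, posTrace]
    refine tsum_congr fun n => ?_
    simp only [mu_absPow S hH hd.le, mu_absPow S hH (show 0 ≤ d * (1 + σ) by positivity)]
    rw [Real.rpow_mul (mu_nonneg _ n)]
  rw [Function.comp_apply, h4]
  field_simp
  ring

theorem tendsto_partialSum_absPow (hd : 0 < d) (hdim : S.dimension = ENNReal.ofReal d)
    (hL : Tendsto (fun s : ℝ => (s - d) * S.zeta s) (𝓝[>] d) (𝓝 L)) :
    Tendsto (fun n : ℕ => partialSum (S.absPow d) n / Real.log n) atTop (𝓝 (L / d)) := by
  have hH := not_finiteDimensional hd hdim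
  have hT := isCompactOperator_absPow S hH hd
  exact tendsto_sum_div_log (mu_pos hH hT fun x => absPow_injective S hd x) (mu_antitone hH hT)
    (fun σ hσ => (summable_mu_absPow_rpow_iff hH hd (by linarith)).mpr
      (isTraceClass_absPow_of_lt hd hdim
        (lt_mul_of_one_lt_right hd (lt_add_of_pos_right 1 hσ))))
    (tendsto_mul_tsum_mu_absPow hH hd hL)

theorem residue_div_nonneg (hd : 0 < d) (hdim : S.dimension = ENNReal.ofReal d)
    (hL : Tendsto (fun s : ℝ => (s - d) * S.zeta s) (𝓝[>] d) (𝓝 L)) : 0 ≤ L / d :=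
  ge_of_tendsto' (tendsto_partialSum_absPow hd hdim hL) fun n =>
    div_nonneg (partialSum_nonneg _ _) (Real.log_natCast_nonneg n)

/-- A generalised limit `ω` which on the ideal of `|D|^{-d}` is given by `η` along `ν` turns the
Hausdorff functional into a multiple of the functional of the associated trace. -/
theorem hausdorffFunctional_eq (hd : 0 < d) (hdim : S.dimension = ENNReal.ofReal d)
    (hL : Tendsto (fun s : ℝ => (s - d) * S.zeta s) (𝓝[>] d) (𝓝 L)) {ω η : GeneralizedLimit}
    {ν : ℕ → ℕ} (hν : Tendsto ν atTop atTop)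
    (h : ∀ P ∈ TwoSidedIdeal.span ({S.absPow d} : Set (H →L[ℂ] H)),
      (dixmierTrace ω P).toReal = η.lim fun k => partialSum P (ν k) / Real.log (ν k)) (a : A) :
    S.hausdorffFunctional ω d a = ((L / d : ℝ) : ℂ) *
      S.besicovitchFunctional (associatedTrace (S.absPow d) ν η) d a := by
  have hH := not_finiteDimensional hd hdim
  have hT := isCompactOperator_absPow S hH hd
  have hlim := tendsto_partialSum_absPow hd hdim hL
  refine linExt_eq_mul_of_forall_mem_span (fun P _ hP => ?_) (mul_absPow_mem_span S a d)
  -- If `L = 0`, then `|D|^{-d}` is in `L_0^{1,∞}` and the Dixmier trace vanishes on its ideal, so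
  -- eccentricity is not needed there.
  rcases (residue_div_nonneg hd hdim hL).eq_or_lt with h0 | h0
  · rw [← h0, zero_mul]
    refine toReal_dixmierTrace_eq_zero hH ω ⟨hT, ?_⟩ hP
    refine (isLittleO_iff_tendsto' ?_).mpr (by rwa [← h0] at hlim)
    filter_upwards [tendsto_log_natCast.eventually_gt_atTop 0] with n hn hn0
    exact absurd hn0 hn.ne'
  · rw [h P hP, toReal_associatedTrace hH hT (mu_pos hH hT fun x => absPow_injective S hd x) h0
      hlim hν η hP]

end Residue

end SpectralTriple

end DixmierGeometry

end

/-! ### The theorem -/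

open DixmierGeometry

theorem theorem3p4 {A : Type*} [NonUnitalRing A] [Module ℂ A] [IsScalarTower ℂ A A]
    [SMulCommClass ℂ A A] {H : Type*} [NormedAddCommGroup H] [InnerProductSpace ℂ H]
    [CompleteSpace H] (S : DixmierGeometry.SpectralTriple A H)
    (d : ℝ) (hd : 0 < d) (hdim : S.dimension = ENNReal.ofReal d) :
    -- (i)
    (∀ ω : DixmierGeometry.GeneralizedLimit, ω.IsDilationInvariant →
      ∀ α : ℝ, 0 < α → S.HausdorffNontrivial ω α → α = d) ∧
    -- (ii)
    ((DixmierGeometry.ord S.invD)⁻¹ = (d : EReal) ∧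
      IsLUB {γ : ℝ | 0 < γ ∧ ¬ DixmierGeometry.IsTraceClass (S.absPow γ)} d ∧
      DixmierGeometry.IsExponentOfSingularTraceability S.invD d) ∧
    -- (iii)
    (∀ L : ℝ, Tendsto (fun s : ℝ => (s - d) * S.zeta s) (𝓝[>] d) (𝓝 L) →
      -- every Hausdorff functional is `L / d` times the Hausdorff–Besicovitch functional
      -- with the same generalised limit
      (∀ ω : DixmierGeometry.GeneralizedLimit, ω.IsDilationInvariant →
        DixmierGeometry.dixmierTrace ω (S.absPow d) = ENNReal.ofReal (L / d) ∧
        ∀ a : A, S.hausdorffFunctional ω d a = ((L / d : ℝ) : ℂ) *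
          S.besicovitchFunctional (DixmierGeometry.associatedTrace (S.absPow d) id ω) d a) ∧
      -- for every Hausdorff–Besicovitch functional associated with `|D|^{-d}`, its multiple
      -- by `L / d` is a Hausdorff functional
      (∀ (ν : ℕ → ℕ) (η : DixmierGeometry.GeneralizedLimit), StrictMono ν →
        ∃ ω : DixmierGeometry.GeneralizedLimit, ω.IsDilationInvariant ∧
          ∀ a : A, S.hausdorffFunctional ω d a = ((L / d : ℝ) : ℂ) *
            S.besicovitchFunctional (DixmierGeometry.associatedTrace (S.absPow d) ν η) d a) ∧
      -- for `L ≠ 0` all these functionals do come from normalised singular traces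
      (L ≠ 0 → ∀ (ν : ℕ → ℕ) (η : DixmierGeometry.GeneralizedLimit), StrictMono ν →
        DixmierGeometry.IsSingularTrace (DixmierGeometry.associatedTrace (S.absPow d) ν η) ∧
          DixmierGeometry.associatedTrace (S.absPow d) ν η (S.absPow d) = 1)) := by
  have hH := SpectralTriple.not_finiteDimensional hd hdim
  have hT := SpectralTriple.isCompactOperator_absPow S hH hd
  have hinj := fun x => SpectralTriple.absPow_injective S hd x
  refine ⟨fun ω _ α hα h => SpectralTriple.eq_of_hausdorffNontrivial hd hdim hα h,
    ⟨SpectralTriple.ord_invD_inv hd hdim, SpectralTriple.isLUB_not_isTraceClass hd hdim,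
      SpectralTriple.isExponentOfSingularTraceability_invD hd hdim⟩, fun L hL => ?_⟩
  have hlim := SpectralTriple.tendsto_partialSum_absPow hd hdim hL
  have hmem := memL1Inf_of_tendsto_div_log hT hlim
  -- For (a) the formula for the Dixmier trace is its definition; for (b) the witness is the average
  -- of `η` over dilates along `ν`.
  refine ⟨fun ω _ => ⟨?_, SpectralTriple.hausdorffFunctional_eq hd hdim hL tendsto_id fun P hP =>
    toReal_dixmierTrace ω (memL1Inf_of_mem_span hH hmem hP)⟩, fun ν η hν =>
    ⟨η.dilationAverage ν hν.tendsto_atTop, η.isDilationInvariant_dilationAverage hν.tendsto_atTop,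
      SpectralTriple.hausdorffFunctional_eq hd hdim hL hν.tendsto_atTop fun P hP =>
        toReal_dixmierTrace_dilationAverage hH hT hlim hν.tendsto_atTop η hP⟩,
    fun hL0 ν η hν => ?_⟩
  · rw [dixmierTrace, if_pos hmem, ω.lim_of_tendsto hlim]
  · have hpos : 0 < L / d := (SpectralTriple.residue_div_nonneg hd hdim hL).lt_of_ne'
      (div_ne_zero hL0 hd.ne')
    exact ⟨isSingularTrace_associatedTrace hH hT hinj
      (isEccentricAlong_of_tendsto_div_log hpos hlim hν.tendsto_atTop) η,
      associatedTrace_self hH hT hinj hν.tendsto_atTop η⟩
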